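/- Let $\mathbb K$ be a field of characteristic zero. An orthogonal category $\overline{\mathbf C}=(\mathbf C,\perp)$ is a small category $\mathbf C$ with a symmetric relation $f_1\perp f_2$ on pairs of morphisms $f_1:c_1\to t$, $f_2:c_2\to t$ with common target such that $f_1\perp f_2$ implies $g f_1 h_1\perp g f_2 h_2$ for all composable $g,h_1,h_2$. **Ordinary AQFTs.** $\mathbf{AQFT}(\overline{\mathbf C})$ is the full subcategory of the category of functors $\mathfrak A$ from $\mathbf C$ to associative unital $\mathbb K$-algebras on those $\mathfrak A$ for which $\mathfrak A(f_1)(a_1)$ and $\mathfrak A(f_2)(a_2)$ commute whenever $f_1\perp f_2$. It is regarded as a $2$-category with only identity $2$-morphisms. **2AQFTs.** For $\underline c=(c_1,\dots,c_n)$, $n\ge 0$, an $n$-tuple $\underline f:\underline c\to t$ is a tuple of morphisms $f_i:c_i\to t$ with $f_i\perp f_j$ for $i\ne j$; tuples compose by concatenation, and permutations act on them. These are the operations of a coloured operad $\mathcal P_{\overline{\mathbf C}}$. Let $\mathbf{Pr}_{\mathbb K}$ be the $\mathbf{Cat}$-enriched coloured operad whose colours are locally presentable $\mathbb K$-linear categories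 and whose $n$-ary operations are functors $\prod_{i=1}^n\mathbf D_i\to\mathbf T$ that are $\mathbb K$-linear and co-continuous in each variable, with natural transformations between them. $\mathbf{2AQFT}(\overline{\mathbf C})=[\mathcal P_{\overline{\mathbf C}},\mathbf{Pr}_{\mathbb K}]$ is the $2$-category of pseudo-morphisms of operads $\mathfrak B:\mathcal P_{\overline{\mathbf C}}\to\mathbf{Pr}_{\mathbb K}$ (categories $\mathfrak B(c)$, factorization products $\mathfrak B(\underline f):\prod_i\mathfrak B(c_i)\to\mathfrak B(t)$, and coherent natural isomorphisms for composition, identities and permutations), pseudo-transformations $\zeta$ (co-continuous $\mathbb K$-linear functors $\zeta_c$ with coherent natural isomorphisms $\mathfrak B(\underline f)\circ\prod_i\zeta_{c_i}\cong\zeta_t\circ\mathfrak A(\underline f)$) and modifications. The *pointing* $\mathbf b_t\in\mathfrak B(t)$ is the value of the factorization product of the empty tuple; a $1$-morphism $\zeta:\mathfrak A\to\mathfrak B$ contains isomorphisms $\zeta_{*}:\mathbf b_t\cong\zeta_t(\mathbf a_t)$. **Inclusion.** The pseudo-functor $\iota:\mathbf{AQFT}(\overline{\mathbf C})\to\mathbf{2AQFT}(\overline{\mathbf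 C})$ sends $\mathfrak A$ to the 2AQFT with $\iota(\mathfrak A)(c)=\mathbf{Mod}_{\mathfrak A(c)}$ (right modules), with factorization products $(M_1,\dots,M_n)\mapsto\big(\bigotimes_i M_i\big)\otimes_{\bigotimes_i\mathfrak A(c_i)}\mathfrak A(t)$ (for $n=0$ this is the free module $\mathfrak A(t)$), and with the canonical coherence isomorphisms. It sends a morphism $\zeta:\mathfrak A\to\mathfrak A'$ to the induction functors $(-)\otimes_{\mathfrak A(c)}\mathfrak A'(c)$ with their canonical coherences. **Truncation.** The $2$-functor $\pi:\mathbf{2AQFT}(\overline{\mathbf C})\to\mathbf{AQFT}(\overline{\mathbf C})$ sends $\mathfrak B$ to the AQFT $c\mapsto\mathrm{End}(\mathbf b_c)$, where $f:c\to t$ acts by conjugating $\mathfrak B(f):\mathrm{End}(\mathbf b_c)\to\mathrm{End}(\mathfrak B(f)(\mathbf b_c))$ with the coherence isomorphism $\mathfrak B(f)(\mathbf b_c)\cong\mathbf b_t$. It sends $\zeta$ to $\pi(\zeta)_c(h)=\zeta_*^{-1}\circ\zeta_c(h)\circ\zeta_*$ and every $2$-morphism to an identity. **Unit.** Let $\eta:\mathrm{id}\Rightarrow\pi\,\iota$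 be given by $\eta_{\mathfrak A,c}:\mathfrak A(c)\to\mathrm{End}(\mathfrak A(c))$, $a\mapsto$ left multiplication by $a$ on the free right module of rank one. **Theorem.** For every orthogonal category $\overline{\mathbf C}$: 1. For all $\mathfrak A\in\mathbf{AQFT}(\overline{\mathbf C})$ and $\mathfrak B\in\mathbf{2AQFT}(\overline{\mathbf C})$ the functor $$\mathbf{2AQFT}(\overline{\mathbf C})(\iota\mathfrak A,\mathfrak B)\longrightarrow\mathbf{AQFT}(\overline{\mathbf C})(\mathfrak A,\pi\mathfrak B),\qquad \zeta\mapsto\pi(\zeta)\circ\eta_{\mathfrak A},$$ whose target is a discrete category, is an equivalence of categories. 2. There is a biadjunction $\iota\dashv\pi$ with unit $\eta$: there are a pseudo-natural transformation $\epsilon:\iota\,\pi\Rightarrow\mathrm{id}$ and invertible modifications filling the two triangles for $(\eta,\epsilon)$ that satisfy the two swallowtail identities. 3. Each $\eta_{\mathfrak A}:\mathfrak A\to\pi\iota\mathfrak A$ is an isomorphism. 4. The biadjunction exhibits $\mathbf{AQFT}(\overline{\mathbf C})$ as a coreflective full $2$-subcategory of $\mathbf{2AQFT}(\overline{\mathbf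 C})$: the functors $\mathbf{AQFT}(\overline{\mathbf C})(\mathfrak A,\mathfrak A')\to\mathbf{2AQFT}(\overline{\mathbf C})(\iota\mathfrak A,\iota\mathfrak A')$ induced by $\iota$ are equivalences of categories. -/

import Mathlib

open CategoryTheory CategoryTheory.Limits

universe w v u

namespace QFT

/-! ### Orthogonal categories -/

/-- An orthogonality relation on a category `C`. -/
structure Orthogonality (C : Type u) [Category.{v} C] where
  /-- The relation `f₁ ⊥ f₂` on pairs of morphisms with a common target. -/
  perp : ∀ {c₁ c₂ t : C}, (c₁ ⟶ t) → (c₂ ⟶ t) → Prop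
  symm : ∀ {c₁ c₂ t : C} {f₁ : c₁ ⟶ t} {f₂ : c₂ ⟶ t}, perp f₁ f₂ → perp f₂ f₁
  comp : ∀ {b₁ b₂ c₁ c₂ t s : C} {f₁ : c₁ ⟶ t} {f₂ : c₂ ⟶ t}
    (h₁ : b₁ ⟶ c₁) (h₂ : b₂ ⟶ c₂) (g : t ⟶ s), perp f₁ f₂ → perp (h₁ ≫ f₁ ≫ g) (h₂ ≫ f₂ ≫ g)

/-- A family `f i : c i ⟶ t` of mutually orthogonal morphisms.  For `I = Fin n` these are the
`n`-ary operations of the prefactorization operad; other (finite) index types `I` occur only as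
bookkeeping devices before they are numbered by some `Fin m`. -/
@[ext]
structure OrthTuple {C : Type u} [Category.{v} C] (P : Orthogonality C) {I : Type}
    (c : I → C) (t : C) where
  hom : ∀ i, c i ⟶ t
  perp : ∀ i j, i ≠ j → P.perp (hom i) (hom j)

/-- The bijection numbering the concatenation of `n` tuples of lengths `k i`, in lexicographic
order. -/
def seq {n : ℕ} (k : Fin n → ℕ) : Fin (∑ i, k i) ≃ (Σ i, Fin (k i)) :=
  finSigmaFinEquiv.symm

/-- The evident bijection `{1,…,n} ≅ {1} × {1,…,n}`. -/
@[simps]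
def oneSigma (n : ℕ) : Fin n ≃ (Σ _ : Fin 1, Fin n) where
  toFun i := ⟨0, i⟩
  invFun s := s.2
  left_inv _ := rfl
  right_inv := by rintro ⟨i, j⟩; rw [Subsingleton.elim i 0]

/-- The evident bijection `{1,…,n} ≅ {1,…,n} × {1}`. -/
@[simps]
def sigmaOne (n : ℕ) : Fin n ≃ (Σ _ : Fin n, Fin 1) where
  toFun i := ⟨i, 0⟩
  invFun s := s.1
  left_inv _ := rfl
  right_inv := by rintro ⟨i, j⟩; rw [Subsingleton.elim j 0]

namespace OrthTuple

variable {C : Type u} [Category.{v} C] {P : Orthogonality C}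

/-- Reindexing a tuple, `(f σ)_j = f_{σ j}`. -/
@[simps]
def reindex {I J : Type} {c : I → C} {t : C} (f : OrthTuple P c t) (σ : J ≃ I) :
    OrthTuple P (fun j => c (σ j)) t where
  hom j := f.hom (σ j)
  perp _ _ h := f.perp _ _ (fun e => h (σ.injective e))

/-- The family `(f_i g_{ij})` indexed by the pairs `(i, j)`. -/
@[simps]
def sigma {I : Type} {J : I → Type} {a : I → C} {b : ∀ i, J i → C} {t : C}
    (f : OrthTuple P a t) (g : ∀ i, OrthTuple P (b i) (a i)) :
    OrthTuple P (fun p : (Σ i, J i) => b p.1 p.2) t where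
  hom p := (g p.1).hom p.2 ≫ f.hom p.1
  perp := by
    rintro ⟨i, j⟩ ⟨i', j'⟩ h
    by_cases hi : i = i'
    · subst hi
      have := P.comp (𝟙 _) (𝟙 _) (f.hom i) ((g i).perp j j' (by rintro rfl; exact h rfl))
      simpa using this
    · have := P.comp ((g i).hom j) ((g i').hom j') (𝟙 t) (f.perp i i' hi)
      simpa using this

/-- Operadic composition: the concatenated tuple `(f_1 g_{11}, …, f_n g_{n k_n})`. -/
def comp {n : ℕ} {k : Fin n → ℕ} {a : Fin n → C} {b : ∀ i, Fin (k i) → C} {t : C}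
    (f : OrthTuple P a t) (g : ∀ i, OrthTuple P (b i) (a i)) :
    OrthTuple P (fun p => b (seq k p).1 (seq k p).2) t :=
  (f.sigma g).reindex (seq k)

/-- The `1`-tuple consisting of a single morphism. -/
@[simps]
def single (P : Orthogonality C) {c t : C} (f : c ⟶ t) : OrthTuple P (fun _ : Fin 1 => c) t where
  hom _ := f
  perp i j h := (h (Subsingleton.elim i j)).elim

/-- The identity operation. -/
def one (P : Orthogonality C) (t : C) : OrthTuple P (fun _ : Fin 1 => t) t := single P (𝟙 t)

/-- The operation of arity zero. -/
@[simps]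
def star (P : Orthogonality C) (t : C) : OrthTuple P (fun i : Fin 0 => i.elim0) t where
  hom i := i.elim0
  perp i := i.elim0

lemma sigma_assoc {I : Type} {J : I → Type} {L : ∀ i, J i → Type} {a : I → C}
    {b : ∀ i, J i → C} {d : ∀ i j, L i j → C} {t : C}
    (f : OrthTuple P a t) (g : ∀ i, OrthTuple P (b i) (a i))
    (h : ∀ i j, OrthTuple P (d i j) (b i j)) :
    (((f.sigma g).sigma (fun p => h p.1 p.2)).reindex (Equiv.sigmaAssoc L).symm :
      OrthTuple P (fun s : (Σ i, Σ j, L i j) => d s.1 s.2.1 s.2.2) t) =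
      f.sigma (fun i => (g i).sigma (h i)) := by
  ext s
  exact (Category.assoc _ _ _).symm

lemma one_sigma {n : ℕ} {c : Fin n → C} {t : C} (f : OrthTuple P c t) :
    (OrthTuple.one P t).sigma (fun _ => f) = f.reindex (oneSigma n).symm := by
  ext s
  exact Category.comp_id _

lemma sigma_one {n : ℕ} {c : Fin n → C} {t : C} (f : OrthTuple P c t) :
    f.sigma (fun i => OrthTuple.one P (c i)) = f.reindex (sigmaOne n).symm := by
  ext s
  exact Category.id_comp _

end OrthTuple

/-! ### Ordinary AQFTs -/

/-- `⊥`-commutativity of a functor to algebras. -/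
def perpCommutative (K : Type w) [Field K] {C : Type u} [Category.{v} C] (P : Orthogonality C) :
    ObjectProperty (C ⥤ AlgCat.{w} K) := fun A =>
  ∀ ⦃c₁ c₂ t : C⦄ (f₁ : c₁ ⟶ t) (f₂ : c₂ ⟶ t), P.perp f₁ f₂ →
    ∀ (a₁ : A.obj c₁) (a₂ : A.obj c₂),
      (A.map f₁).hom a₁ * (A.map f₂).hom a₂ = (A.map f₂).hom a₂ * (A.map f₁).hom a₁

/-- The category of AQFTs: the full subcategory of `⊥`-commutative functors. -/
abbrev AQFT (K : Type w) [Field K] {C : Type u} [Category.{v} C] (P : Orthogonality C) :=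
  (perpCommutative K P).FullSubcategory

/-! ### Locally presentable `K`-linear categories -/

/-- Locally presentable `K`-linear categories. -/
structure PrLin (K : Type w) [Field K] where
  carrier : Type (w + 1)
  [category : Category.{w} carrier]
  [preadditive : Preadditive carrier]
  [linear : Linear K carrier]
  [locallyPresentable : IsLocallyPresentable.{w} carrier]

namespace PrLin

variable {K : Type w} [Field K]

instance : CoeSort (PrLin K) (Type (w + 1)) := ⟨PrLin.carrier⟩

instance (D : PrLin K) : Category.{w} D := D.category
instance (D : PrLin K) : Preadditive D := D.preadditive
instance (D : PrLin K) : Linear K D := D.linear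
instance (D : PrLin K) : IsLocallyPresentable.{w} D := D.locallyPresentable

/-- The functor `D i ⥤ ∏ j, D j` that puts its argument into the slot `i` and the fixed objects
`X j` into the slots `j ≠ i`. -/
def insertVar {n : ℕ} {D : Fin n → PrLin K} (X : ∀ j, D j) (i : Fin n) : D i ⥤ (∀ j, D j) :=
  Functor.pi' fun j =>
    if h : i = j then (Pi.eqToEquivalence (fun j => (D j : Type (w + 1))) h).functor
    else (Functor.const _).obj (X j)

/-- Functors `∏ i, D i ⥤ T` which are `K`-linear and co-continuous in each variable. -/
structure MultFunctor {n : ℕ} (D : Fin n → PrLin K) (T : PrLin K) extends (∀ i, D i) ⥤ T where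
  map_add : ∀ {X Y : ∀ i, D i} (h : ∀ i, X i ⟶ Y i) (i : Fin n) (g g' : X i ⟶ Y i),
    toFunctor.map (X := X) (Y := Y) (Function.update h i (g + g')) =
      toFunctor.map (X := X) (Y := Y) (Function.update h i g) +
        toFunctor.map (X := X) (Y := Y) (Function.update h i g')
  map_smul : ∀ {X Y : ∀ i, D i} (h : ∀ i, X i ⟶ Y i) (i : Fin n) (r : K) (g : X i ⟶ Y i),
    toFunctor.map (X := X) (Y := Y) (Function.update h i (r • g)) =
      r • toFunctor.map (X := X) (Y := Y) (Function.update h i g)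
  cocontinuous : ∀ (X : ∀ i, D i) (i : Fin n),
    PreservesColimitsOfSize.{w, w} (insertVar X i ⋙ toFunctor)

namespace MultFunctor

variable {n : ℕ} {D : Fin n → PrLin K} {T : PrLin K} (F : MultFunctor D T)

/-- The action of `F` on a family of morphisms. -/
def mapFam {X Y : ∀ i, D i} (h : ∀ i, X i ⟶ Y i) : F.obj X ⟶ F.obj Y :=
  F.toFunctor.map (X := X) (Y := Y) h

@[simp]
lemma mapFam_id (X : ∀ i, D i) : F.mapFam (fun i => 𝟙 (X i)) = 𝟙 (F.obj X) :=
  F.toFunctor.map_id X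

lemma mapFam_comp {X Y Z : ∀ i, D i} (h : ∀ i, X i ⟶ Y i) (h' : ∀ i, Y i ⟶ Z i) :
    F.mapFam (fun i => h i ≫ h' i) = F.mapFam h ≫ F.mapFam h' :=
  F.toFunctor.map_comp (X := X) (Y := Y) (Z := Z) h h'

end MultFunctor

/-- Co-continuous `K`-linear functors. -/
structure LinFunctor (D E : PrLin K) extends D ⥤ E where
  map_add : ∀ {X Y : D} (g g' : X ⟶ Y), toFunctor.map (g + g') = toFunctor.map g + toFunctor.map g'
  map_smul : ∀ {X Y : D} (r : K) (g : X ⟶ Y), toFunctor.map (r • g) = r • toFunctor.map g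
  cocontinuous : PreservesColimitsOfSize.{w, w} toFunctor

namespace LinFunctor

/-- The identity functor. -/
abbrev id (D : PrLin K) : LinFunctor D D where
  toFunctor := 𝟭 D
  map_add _ _ := rfl
  map_smul _ _ := rfl
  cocontinuous := inferInstance

/-- Composition of functors. -/
abbrev comp {D E T : PrLin K} (F : LinFunctor D E) (G : LinFunctor E T) : LinFunctor D T where
  toFunctor := F.toFunctor ⋙ G.toFunctor
  map_add _ _ := by simp [F.map_add, G.map_add]
  map_smul _ _ := by simp [F.map_smul, G.map_smul]
  cocontinuous := by
    have := F.cocontinuous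
    have := G.cocontinuous
    infer_instance

end LinFunctor

end PrLin

open PrLin

/-! ### 2AQFTs -/

/-- The data of a pseudo-morphism from the prefactorization operad to the operad of locally
presentable `K`-linear categories. -/
structure TwoAQFTData (K : Type w) [Field K] {C : Type u} [Category.{v} C]
    (P : Orthogonality C) where
  cat : C → PrLin K
  /-- the factorization products -/
  op : ∀ {n : ℕ} {c : Fin n → C} {t : C}, OrthTuple P c t → MultFunctor (fun i => cat (c i)) (cat t)
  /-- the coherences for composition -/
  compIso : ∀ {n : ℕ} {k : Fin n → ℕ} {a : Fin n → C} {b : ∀ i, Fin (k i) → C} {t : C}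
    (f : OrthTuple P a t) (g : ∀ i, OrthTuple P (b i) (a i)) (X : ∀ i j, cat (b i j)),
    (op f).obj (fun i => (op (g i)).obj (X i)) ≅
      (op (f.comp g)).obj (fun p => X (seq k p).1 (seq k p).2)
  /-- the coherences for identities -/
  unitIso : ∀ (t : C) (X : Fin 1 → cat t), X 0 ≅ (op (OrthTuple.one P t)).obj X
  /-- the coherences for permutations (here necessarily `m = n`) -/
  permIso : ∀ {n m : ℕ} {c : Fin n → C} {t : C} (f : OrthTuple P c t) (σ : Fin m ≃ Fin n)
    (X : ∀ i, cat (c i)), (op f).obj X ≅ (op (f.reindex σ)).obj (fun j => X (σ j))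

namespace TwoAQFTData

variable {K : Type w} [Field K] {C : Type u} [Category.{v} C] {P : Orthogonality C}
  (A : TwoAQFTData K P)

lemma renum_aux {I : Type} {c : I → C} {t : C} {F F' : OrthTuple P c t} (h : F = F')
    {n m : ℕ} (e₁ : Fin n ≃ I) (e₂ : Fin m ≃ I) (X : ∀ i, A.cat (c i)) :
    (A.op ((F.reindex e₁).reindex (e₂.trans e₁.symm))).obj
        (fun i => X (e₁ ((e₂.trans e₁.symm) i))) =
      (A.op (F'.reindex e₂)).obj (fun i => X (e₂ i)) := by
  subst h
  have key : ∀ e : Fin m ≃ I, e = e₂ →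
      (A.op (F.reindex e)).obj (fun i => X (e i)) =
        (A.op (F.reindex e₂)).obj (fun i => X (e₂ i)) := by
    rintro _ rfl
    rfl
  exact key ((e₂.trans e₁.symm).trans e₁) (by ext; simp)

/-- If an orthogonal family indexed by a finite set `I` is listed in two ways `e₁`, `e₂` as a tuple,
then the coherence for the permutation `e₁⁻¹ e₂` compares the two factorization products.  (The
permuted first tuple equals the second one, which is what the `eqToHom` records.) -/
def renum {I : Type} {c : I → C} {t : C} {F F' : OrthTuple P c t} (h : F = F')
    {n m : ℕ} (e₁ : Fin n ≃ I) (e₂ : Fin m ≃ I) (X : ∀ i, A.cat (c i)) :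
    (A.op (F.reindex e₁)).obj (fun i => X (e₁ i)) ⟶
      (A.op (F'.reindex e₂)).obj (fun i => X (e₂ i)) :=
  (A.permIso (F.reindex e₁) (e₂.trans e₁.symm) (fun i => X (e₁ i))).hom ≫
    eqToHom (A.renum_aux h e₁ e₂ X)

end TwoAQFTData

/-- The first way of numbering a threefold concatenation. -/
def seqL {n : ℕ} {k : Fin n → ℕ} (l : ∀ i, Fin (k i) → ℕ) :
    Fin (∑ p : Fin (∑ i, k i), l (seq k p).1 (seq k p).2) ≃
      (Σ i, Σ j : Fin (k i), Fin (l i j)) :=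
  ((seq (fun p : Fin (∑ i, k i) => l (seq k p).1 (seq k p).2)).trans
    (Equiv.sigmaCongrLeft (β := fun s : (Σ i, Fin (k i)) => Fin (l s.1 s.2)) (seq k))).trans
    (Equiv.sigmaAssoc (fun i j => Fin (l i j)))

/-- The second way of numbering a threefold concatenation. -/
def seqR {n : ℕ} {k : Fin n → ℕ} (l : ∀ i, Fin (k i) → ℕ) :
    Fin (∑ i, ∑ j, l i j) ≃ (Σ i, Σ j : Fin (k i), Fin (l i j)) :=
  (seq (fun i => ∑ j, l i j)).trans (Equiv.sigmaCongrRight fun i => seq (l i))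

/-- A 2AQFT: a pseudo-morphism of `Cat`-enriched coloured operads from the prefactorization operad
of an orthogonal category to the operad of locally presentable `K`-linear categories. -/
structure TwoAQFT (K : Type w) [Field K] {C : Type u} [Category.{v} C]
    (P : Orthogonality C) extends TwoAQFTData K P where
  comp_naturality : ∀ {n : ℕ} {k : Fin n → ℕ} {a : Fin n → C} {b : ∀ i, Fin (k i) → C} {t : C}
    (f : OrthTuple P a t) (g : ∀ i, OrthTuple P (b i) (a i)) {X Y : ∀ i j, cat (b i j)}
    (h : ∀ i j, X i j ⟶ Y i j),
    (op f).mapFam (fun i => (op (g i)).mapFam (h i)) ≫ (compIso f g Y).hom =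
      (compIso f g X).hom ≫ (op (f.comp g)).mapFam (fun p => h (seq k p).1 (seq k p).2)
  unit_naturality : ∀ (t : C) {X Y : Fin 1 → cat t} (h : ∀ i, X i ⟶ Y i),
    h 0 ≫ (unitIso t Y).hom = (unitIso t X).hom ≫ (op (OrthTuple.one P t)).mapFam h
  perm_naturality : ∀ {n m : ℕ} {c : Fin n → C} {t : C} (f : OrthTuple P c t) (σ : Fin m ≃ Fin n)
    {X Y : ∀ i, cat (c i)} (h : ∀ i, X i ⟶ Y i),
    (op f).mapFam h ≫ (permIso f σ Y).hom =
      (permIso f σ X).hom ≫ (op (f.reindex σ)).mapFam (fun j => h (σ j))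
  /-- associativity -/
  comp_assoc : ∀ {n : ℕ} {k : Fin n → ℕ} {l : ∀ i, Fin (k i) → ℕ} {a : Fin n → C}
    {b : ∀ i, Fin (k i) → C} {d : ∀ i j, Fin (l i j) → C} {t : C}
    (f : OrthTuple P a t) (g : ∀ i, OrthTuple P (b i) (a i))
    (h : ∀ i j, OrthTuple P (d i j) (b i j)) (X : ∀ i j r, cat (d i j r)),
    (compIso f g (fun i j => (op (h i j)).obj (X i j))).hom ≫
      (compIso (f.comp g) (fun p => h (seq k p).1 (seq k p).2)
        (fun p => X (seq k p).1 (seq k p).2)).hom ≫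
      toTwoAQFTData.renum
        (F := ((f.sigma g).sigma (fun p => h p.1 p.2)).reindex (Equiv.sigmaAssoc _).symm)
        (F' := f.sigma (fun i => (g i).sigma (h i)))
        (OrthTuple.sigma_assoc f g h) (seqL l) (seqR l) (fun s => X s.1 s.2.1 s.2.2) =
    (op f).mapFam (fun i => (compIso (g i) (h i) (X i)).hom) ≫
      (compIso f (fun i => (g i).comp (h i))
        (fun i p => X i (seq (l i) p).1 (seq (l i) p).2)).hom
  /-- left unitality -/
  one_comp : ∀ {n : ℕ} {c : Fin n → C} {t : C} (f : OrthTuple P c t) (X : ∀ i, cat (c i)),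
    (unitIso t (fun _ => (op f).obj X)).hom ≫
      (compIso (OrthTuple.one P t) (fun _ => f) (fun _ => X)).hom ≫
      toTwoAQFTData.renum (F := (OrthTuple.one P t).sigma (fun _ => f))
        (F' := f.reindex (oneSigma n).symm) (OrthTuple.one_sigma f) (seq (fun _ : Fin 1 => n))
        (oneSigma n) (fun s => X s.2) = 𝟙 _
  /-- right unitality -/
  comp_one : ∀ {n : ℕ} {c : Fin n → C} {t : C} (f : OrthTuple P c t) (X : ∀ i, cat (c i)),
    (op f).mapFam (fun i => (unitIso (c i) (fun _ => X i)).hom) ≫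
      (compIso f (fun i => OrthTuple.one P (c i)) (fun i _ => X i)).hom ≫
      toTwoAQFTData.renum (F := f.sigma (fun i => OrthTuple.one P (c i)))
        (F' := f.reindex (sigmaOne n).symm) (OrthTuple.sigma_one f) (seq (fun _ : Fin n => 1))
        (sigmaOne n) (fun s => X s.1) = 𝟙 _
  /-- the permutation coherences are unital and multiplicative -/
  perm_refl : ∀ {n : ℕ} {c : Fin n → C} {t : C} (f : OrthTuple P c t) (X : ∀ i, cat (c i)),
    (permIso f (Equiv.refl _) X).hom = 𝟙 _
  perm_trans : ∀ {n m l : ℕ} {c : Fin n → C} {t : C} (f : OrthTuple P c t)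
    (σ : Fin m ≃ Fin n) (σ' : Fin l ≃ Fin m) (X : ∀ i, cat (c i)),
    (permIso f σ X).hom ≫ (permIso (f.reindex σ) σ' (fun j => X (σ j))).hom =
      (permIso f (σ'.trans σ) X).hom
  /-- equivariance for permutations of the outer operation; here `renum` is the coherence for the
  block permutation of the concatenated tuple that is induced by `σ` -/
  comp_perm_left : ∀ {n m : ℕ} {k : Fin n → ℕ} {a : Fin n → C} {b : ∀ i, Fin (k i) → C} {t : C}
    (f : OrthTuple P a t) (g : ∀ i, OrthTuple P (b i) (a i)) (σ : Fin m ≃ Fin n)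
    (X : ∀ i j, cat (b i j)),
    (compIso f g X).hom ≫
      toTwoAQFTData.renum (F := f.sigma g) (F' := f.sigma g) rfl (seq k)
        ((seq (fun i => k (σ i))).trans
          (Equiv.sigmaCongrLeft (β := fun i => Fin (k i)) σ))
        (fun p => X p.1 p.2) =
    (permIso f σ (fun i => (op (g i)).obj (X i))).hom ≫
      (compIso (f.reindex σ) (fun i => g (σ i)) (fun i => X (σ i))).hom
  /-- equivariance for permutations of the inner operations; here `renum` is the coherence for the
  sum of the permutations `σ i` -/
  comp_perm_right : ∀ {n : ℕ} {k k' : Fin n → ℕ} {a : Fin n → C} {b : ∀ i, Fin (k i) → C} {t : C}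
    (f : OrthTuple P a t) (g : ∀ i, OrthTuple P (b i) (a i)) (σ : ∀ i, Fin (k' i) ≃ Fin (k i))
    (X : ∀ i j, cat (b i j)),
    (compIso f g X).hom ≫
      toTwoAQFTData.renum (F := f.sigma g) (F' := f.sigma g) rfl (seq k)
        ((seq k').trans (Equiv.sigmaCongrRight σ)) (fun p => X p.1 p.2) =
    (op f).mapFam (fun i => (permIso (g i) (σ i) (X i)).hom) ≫
      (compIso f (fun i => (g i).reindex (σ i)) (fun i j => X i (σ i j))).hom

end QFT

namespace QFT
open PrLin

namespace TwoAQFT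

variable {K : Type w} [Field K] {C : Type u} [Category.{v} C] {P : Orthogonality C}

/-- 1-morphisms of 2AQFTs: pseudo-transformations. -/
structure Hom (A B : TwoAQFT K P) where
  app : ∀ c : C, LinFunctor (A.cat c) (B.cat c)
  natIso : ∀ {n : ℕ} {c : Fin n → C} {t : C} (f : OrthTuple P c t) (X : ∀ i, A.cat (c i)),
    (B.op f).obj (fun i => (app (c i)).obj (X i)) ≅ (app t).obj ((A.op f).obj X)
  naturality : ∀ {n : ℕ} {c : Fin n → C} {t : C} (f : OrthTuple P c t) {X Y : ∀ i, A.cat (c i)}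
    (h : ∀ i, X i ⟶ Y i),
    (B.op f).mapFam (fun i => (app (c i)).map (h i)) ≫ (natIso f Y).hom =
      (natIso f X).hom ≫ (app t).map ((A.op f).mapFam h)
  natIso_comp : ∀ {n : ℕ} {k : Fin n → ℕ} {a : Fin n → C} {b : ∀ i, Fin (k i) → C} {t : C}
    (f : OrthTuple P a t) (g : ∀ i, OrthTuple P (b i) (a i)) (X : ∀ i j, A.cat (b i j)),
    (B.compIso f g (fun i j => (app (b i j)).obj (X i j))).hom ≫
      (natIso (f.comp g) (fun p => X (seq k p).1 (seq k p).2)).hom =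
    (B.op f).mapFam (fun i => (natIso (g i) (X i)).hom) ≫
      (natIso f (fun i => (A.op (g i)).obj (X i))).hom ≫ (app t).map (A.compIso f g X).hom
  natIso_one : ∀ (t : C) (X : Fin 1 → A.cat t),
    (B.unitIso t (fun i => (app t).obj (X i))).hom ≫ (natIso (OrthTuple.one P t) X).hom =
      (app t).map (A.unitIso t X).hom
  natIso_perm : ∀ {n m : ℕ} {c : Fin n → C} {t : C} (f : OrthTuple P c t) (σ : Fin m ≃ Fin n)
    (X : ∀ i, A.cat (c i)),
    (B.permIso f σ (fun i => (app (c i)).obj (X i))).hom ≫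
      (natIso (f.reindex σ) (fun j => X (σ j))).hom =
    (natIso f X).hom ≫ (app t).map (A.permIso f σ X).hom

/-- 2-morphisms of 2AQFTs: modifications. -/
@[ext]
structure Hom₂ {A B : TwoAQFT K P} (ζ κ : Hom A B) where
  app : ∀ c : C, (ζ.app c).toFunctor ⟶ (κ.app c).toFunctor
  naturality : ∀ {n : ℕ} {c : Fin n → C} {t : C} (f : OrthTuple P c t) (X : ∀ i, A.cat (c i)),
    (B.op f).mapFam (fun i => (app (c i)).app (X i)) ≫ (κ.natIso f X).hom =
      (ζ.natIso f X).hom ≫ (app t).app ((A.op f).obj X)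

/-- The identity 1-morphism. -/
abbrev Hom.id (A : TwoAQFT K P) : Hom A A where
  app c := LinFunctor.id (A.cat c)
  natIso f X := Iso.refl _
  naturality f X Y h := by simp
  natIso_comp f g X := by simp
  natIso_one t X := by simp
  natIso_perm f σ X := by simp

/-- Composition of 1-morphisms. -/
abbrev Hom.comp {A B D : TwoAQFT K P} (ζ : Hom A B) (κ : Hom B D) : Hom A D where
  app c := (ζ.app c).comp (κ.app c)
  natIso {_ c t} f X := κ.natIso f (fun i => (ζ.app (c i)).obj (X i)) ≪≫
    (κ.app t).mapIso (ζ.natIso f X)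
  naturality {_ c t} f X Y h := by
    have := κ.naturality f (fun i => (ζ.app (c i)).map (h i))
    simp only [Functor.comp_map, Iso.trans_hom, Functor.mapIso_hom,
      Category.assoc]
    erw [reassoc_of% this]
    rw [← Functor.map_comp, ζ.naturality f h, Functor.map_comp]
  natIso_comp {_ k a b t} f g X := by
    have h1 := κ.natIso_comp f g (fun i j => (ζ.app (b i j)).obj (X i j))
    have h2 := ζ.natIso_comp f g X
    have h3 := κ.naturality f (fun i => (ζ.natIso (g i) (X i)).hom)
    have h4 := (D.op f).mapFam_comp
      (fun i => (κ.natIso (g i) (fun j => (ζ.app (b i j)).obj (X i j))).hom)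
      (fun i => (κ.app (a i)).map (ζ.natIso (g i) (X i)).hom)
    simp only [Functor.comp_map, Iso.trans_hom, Functor.mapIso_hom,
      Category.assoc, Functor.comp_obj] at h1 h4 ⊢
    erw [reassoc_of% h1, h4]
    simp only [Category.assoc]
    erw [reassoc_of% h3]
    simp only [← Functor.map_comp]
    rw [h2]
  natIso_one t X := by
    have h1 := κ.natIso_one t (fun i => (ζ.app t).obj (X i))
    have h2 := ζ.natIso_one t X
    simp only [Functor.comp_map, Iso.trans_hom, Functor.mapIso_hom,
      Functor.comp_obj]
    erw [reassoc_of% h1]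
    rw [← Functor.map_comp, h2]
  natIso_perm {_ _ c t} f σ X := by
    have h1 := κ.natIso_perm f σ (fun i => (ζ.app (c i)).obj (X i))
    have h2 := ζ.natIso_perm f σ X
    simp only [Functor.comp_map, Iso.trans_hom, Functor.mapIso_hom,
      Functor.comp_obj, Category.assoc]
    erw [reassoc_of% h1]
    rw [← Functor.map_comp, h2, Functor.map_comp]

instance : CategoryStruct (TwoAQFT K P) where
  Hom := Hom
  id := Hom.id
  comp := Hom.comp

@[simp] lemma id_app (A : TwoAQFT K P) (c : C) : Hom.app (𝟙 A) c = LinFunctor.id (A.cat c) := rfl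
@[simp] lemma comp_app {A B D : TwoAQFT K P} (ζ : A ⟶ B) (κ : B ⟶ D) (c : C) :
    Hom.app (ζ ≫ κ) c = (ζ.app c).comp (κ.app c) := rfl

/-- The category of 1-morphisms and 2-morphisms. -/
instance homCategory (A B : TwoAQFT K P) : Category (A ⟶ B) where
  Hom ζ κ := Hom₂ ζ κ
  id ζ := { app := fun c => 𝟙 _, naturality := fun f X => by simp }
  comp {ζ κ ξ} Γ Δ :=
    { app := fun c => Γ.app c ≫ Δ.app c
      naturality := fun {_ c t} f X => by
        simp only [NatTrans.comp_app]
        rw [MultFunctor.mapFam_comp, Category.assoc, Δ.naturality f X, ← Category.assoc,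
          Γ.naturality f X, Category.assoc] }
  id_comp Γ := by apply Hom₂.ext; funext c; exact Category.id_comp _
  comp_id Γ := by apply Hom₂.ext; funext c; exact Category.comp_id _
  assoc Γ Δ E := by apply Hom₂.ext; funext c; exact Category.assoc _ _ _

@[simp] lemma id₂_app {A B : TwoAQFT K P} (ζ : A ⟶ B) (c : C) :
    Hom₂.app (𝟙 ζ) c = 𝟙 (ζ.app c).toFunctor := rfl
@[simp] lemma comp₂_app {A B : TwoAQFT K P} {ζ κ ξ : A ⟶ B} (Γ : ζ ⟶ κ) (Δ : κ ⟶ ξ) (c : C) :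
    Hom₂.app (Γ ≫ Δ) c = Hom₂.app Γ c ≫ Hom₂.app Δ c := rfl

@[ext] lemma hom₂_ext {A B : TwoAQFT K P} {ζ κ : A ⟶ B} {Γ Δ : ζ ⟶ κ}
    (h : ∀ c (X : A.cat c), (Hom₂.app Γ c).app X = (Hom₂.app Δ c).app X) : Γ = Δ := by
  apply Hom₂.ext; funext c; ext X; exact h c X

/-- Invertible 2-morphisms from componentwise isomorphisms. -/
def isoMk {A B : TwoAQFT K P} {ζ κ : A ⟶ B}
    (e : ∀ c, (Hom.app ζ c).toFunctor ≅ (Hom.app κ c).toFunctor)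
    (naturality : ∀ {n : ℕ} {c : Fin n → C} {t : C} (f : OrthTuple P c t)
      (X : ∀ i, A.cat (c i)),
      (B.op f).mapFam (fun i => (e (c i)).hom.app (X i)) ≫ (Hom.natIso κ f X).hom =
        (Hom.natIso ζ f X).hom ≫ (e t).hom.app ((A.op f).obj X)) : ζ ≅ κ where
  hom := { app := fun c => (e c).hom, naturality := naturality }
  inv :=
    { app := fun c => (e c).inv
      naturality := fun {_ c t} f X => by
        have h := naturality f X
        have h2 := (B.op f).mapFam_comp (fun i => (e (c i)).inv.app (X i))
          (fun i => (e (c i)).hom.app (X i))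
        simp only [Iso.inv_hom_id_app, MultFunctor.mapFam_id] at h2
        rw [← cancel_mono ((e t).hom.app _), Category.assoc, ← h]
        simp only [Category.assoc, Iso.inv_hom_id_app, Category.comp_id]
        rw [← Category.assoc, ← h2, Category.id_comp] }
  hom_inv_id := by ext c X; exact Iso.hom_inv_id_app _ _
  inv_hom_id := by ext c X; exact Iso.inv_hom_id_app _ _

@[simp] lemma isoMk_hom_app {A B : TwoAQFT K P} {ζ κ : A ⟶ B}
    (e : ∀ c, (Hom.app ζ c).toFunctor ≅ (Hom.app κ c).toFunctor) (h) (c : C) :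
    Hom₂.app (isoMk (ζ := ζ) (κ := κ) e h).hom c = (e c).hom := rfl
@[simp] lemma isoMk_inv_app {A B : TwoAQFT K P} {ζ κ : A ⟶ B}
    (e : ∀ c, (Hom.app ζ c).toFunctor ≅ (Hom.app κ c).toFunctor) (h) (c : C) :
    Hom₂.app (isoMk (ζ := ζ) (κ := κ) e h).inv c = (e c).inv := rfl

/-- Left whiskering. -/
def whiskerL {A B D : TwoAQFT K P} (ζ : A ⟶ B) {κ ξ : B ⟶ D} (Γ : κ ⟶ ξ) : ζ ≫ κ ⟶ ζ ≫ ξ where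
  app c := Functor.whiskerLeft (Hom.app ζ c).toFunctor (Hom₂.app Γ c)
  naturality {_ c t} f X := by
    have h := Hom₂.naturality Γ f (fun i => (ζ.app (c i)).obj (X i))
    have h2 := (Hom₂.app Γ t).naturality (ζ.natIso f X).hom
    change _ ≫ (Hom.natIso ξ f _).hom ≫ (Hom.app ξ t).map _ =
      ((Hom.natIso κ f _).hom ≫ (Hom.app κ t).map _) ≫ _
    erw [reassoc_of% h, ← h2]
    simp

/-- Right whiskering. -/
def whiskerR {A B D : TwoAQFT K P} {ζ κ : A ⟶ B} (Γ : ζ ⟶ κ) (ξ : B ⟶ D) : ζ ≫ ξ ⟶ κ ≫ ξ where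
  app c := Functor.whiskerRight (Hom₂.app Γ c) (Hom.app ξ c).toFunctor
  naturality {_ c t} f X := by
    have h := Hom₂.naturality Γ f X
    have h2 := Hom.naturality ξ f (fun i => (Hom₂.app Γ (c i)).app (X i))
    change _ ≫ (Hom.natIso ξ f _).hom ≫ (Hom.app ξ t).map _ =
      ((Hom.natIso ξ f _).hom ≫ (Hom.app ξ t).map _) ≫ _
    erw [reassoc_of% h2]
    rw [← Functor.map_comp, h, Functor.map_comp]
    simp

@[simp] lemma whiskerL_app {A B D : TwoAQFT K P} (ζ : A ⟶ B) {κ ξ : B ⟶ D} (Γ : κ ⟶ ξ) (c : C)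
    (X : A.cat c) :
    (Hom₂.app (whiskerL ζ Γ) c).app X = (Hom₂.app Γ c).app ((Hom.app ζ c).obj X) := rfl

@[simp] lemma whiskerR_app {A B D : TwoAQFT K P} {ζ κ : A ⟶ B} (Γ : ζ ⟶ κ) (ξ : B ⟶ D) (c : C)
    (X : A.cat c) :
    (Hom₂.app (whiskerR Γ ξ) c).app X = (Hom.app ξ c).map ((Hom₂.app Γ c).app X) := rfl

/-- The associator. -/
def assoc {A B D E : TwoAQFT K P} (ζ : A ⟶ B) (κ : B ⟶ D) (ξ : D ⟶ E) :
    (ζ ≫ κ) ≫ ξ ≅ ζ ≫ κ ≫ ξ :=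
  isoMk (ζ := (ζ ≫ κ) ≫ ξ) (κ := ζ ≫ κ ≫ ξ)
    (fun c => Functor.associator (Hom.app ζ c).toFunctor (Hom.app κ c).toFunctor
      (Hom.app ξ c).toFunctor) (fun {_ c t} f X => by
    change (E.op f).mapFam (fun i => 𝟙 _) ≫ (((Hom.natIso ξ f _).hom ≫
        (Hom.app ξ t).map (Hom.natIso κ f _).hom) ≫
        (Hom.app ξ t).map ((Hom.app κ t).map (Hom.natIso ζ f X).hom)) =
      ((Hom.natIso ξ f _).hom ≫ (Hom.app ξ t).map
        ((Hom.natIso κ f _).hom ≫ (Hom.app κ t).map (Hom.natIso ζ f X).hom)) ≫ 𝟙 _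
    simp)

/-- The left unitor. -/
def leftUnit {A B : TwoAQFT K P} (ζ : A ⟶ B) : 𝟙 A ≫ ζ ≅ ζ :=
  isoMk (ζ := 𝟙 A ≫ ζ) (κ := ζ) (fun c => Functor.leftUnitor (Hom.app ζ c).toFunctor)
    (fun {_ c t} f X => by
    change (B.op f).mapFam (fun i => 𝟙 _) ≫ (Hom.natIso ζ f X).hom =
      ((Hom.natIso ζ f X).hom ≫ (Hom.app ζ t).map (𝟙 _)) ≫ 𝟙 _
    simp)

/-- The right unitor. -/
def rightUnit {A B : TwoAQFT K P} (ζ : A ⟶ B) : ζ ≫ 𝟙 B ≅ ζ :=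
  isoMk (ζ := ζ ≫ 𝟙 B) (κ := ζ) (fun c => Functor.rightUnitor (Hom.app ζ c).toFunctor)
    (fun {_ c t} f X => by
    change (B.op f).mapFam (fun i => 𝟙 _) ≫ (Hom.natIso ζ f X).hom =
      (𝟙 _ ≫ (Hom.natIso ζ f X).hom) ≫ 𝟙 _
    simp)

@[simp] lemma assoc_hom_app {A B D E : TwoAQFT K P} (ζ : A ⟶ B) (κ : B ⟶ D) (ξ : D ⟶ E) (c : C)
    (X : A.cat c) : (Hom₂.app (assoc ζ κ ξ).hom c).app X = 𝟙 _ := rfl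
@[simp] lemma assoc_inv_app {A B D E : TwoAQFT K P} (ζ : A ⟶ B) (κ : B ⟶ D) (ξ : D ⟶ E) (c : C)
    (X : A.cat c) : (Hom₂.app (assoc ζ κ ξ).inv c).app X = 𝟙 _ := rfl
@[simp] lemma leftUnit_hom_app {A B : TwoAQFT K P} (ζ : A ⟶ B) (c : C) (X : A.cat c) :
    (Hom₂.app (leftUnit ζ).hom c).app X = 𝟙 _ := rfl
@[simp] lemma leftUnit_inv_app {A B : TwoAQFT K P} (ζ : A ⟶ B) (c : C) (X : A.cat c) :
    (Hom₂.app (leftUnit ζ).inv c).app X = 𝟙 _ := rfl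
@[simp] lemma rightUnit_hom_app {A B : TwoAQFT K P} (ζ : A ⟶ B) (c : C) (X : A.cat c) :
    (Hom₂.app (rightUnit ζ).hom c).app X = 𝟙 _ := rfl
@[simp] lemma rightUnit_inv_app {A B : TwoAQFT K P} (ζ : A ⟶ B) (c : C) (X : A.cat c) :
    (Hom₂.app (rightUnit ζ).inv c).app X = 𝟙 _ := rfl

/-- The 2-category of 2AQFTs. -/
instance bicategory : Bicategory (TwoAQFT K P) where
  whiskerLeft ζ _ _ Γ := whiskerL ζ Γ
  whiskerRight Γ ξ := whiskerR Γ ξ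
  associator := assoc
  leftUnitor := leftUnit
  rightUnitor := rightUnit
  whiskerLeft_id := by intros; ext c X; simp
  whiskerLeft_comp := by intros; ext c X; simp
  id_whiskerLeft := by intros; ext c X; simp
  comp_whiskerLeft := by intros; ext c X; simp
  id_whiskerRight := by intros; ext c X; simp
  comp_whiskerRight := by intros; ext c X; simp
  whiskerRight_id := by intros; ext c X; simp
  whiskerRight_comp := by intros; ext c X; simp
  whisker_assoc := by intros; ext c X; simp
  whisker_exchange := by intros; ext c X; simp
  pentagon := by intros; ext c X; simp
  triangle := by intros; ext c X; simp

end TwoAQFT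
end QFT

namespace QFT
open PrLin

/-! ### Truncation -/

namespace TwoAQFT

variable {K : Type w} [Field K] {C : Type u} [Category.{v} C] {P : Orthogonality C}

lemma comp_aux {D : Type*} [Category D] {x y z z' y' t : D} {p : x ⟶ y} {q : y ⟶ z}
    {r : z ⟶ z'} {m : x ⟶ y'} {n : y' ⟶ z'} {e : z' ⟶ t} {e' : z ⟶ t}
    (h : p ≫ q ≫ r = m ≫ n) (hr : r ≫ e = e') : p ≫ q ≫ e' = m ≫ n ≫ e := by
  rw [← hr, ← Category.assoc m, ← h]
  simp only [Category.assoc]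

section objects

variable (A : TwoAQFT K P)

/-- The pointing of a 2AQFT. -/
def pt (t : C) : A.cat t := (A.op (OrthTuple.star P t)).obj (fun i => i.elim0)

/-- All families indexed by an empty tuple agree, so that every value of a factorization product
of arity zero is the pointing. -/
lemma op_empty {n : ℕ} (hn : n = 0) {c : Fin n → C} {t : C} (F : OrthTuple P c t)
    (X : ∀ i, A.cat (c i)) : (A.op F).obj X = A.pt t := by
  subst hn
  obtain rfl : c = fun i => i.elim0 := Subsingleton.elim _ _
  obtain rfl : F = OrthTuple.star P t := by ext i; exact i.elim0
  obtain rfl : X = fun i => i.elim0 := by funext i; exact i.elim0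
  rfl

/-- The coherence isomorphism from the factorization product of the pointings to the pointing. -/
def theta {n : ℕ} {c : Fin n → C} {t : C} (f : OrthTuple P c t) :
    (A.op f).obj (fun i => A.pt (c i)) ≅ A.pt t :=
  A.compIso f (fun i => OrthTuple.star P (c i)) (fun _ j => j.elim0) ≪≫
    eqToIso (A.op_empty (by simp) _ _)

lemma mapFam_empty {n : ℕ} (hn : n = 0) {c : Fin n → C} {t : C} (F : OrthTuple P c t)
    {X Y : ∀ i, A.cat (c i)} (h : ∀ i, X i ⟶ Y i) :
    (A.op F).mapFam h = eqToHom ((A.op_empty hn F X).trans (A.op_empty hn F Y).symm) := by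
  subst hn
  obtain rfl : X = Y := by funext i; exact i.elim0
  obtain rfl : h = fun i => 𝟙 _ := by funext i; exact i.elim0
  simp

lemma compIso_empty {n : ℕ} {k : Fin n → ℕ} (hk : ∀ i, k i = 0) {a : Fin n → C}
    {b : ∀ i, Fin (k i) → C} {t : C} (f : OrthTuple P a t) (g : ∀ i, OrthTuple P (b i) (a i))
    (X : ∀ i j, A.cat (b i j)) :
    (A.compIso f g X).hom ≫ eqToHom (A.op_empty (by simp [hk]) _ _) =
      (A.op f).mapFam (fun i => eqToHom (A.op_empty (hk i) (g i) (X i))) ≫ (A.theta f).hom := by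
  obtain rfl : k = fun _ => 0 := funext hk
  obtain rfl : b = fun i j => j.elim0 := by funext i j; exact j.elim0
  obtain rfl : g = fun i => OrthTuple.star P (a i) := by funext i; ext j; exact j.elim0
  obtain rfl : X = fun i j => j.elim0 := by funext i j; exact j.elim0
  exact ((congrArg (· ≫ (A.theta f).hom) (MultFunctor.mapFam_id (A.op f)
    (fun i => A.pt (a i)))).trans (Category.id_comp _)).symm

lemma permIso_empty {n m : ℕ} (hn : n = 0) (hm : m = 0) {c : Fin n → C} {t : C}
    (F : OrthTuple P c t) (σ : Fin m ≃ Fin n) (X : ∀ i, A.cat (c i)) :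
    (A.permIso F σ X).hom = eqToHom ((A.op_empty hn F X).trans (A.op_empty hm _ _).symm) := by
  subst hn
  subst hm
  obtain rfl : σ = Equiv.refl _ := Subsingleton.elim _ _
  rw [A.perm_refl]
  rfl

lemma renum_empty {I : Type} {c : I → C} {t : C} {F F' : OrthTuple P c t} (h : F = F')
    {n m : ℕ} (hn : n = 0) (hm : m = 0) (e₁ : Fin n ≃ I) (e₂ : Fin m ≃ I)
    (X : ∀ i, A.cat (c i)) :
    A.renum h e₁ e₂ X ≫ eqToHom (A.op_empty hm _ _) = eqToHom (A.op_empty hn _ _) := by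
  rw [TwoAQFTData.renum, A.permIso_empty hn hm, Category.assoc, eqToHom_trans]
  exact eqToHom_trans _ _

lemma theta_perm {n m : ℕ} {c : Fin n → C} {t : C} (f : OrthTuple P c t) (σ : Fin m ≃ Fin n) :
    (A.permIso f σ (fun i => A.pt (c i))).hom ≫ (A.theta (f.reindex σ)).hom = (A.theta f).hom := by
  have h := A.comp_perm_left f (fun i => OrthTuple.star P (c i)) σ (fun _ j => j.elim0)
  have hr := A.renum_empty (F := f.sigma (fun i => OrthTuple.star P (c i))) rfl (by simp) (by simp)
    (seq (fun _ => 0)) ((seq (fun _ => 0)).trans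
      (Equiv.sigmaCongrLeft (β := fun i : Fin n => Fin ((fun _ => 0) i)) σ)) (fun p => p.2.elim0)
  exact ((congrArg ((A.compIso f (fun i => OrthTuple.star P (c i)) (fun _ j => j.elim0)).hom ≫ ·)
    hr.symm).trans ((Category.assoc _ _ _).symm.trans
      ((congrArg (· ≫ eqToHom (A.op_empty (by simp) _ _)) h).trans (Category.assoc _ _ _)))).symm

lemma theta_comp {n : ℕ} {k : Fin n → ℕ} {a : Fin n → C} {b : ∀ i, Fin (k i) → C} {t : C}
    (f : OrthTuple P a t) (g : ∀ i, OrthTuple P (b i) (a i)) :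
    (A.compIso f g (fun i j => A.pt (b i j))).hom ≫ (A.theta (f.comp g)).hom =
      (A.op f).mapFam (fun i => (A.theta (g i)).hom) ≫ (A.theta f).hom := by
  have h := A.comp_assoc f g (fun i j => OrthTuple.star P (b i j)) (fun _ _ r => r.elim0)
  have hr := A.renum_empty
    (F := ((f.sigma g).sigma (fun p => OrthTuple.star P (b p.1 p.2))).reindex
      (Equiv.sigmaAssoc _).symm) (OrthTuple.sigma_assoc f g (fun i j => OrthTuple.star P (b i j)))
    (by simp) (by simp) (seqL (fun _ _ => 0)) (seqR (fun _ _ => 0)) (fun s => s.2.2.elim0)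
  have h3 := A.compIso_empty (k := fun i => ∑ j : Fin (k i), 0) (by simp) f
    (fun i => (g i).comp (fun j => OrthTuple.star P (b i j))) (fun i p => ((seq _ p).2).elim0)
  have h4 := MultFunctor.mapFam_comp (A.op f)
    (fun i => (A.compIso (g i) (fun j => OrthTuple.star P (b i j)) (fun _ r => r.elim0)).hom)
    (fun i => eqToHom (A.op_empty (by simp) _ _))
  exact (comp_aux h hr).trans ((congrArg (_ ≫ ·) h3).trans ((Category.assoc _ _ _).symm.trans
    (congrArg (· ≫ (A.theta f).hom) h4.symm)))

lemma theta_one (t : C) :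
    (A.unitIso t (fun _ => A.pt t)).hom ≫ (A.theta (OrthTuple.one P t)).hom = 𝟙 _ := by
  have h := A.one_comp (OrthTuple.star P t) (fun i => i.elim0)
  have hr := A.renum_empty (OrthTuple.one_sigma (OrthTuple.star P t)) (by simp) rfl
    (seq (fun _ : Fin 1 => 0)) (oneSigma 0) (fun s => s.2.elim0)
  exact (congrArg (fun x => (A.unitIso t (fun _ => A.pt t)).hom ≫
    (A.compIso (OrthTuple.one P t) (fun _ => OrthTuple.star P t) (fun _ j => j.elim0)).hom ≫ x)
    (hr.symm.trans (Category.comp_id _))).trans h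

/-- The factorization products of the truncation,
`h ↦ A²_{(f,*)} ∘ A(f)(h_1, …, h_n) ∘ (A²_{(f,*)})⁻¹`. -/
def truncMap {n : ℕ} {c : Fin n → C} {t : C} (f : OrthTuple P c t)
    (h : ∀ i, End (A.pt (c i))) : End (A.pt t) :=
  (A.theta f).inv ≫ (A.op f).mapFam h ≫ (A.theta f).hom

lemma truncMap_one {n : ℕ} {c : Fin n → C} {t : C} (f : OrthTuple P c t) :
    A.truncMap f (fun _ => 1) = 1 := by
  have : (A.op f).mapFam (fun i => (1 : End (A.pt (c i)))) = 𝟙 _ := MultFunctor.mapFam_id _ _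
  simp only [truncMap, this, Category.id_comp, Iso.inv_hom_id]
  rfl

lemma truncMap_mul {n : ℕ} {c : Fin n → C} {t : C} (f : OrthTuple P c t)
    (h h' : ∀ i, End (A.pt (c i))) :
    A.truncMap f (fun i => h i * h' i) = A.truncMap f h * A.truncMap f h' := by
  have : (A.op f).mapFam (fun i => h i * h' i) = (A.op f).mapFam h' ≫ (A.op f).mapFam h :=
    MultFunctor.mapFam_comp _ _ _
  simp only [truncMap, this]
  simp only [End.mul_def, Category.assoc, Iso.hom_inv_id_assoc]

lemma truncMap_comp {n : ℕ} {k : Fin n → ℕ} {a : Fin n → C} {b : ∀ i, Fin (k i) → C} {t : C}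
    (f : OrthTuple P a t) (g : ∀ i, OrthTuple P (b i) (a i)) (h : ∀ i j, End (A.pt (b i j))) :
    A.truncMap f (fun i => A.truncMap (g i) (h i)) =
      A.truncMap (f.comp g) (fun p => h (seq k p).1 (seq k p).2) := by
  have h1 := A.theta_comp f g
  have h2 := A.comp_naturality f g h
  have e1 : (A.op f).mapFam (fun i => A.truncMap (g i) (h i)) =
      (A.op f).mapFam (fun i => (A.theta (g i)).inv) ≫
        (A.op f).mapFam (fun i => (A.op (g i)).mapFam (h i)) ≫
        (A.op f).mapFam (fun i => (A.theta (g i)).hom) := by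
    rw [← MultFunctor.mapFam_comp, ← MultFunctor.mapFam_comp]
    rfl
  have e2 : (A.op f).mapFam (fun i => (A.theta (g i)).inv) ≫
      (A.op f).mapFam (fun i => (A.theta (g i)).hom) = 𝟙 _ := by
    rw [← MultFunctor.mapFam_comp]
    simp
  have e3 : (A.theta f).hom ≫ (A.theta (f.comp g)).inv =
      (A.op f).mapFam (fun i => (A.theta (g i)).inv) ≫
        (A.compIso f g (fun i j => A.pt (b i j))).hom := by
    rw [Iso.comp_inv_eq, Category.assoc, h1, reassoc_of% e2]
  simp only [truncMap] at e1 ⊢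
  rw [Iso.inv_comp_eq, e1]
  simp only [Category.assoc]
  rw [← h1, reassoc_of% h2, reassoc_of% e3]

lemma truncMap_perm {n m : ℕ} {c : Fin n → C} {t : C} (f : OrthTuple P c t) (σ : Fin m ≃ Fin n)
    (h : ∀ i, End (A.pt (c i))) :
    A.truncMap f h = A.truncMap (f.reindex σ) (fun j => h (σ j)) := by
  have h1 := A.theta_perm f σ
  have h2 := A.perm_naturality f σ h
  simp only [truncMap]
  rw [Iso.inv_comp_eq, ← h1, reassoc_of% h2]
  simp

lemma truncMap_renum {I : Type} {c : I → C} {t : C} (F : OrthTuple P c t)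
    {n m : ℕ} (e₁ : Fin n ≃ I) (e₂ : Fin m ≃ I) (h : ∀ i, End (A.pt (c i))) :
    A.truncMap (F.reindex e₁) (fun i => h (e₁ i)) =
      A.truncMap (F.reindex e₂) (fun i => h (e₂ i)) := by
  rw [A.truncMap_perm (F.reindex e₁) (e₂.trans e₁.symm)]
  have key : ∀ e : Fin m ≃ I, e = e₂ → A.truncMap (F.reindex e) (fun i => h (e i)) =
      A.truncMap (F.reindex e₂) (fun i => h (e₂ i)) := by
    rintro _ rfl
    rfl
  exact key ((e₂.trans e₁.symm).trans e₁) (by ext; simp)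

lemma truncMap_id (t : C) (h : Fin 1 → End (A.pt t)) :
    A.truncMap (OrthTuple.one P t) h = h 0 := by
  have h1 := A.theta_one t
  have h2 := A.unit_naturality t (X := fun _ => A.pt t) (Y := fun _ => A.pt t) h
  simp only [truncMap]
  rw [Iso.inv_comp_eq, ← cancel_epi (A.unitIso t (fun _ => A.pt t)).hom, ← reassoc_of% h2, h1,
    reassoc_of% h1]
  exact Category.comp_id _

lemma truncMap_empty {n : ℕ} (hn : n = 0) {c : Fin n → C} {t : C} (f : OrthTuple P c t)
    (h : ∀ i, End (A.pt (c i))) : A.truncMap f h = 1 := by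
  rw [← A.truncMap_one f]
  congr 1
  funext i
  subst hn
  exact i.elim0

lemma truncMap_single_comp {c d t : C} (f : c ⟶ d) (g : d ⟶ t) (h : End (A.pt c)) :
    A.truncMap (OrthTuple.single P (f ≫ g)) (fun _ => h) =
      A.truncMap (OrthTuple.single P g) (fun _ => A.truncMap (OrthTuple.single P f) (fun _ => h)) := by
  rw [A.truncMap_comp (OrthTuple.single P g) (fun _ => OrthTuple.single P f) (fun _ _ => h)]
  exact A.truncMap_renum ((OrthTuple.single P g).sigma (fun _ : Fin 1 => OrthTuple.single P f))
    (oneSigma 1) (seq _) (fun _ => h)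

/-- The `k`-tuple of identities, for `k ≤ 1`. -/
def idTuple (P : Orthogonality C) {k : ℕ} (hk : k ≤ 1) (t : C) :
    OrthTuple P (fun _ : Fin k => t) t where
  hom _ := 𝟙 t
  perp i j h := (h (by ext; omega)).elim

lemma truncMap_slot {n : ℕ} {c : Fin n → C} {t : C} (F : OrthTuple P c t) (i : Fin n)
    (h : ∀ i, End (A.pt (c i))) (hh : ∀ j, j ≠ i → h j = 1) :
    A.truncMap F h = A.truncMap (OrthTuple.single P (F.hom i)) (fun _ => h i) := by
  let k : Fin n → ℕ := fun j => if j = i then 1 else 0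
  have hk : ∀ j, k j ≤ 1 := fun j => by simp only [k]; split <;> omega
  have key : ∀ (j : Fin n) (m : ℕ) (hm : m ≤ 1), m = (if j = i then 1 else 0) →
      A.truncMap (idTuple P hm (c j)) (fun _ => h j) = h j := by
    intro j m hm e
    by_cases hj : j = i
    · obtain rfl : m = 1 := by simpa [hj] using e
      exact A.truncMap_id (c j) (fun _ => h j)
    · rw [hh j hj]
      exact A.truncMap_one _
  have e1 : A.truncMap F h =
      A.truncMap F (fun j => A.truncMap (idTuple P (hk j) (c j)) (fun _ => h j)) := by
    congr 1
    funext j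
    exact (key j (k j) (hk j) rfl).symm
  have hki : k i = 1 := by simp [k]
  let e₂ : Fin 1 ≃ (Σ j, Fin (k j)) :=
    { toFun := fun _ => ⟨i, ⟨0, by omega⟩⟩
      invFun := fun _ => 0
      left_inv := fun _ => Subsingleton.elim _ _
      right_inv := by
        rintro ⟨j, x⟩
        have hj : j = i := by
          by_contra hj
          have : k j = 0 := by simp [k, hj]
          have := x.2
          omega
        subst hj
        have hx : x = ⟨0, by omega⟩ := by
          ext
          have := x.2
          simp only
          omega
        rw [hx] }
  rw [e1, A.truncMap_comp]
  refine (A.truncMap_renum (F.sigma (fun j => idTuple P (hk j) (c j))) (seq k) e₂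
    (fun s => h s.1)).trans ?_
  have e3 : (F.sigma (fun j => idTuple P (hk j) (c j))).reindex e₂ =
      OrthTuple.single P (F.hom i) := by
    ext j
    exact Category.id_comp _
  rw [e3]
  rfl

/-- A pair of orthogonal morphisms as an operation of arity two. -/
def pairTuple {c₁ c₂ t : C} {f₁ : c₁ ⟶ t} {f₂ : c₂ ⟶ t} (h : P.perp f₁ f₂) :
    OrthTuple P ![c₁, c₂] t where
  hom i := match i with
    | 0 => f₁
    | 1 => f₂
  perp i j hij := match i, j, hij with
    | 0, 0, e => (e rfl).elim
    | 0, 1, _ => h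
    | 1, 0, _ => P.symm h
    | 1, 1, e => (e rfl).elim

lemma truncMap_commute {c₁ c₂ t : C} {f₁ : c₁ ⟶ t} {f₂ : c₂ ⟶ t} (h : P.perp f₁ f₂)
    (h₁ : End (A.pt c₁)) (h₂ : End (A.pt c₂)) :
    A.truncMap (OrthTuple.single P f₁) (fun _ => h₁) *
        A.truncMap (OrthTuple.single P f₂) (fun _ => h₂) =
      A.truncMap (OrthTuple.single P f₂) (fun _ => h₂) *
        A.truncMap (OrthTuple.single P f₁) (fun _ => h₁) := by
  let x : ∀ i, End (A.pt (![c₁, c₂] i)) := fun i => match i with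
    | 0 => h₁
    | 1 => (1 : End (A.pt c₂))
  let y : ∀ i, End (A.pt (![c₁, c₂] i)) := fun i => match i with
    | 0 => (1 : End (A.pt c₁))
    | 1 => h₂
  have hx := A.truncMap_slot (pairTuple h) 0 x (by
    intro j hj
    match j, hj with
    | 0, e => exact (e rfl).elim
    | 1, _ => rfl)
  have hy := A.truncMap_slot (pairTuple h) 1 y (by
    intro j hj
    match j, hj with
    | 0, _ => rfl
    | 1, e => exact (e rfl).elim)
  have e1 : A.truncMap (OrthTuple.single P f₁) (fun _ => h₁) = A.truncMap (pairTuple h) x :=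
    hx.symm
  have e2 : A.truncMap (OrthTuple.single P f₂) (fun _ => h₂) = A.truncMap (pairTuple h) y :=
    hy.symm
  rw [e1, e2, ← truncMap_mul, ← truncMap_mul]
  congr 1
  funext i
  match i with
  | 0 => exact (mul_one h₁).trans (one_mul h₁).symm
  | 1 => exact (one_mul h₂).trans (mul_one h₂).symm

lemma truncMap_single_add {c t : C} (f : c ⟶ t) (h h' : End (A.pt c)) :
    A.truncMap (OrthTuple.single P f) (fun _ => h + h') =
      A.truncMap (OrthTuple.single P f) (fun _ => h) +
        A.truncMap (OrthTuple.single P f) (fun _ => h') := by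
  have key : ∀ g : A.pt c ⟶ A.pt c, (fun _ : Fin 1 => g) = Function.update (fun _ => 0) 0 g := by
    intro g
    funext i
    rw [Subsingleton.elim i 0, Function.update_self]
  have := (A.op (OrthTuple.single P f)).map_add (X := fun _ => A.pt c) (Y := fun _ => A.pt c)
    (fun _ => 0) 0 h h'
  rw [← key, ← key, ← key] at this
  simp only [truncMap]
  change _ ≫ (A.op (OrthTuple.single P f)).map (X := fun _ => A.pt c) (Y := fun _ => A.pt c) _ ≫ _
    = _
  rw [this]
  simp only [Preadditive.add_comp, Preadditive.comp_add]
  rfl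

lemma truncMap_single_smul {c t : C} (f : c ⟶ t) (r : K) (h : End (A.pt c)) :
    A.truncMap (OrthTuple.single P f) (fun _ => r • h) =
      r • A.truncMap (OrthTuple.single P f) (fun _ => h) := by
  have key : ∀ g : A.pt c ⟶ A.pt c, (fun _ : Fin 1 => g) = Function.update (fun _ => 0) 0 g := by
    intro g
    funext i
    rw [Subsingleton.elim i 0, Function.update_self]
  have := (A.op (OrthTuple.single P f)).map_smul (X := fun _ => A.pt c) (Y := fun _ => A.pt c)
    (fun _ => 0) 0 r h
  rw [← key, ← key] at this
  simp only [truncMap]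
  change _ ≫ (A.op (OrthTuple.single P f)).map (X := fun _ => A.pt c) (Y := fun _ => A.pt c) _ ≫ _
    = _
  rw [this]
  simp only [Linear.smul_comp, Linear.comp_smul]
  rfl

/-- The algebra morphism `End (a_c) → End (a_t)` associated to `f : c ⟶ t`. -/
def truncAlgHom {c t : C} (f : c ⟶ t) : End (A.pt c) →ₐ[K] End (A.pt t) :=
  AlgHom.ofLinearMap
    { toFun := fun h => A.truncMap (OrthTuple.single P f) (fun _ => h)
      map_add' := A.truncMap_single_add f
      map_smul' := A.truncMap_single_smul f }
    (A.truncMap_one _) (fun h h' => A.truncMap_mul _ (fun _ => h) (fun _ => h'))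

/-- The truncation of a 2AQFT. -/
def trunc : AQFT K P where
  obj :=
    { obj := fun c => AlgCat.of K (End (A.pt c))
      map := fun f => AlgCat.ofHom (A.truncAlgHom f)
      map_id := fun c => by
        ext h
        exact A.truncMap_id c (fun _ => h)
      map_comp := fun f g => by
        ext h
        exact A.truncMap_single_comp f g h }
  property _ _ _ _ _ h a₁ a₂ := A.truncMap_commute h a₁ a₂

end objects

end TwoAQFT
end QFT

namespace QFT
open PrLin
namespace TwoAQFT

variable {K : Type w} [Field K] {C : Type u} [Category.{v} C] {P : Orthogonality C}

section morphisms

variable {A B D : TwoAQFT K P}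

/-- The comparison of pointings `b_c ≅ ζ_c (a_c)`. -/
def starIso (ζ : A ⟶ B) (c : C) : B.pt c ≅ (Hom.app ζ c).obj (A.pt c) :=
  eqToIso (B.op_empty rfl _ _).symm ≪≫ Hom.natIso ζ (OrthTuple.star P c) (fun i => i.elim0)

lemma natIso_empty_aux {D E : Type*} [Category D] [Category E] (F : D ⥤ E) {x y : E} {z : D}
    (h : y = x) (p : x ⟶ F.obj z) : p ≫ F.map (𝟙 z) = eqToHom h.symm ≫ eqToHom h ≫ p := by
  subst h
  simp

lemma natIso_empty (ζ : A ⟶ B) {n : ℕ} (hn : n = 0) {c : Fin n → C} {t : C} (F : OrthTuple P c t)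
    (X : ∀ i, A.cat (c i)) :
    (Hom.natIso ζ F X).hom ≫ (Hom.app ζ t).map (eqToHom (A.op_empty hn F X)) =
      eqToHom (B.op_empty hn F _) ≫ (starIso ζ t).hom := by
  subst hn
  obtain rfl : c = fun i => i.elim0 := Subsingleton.elim _ _
  obtain rfl : F = OrthTuple.star P t := by ext i; exact i.elim0
  obtain rfl : X = fun i => i.elim0 := by funext i; exact i.elim0
  exact natIso_empty_aux (Hom.app ζ t).toFunctor (B.op_empty rfl (OrthTuple.star P t) _).symm _

lemma theta_natural_aux {D D' : Type*} [Category D] [Category D'] (F : D' ⥤ D) {x y z' t' : D}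
    {y' z t : D'} {p : x ⟶ y} {q : y ⟶ F.obj z} {r : x ⟶ z'} {m : z' ⟶ F.obj y'} {n : y' ⟶ z}
    {e : z ⟶ t} {e' : y ⟶ t'} {s : t' ⟶ F.obj t} (h : p ≫ q = r ≫ m ≫ F.map n)
    (hr : q ≫ F.map e = e' ≫ s) : (p ≫ e') ≫ s = r ≫ m ≫ F.map (n ≫ e) := by
  rw [Category.assoc, ← hr, ← Category.assoc, h, F.map_comp]
  simp only [Category.assoc]

lemma theta_natural_aux' {D : Type*} [Category D] {x x' y z w : D} {E : x' ⟶ x} {θ : x ⟶ y}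
    {s : y ⟶ z} {N : x' ⟶ w} {R : w ⟶ z} {E' : x ⟶ x'} {S : x ⟶ w}
    (h : (E ≫ θ) ≫ s = N ≫ R) (h1 : E' ≫ E = 𝟙 _) (h2 : S = E' ≫ N) : θ ≫ s = S ≫ R := by
  rw [h2, Category.assoc, ← h, Category.assoc, ← Category.assoc E', h1, Category.id_comp]

lemma theta_natural (ζ : A ⟶ B) {n : ℕ} {c : Fin n → C} {t : C} (f : OrthTuple P c t) :
    (B.theta f).hom ≫ (starIso ζ t).hom =
      (B.op f).mapFam (fun i => (starIso ζ (c i)).hom) ≫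
        (Hom.natIso ζ f (fun i => A.pt (c i))).hom ≫ (Hom.app ζ t).map (A.theta f).hom := by
  have h1 := Hom.natIso_comp ζ f (fun i => OrthTuple.star P (c i)) (fun _ j => j.elim0)
  have h2 := natIso_empty ζ (n := ∑ i : Fin n, 0) (by simp)
    (f.comp (fun i => OrthTuple.star P (c i)))
    (fun p => ((seq (fun _ => 0) p).2).elim0)
  have h3 := theta_natural_aux (Hom.app ζ t).toFunctor h1 h2
  have h4 := B.compIso_empty (k := fun _ => 0) (fun _ => rfl) f (fun i => OrthTuple.star P (c i))
    (fun i j => (Hom.app ζ _).obj (j.elim0))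
  have h5 := (congrArg (· ≫ (starIso ζ t).hom) h4.symm).trans h3
  have h7 := MultFunctor.mapFam_comp (B.op f)
    (fun i => eqToHom (B.op_empty rfl (OrthTuple.star P (c i))
      (fun j => (Hom.app ζ _).obj (j.elim0))).symm)
    (fun i => (Hom.natIso ζ (OrthTuple.star P (c i)) (fun j => j.elim0)).hom)
  have h8 := MultFunctor.mapFam_comp (B.op f)
    (fun i => eqToHom (B.op_empty rfl (OrthTuple.star P (c i))
      (fun j => (Hom.app ζ _).obj (j.elim0))).symm)
    (fun i => eqToHom (B.op_empty rfl (OrthTuple.star P (c i))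
      (fun j => (Hom.app ζ _).obj (j.elim0))))
  simp only [eqToHom_trans, eqToHom_refl, MultFunctor.mapFam_id] at h8
  exact theta_natural_aux' h5 h8.symm h7

/-- The components of the truncation of a 1-morphism,
`h ↦ ζ_*⁻¹ ∘ ζ_c(h) ∘ ζ_*`. -/
def truncHomApp (ζ : A ⟶ B) (c : C) : End (A.pt c) →ₐ[K] End (B.pt c) :=
  AlgHom.ofLinearMap
    { toFun := fun h => (starIso ζ c).hom ≫ (Hom.app ζ c).map h ≫ (starIso ζ c).inv
      map_add' := fun h h' => by
        have := (Hom.app ζ c).map_add h h'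
        exact (congrArg (fun x => (starIso ζ c).hom ≫ x ≫ (starIso ζ c).inv) this).trans
          (by rw [Preadditive.add_comp, Preadditive.comp_add])
      map_smul' := fun r h => by
        have := (Hom.app ζ c).map_smul r h
        exact (congrArg (fun x => (starIso ζ c).hom ≫ x ≫ (starIso ζ c).inv) this).trans
          (by rw [Linear.smul_comp, Linear.comp_smul]; rfl) }
    (by
      change (starIso ζ c).hom ≫ (Hom.app ζ c).map (𝟙 _) ≫ (starIso ζ c).inv = 𝟙 _
      simp)
    (fun h h' => by
      change (starIso ζ c).hom ≫ (Hom.app ζ c).map (h' ≫ h) ≫ (starIso ζ c).inv =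
        ((starIso ζ c).hom ≫ (Hom.app ζ c).map h' ≫ (starIso ζ c).inv) ≫
        ((starIso ζ c).hom ≫ (Hom.app ζ c).map h ≫ (starIso ζ c).inv)
      simp)

lemma truncHomApp_apply (ζ : A ⟶ B) (c : C) (h : End (A.pt c)) :
    truncHomApp ζ c h = (starIso ζ c).hom ≫ (Hom.app ζ c).map h ≫ (starIso ζ c).inv := rfl

lemma truncHomApp_aux {D D' : Type*} [Category D] [Category D'] (F : D' ⥤ D) {x y z : D}
    {x' y' : D'} {th : x ≅ y} {s : y ≅ F.obj y'} {S : x ⟶ z} {S' : z ⟶ x} {N : z ⟶ F.obj x'}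
    {th' : x' ≅ y'} {m : x ⟶ x} {m0 : z ⟶ z} {m' : x' ⟶ x'}
    (h : th.hom ≫ s.hom = S ≫ N ≫ F.map th'.hom) (hm : m = S ≫ m0 ≫ S')
    (hS : S' ≫ S = 𝟙 _) (hn : m0 ≫ N = N ≫ F.map m') :
    s.hom ≫ F.map (th'.inv ≫ m' ≫ th'.hom) ≫ s.inv = th.inv ≫ m ≫ th.hom := by
  rw [← cancel_epi th.hom, ← cancel_mono s.hom]
  simp only [Category.assoc, Iso.inv_hom_id, Category.comp_id, Iso.hom_inv_id_assoc, F.map_comp]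
  rw [reassoc_of% h, h, hm]
  simp only [Category.assoc]
  rw [reassoc_of% hS, reassoc_of% hn]
  simp only [← F.map_comp, Iso.hom_inv_id_assoc]

lemma truncHomApp_truncMap (ζ : A ⟶ B) {n : ℕ} {c : Fin n → C} {t : C} (f : OrthTuple P c t)
    (h : ∀ i, End (A.pt (c i))) :
    truncHomApp ζ t (A.truncMap f h) = B.truncMap f (fun i => truncHomApp ζ (c i) (h i)) := by
  have h1 := theta_natural ζ f
  have h2 := Hom.naturality ζ f h
  have h3 : (B.op f).mapFam (fun i => truncHomApp ζ (c i) (h i)) =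
      (B.op f).mapFam (fun i => (starIso ζ (c i)).hom) ≫
        (B.op f).mapFam (fun i => (Hom.app ζ (c i)).map (h i)) ≫
        (B.op f).mapFam (fun i => (starIso ζ (c i)).inv) := by
    rw [← MultFunctor.mapFam_comp, ← MultFunctor.mapFam_comp]
    rfl
  have h4 : (B.op f).mapFam (fun i => (starIso ζ (c i)).inv) ≫
      (B.op f).mapFam (fun i => (starIso ζ (c i)).hom) = 𝟙 _ := by
    rw [← MultFunctor.mapFam_comp]
    simp
  exact truncHomApp_aux (Hom.app ζ t).toFunctor (s := starIso ζ t) h1 h3 h4 h2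

/-- The truncation of a 1-morphism. -/
def truncHom (ζ : A ⟶ B) : A.trunc ⟶ B.trunc :=
  ObjectProperty.homMk
    { app := fun c => AlgCat.ofHom (truncHomApp ζ c)
      naturality := fun c t f => by
        ext h
        exact truncHomApp_truncMap ζ (OrthTuple.single P f) (fun _ => h) }

lemma truncHomApp_id (A : TwoAQFT K P) (c : C) (h : End (A.pt c)) :
    truncHomApp (𝟙 A) c h = h := by
  have e : ∀ {D : Type (w + 1)} [Category.{w} D] {x y : D} (p : x = y) (s : x ≅ y) (k : x ⟶ x)
      (k' : y ⟶ y), s = eqToIso p → HEq k k' → s.hom ≫ k' ≫ s.inv = k := by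
    rintro D _ x _ rfl s k _ rfl ⟨⟩
    simp
  refine e (x := A.pt c) (y := A.pt c) rfl (starIso (𝟙 A) c) h h ?_ HEq.rfl
  ext
  exact Category.comp_id _

lemma starIso_comp_aux {D D' : Type*} [Category D] [Category D'] (F : D ⥤ D') {x y : D'}
    {b a : D} {p : D} {e : x = y} {s : x ⟶ F.obj b} {h : p = b} {N : y ⟶ F.obj p} {z : p ⟶ a}
    (hh : N ≫ F.map (eqToHom h) = eqToHom e.symm ≫ s) :
    eqToHom e ≫ N ≫ F.map z = s ≫ F.map (eqToHom h.symm ≫ z) := by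
  subst e
  subst h
  simp only [eqToHom_refl, Category.id_comp, CategoryTheory.Functor.map_id, Category.comp_id] at hh
  simp [hh]

lemma starIso_comp (ζ : A ⟶ B) (κ : B ⟶ D) (c : C) :
    (starIso (ζ ≫ κ) c).hom = (starIso κ c).hom ≫ (Hom.app κ c).map (starIso ζ c).hom :=
  starIso_comp_aux (e := (D.op_empty rfl (OrthTuple.star P c) _).symm) (Hom.app κ c).toFunctor (natIso_empty κ rfl (OrthTuple.star P c)
    (fun i => (Hom.app ζ ((fun i : Fin 0 => i.elim0) i)).obj (i.elim0)))

lemma truncHomApp_comp_aux {D D' D'' : Type*} [Category D] [Category D'] [Category D'']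
    (F : D ⥤ D') (G : D' ⥤ D'') {x : D''} {b : D'} {a : D} {s : x ≅ G.obj b} {z : b ≅ F.obj a}
    {S : x ≅ G.obj (F.obj a)} (h : a ⟶ a) (hS : S.hom = s.hom ≫ G.map z.hom) :
    S.hom ≫ G.map (F.map h) ≫ S.inv = s.hom ≫ G.map (z.hom ≫ F.map h ≫ z.inv) ≫ s.inv := by
  obtain rfl : S = s ≪≫ G.mapIso z := by ext; exact hS
  simp

lemma truncHomApp_comp (ζ : A ⟶ B) (κ : B ⟶ D) (c : C) (h : End (A.pt c)) :
    truncHomApp (ζ ≫ κ) c h = truncHomApp κ c (truncHomApp ζ c h) :=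
  truncHomApp_comp_aux (Hom.app ζ c).toFunctor (Hom.app κ c).toFunctor h (starIso_comp ζ κ c)

lemma starIso_hom₂_aux {D : Type*} [Category D] {x y y' z z' : D} (e : x = y) (e' : x = y')
    {g : y = y'} {n : y ⟶ z} {n' : y' ⟶ z'} (k : z ⟶ z') (h : eqToHom g ≫ n' = n ≫ k) :
    eqToHom e' ≫ n' = (eqToHom e ≫ n) ≫ k := by
  subst e
  subst e'
  simpa using h

lemma starIso_hom₂ {ζ κ : A ⟶ B} (Γ : ζ ⟶ κ) (c : C) :
    (starIso κ c).hom = (starIso ζ c).hom ≫ (Hom₂.app Γ c).app (A.pt c) := by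
  have h1 := Hom₂.naturality Γ (OrthTuple.star P c) (fun i => i.elim0)
  have h2 := B.mapFam_empty rfl (OrthTuple.star P c)
    (fun i : Fin 0 => (Hom₂.app Γ ((fun i : Fin 0 => i.elim0) i)).app (i.elim0))
  have h3 := (congrArg (· ≫ (Hom.natIso κ (OrthTuple.star P c) (fun i => i.elim0)).hom)
    h2.symm).trans h1
  exact starIso_hom₂_aux (B.op_empty rfl _ _).symm (B.op_empty rfl _ _).symm _ h3

lemma truncHom_eq_aux {D D' : Type*} [Category D] [Category D'] {F G : D ⥤ D'} (α : F ⟶ G)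
    {x : D'} {a : D} {s : x ≅ F.obj a} {s' : x ≅ G.obj a} (h : a ⟶ a)
    (hs : s'.hom = s.hom ≫ α.app a) :
    s.hom ≫ F.map h ≫ s.inv = s'.hom ≫ G.map h ≫ s'.inv := by
  have h3 : s.inv = α.app a ≫ s'.inv := by
    rw [← cancel_epi s.hom, Iso.hom_inv_id, ← Category.assoc, ← hs, Iso.hom_inv_id]
  rw [hs, h3]
  simp

/-- Isomorphic 1-morphisms have equal truncations, in fact all 2-morphisms are truncated to
identities. -/
lemma truncHom_eq {ζ κ : A ⟶ B} (Γ : ζ ⟶ κ) : truncHom ζ = truncHom κ := by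
  apply ObjectProperty.hom_ext
  ext c h
  exact truncHom_eq_aux (Hom₂.app Γ c) h (starIso_hom₂ Γ c)

lemma truncHom_id (A : TwoAQFT K P) : truncHom (𝟙 A) = 𝟙 A.trunc := by
  apply ObjectProperty.hom_ext
  ext c h
  exact truncHomApp_id A c h

lemma truncHom_comp (ζ : A ⟶ B) (κ : B ⟶ D) : truncHom (ζ ≫ κ) = truncHom ζ ≫ truncHom κ := by
  apply ObjectProperty.hom_ext
  ext c h
  exact truncHomApp_comp ζ κ c h

end morphisms

end TwoAQFT

/-- A pseudofunctor to a category, regarded as a 2-category with only identity 2-morphisms. -/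
def pseudofunctorToLocallyDiscrete {B : Type*} [Bicategory B] {D : Type*} [Category D]
    (obj : B → D) (map : ∀ {a b : B}, (a ⟶ b) → (obj a ⟶ obj b))
    (map_eq : ∀ {a b : B} {f g : a ⟶ b}, (f ⟶ g) → map f = map g)
    (map_id : ∀ a : B, map (𝟙 a) = 𝟙 (obj a))
    (map_comp : ∀ {a b c : B} (f : a ⟶ b) (g : b ⟶ c), map (f ≫ g) = map f ≫ map g) :
    Pseudofunctor B (LocallyDiscrete D) where
  obj a := ⟨obj a⟩
  map f := (map f).toLoc
  map₂ α := eqToHom (congrArg Quiver.Hom.toLoc (map_eq α))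
  mapId a := eqToIso (congrArg Quiver.Hom.toLoc (map_id a))
  mapComp f g := eqToIso (congrArg Quiver.Hom.toLoc (map_comp f g))
  map₂_id _ := Subsingleton.elim _ _
  map₂_comp _ _ := Subsingleton.elim _ _
  map₂_whisker_left _ _ _ _ := Subsingleton.elim _ _
  map₂_whisker_right _ _ := Subsingleton.elim _ _
  map₂_associator _ _ _ := Subsingleton.elim _ _
  map₂_left_unitor _ := Subsingleton.elim _ _
  map₂_right_unitor _ := Subsingleton.elim _ _

/-- The truncation 2-functor `π`, with values in the category of AQFTs regarded as a 2-category
with only identity 2-morphisms. -/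
def truncation (K : Type w) [Field K] {C : Type u} [Category.{v} C] (P : Orthogonality C) :
    Pseudofunctor (TwoAQFT K P) (LocallyDiscrete (AQFT K P)) :=
  pseudofunctorToLocallyDiscrete (fun A => A.trunc) (fun ζ => TwoAQFT.truncHom ζ)
    (fun Γ => TwoAQFT.truncHom_eq Γ) (fun A => TwoAQFT.truncHom_id A)
    (fun ζ κ => TwoAQFT.truncHom_comp ζ κ)

end QFT

namespace QFT

/-! ### Relative tensor products of right modules -/

section Multilinear

variable {K : Type w} [Field K] {I : Type} [Finite I]

/-- A function on tuples of generators which extends linearly in each variable separately extends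
to a multilinear map. -/
lemma exists_multilinear [DecidableEq I] {Q : I → Type w} [∀ i, AddCommGroup (Q i)]
    [∀ i, Module K (Q i)] {X : I → Type w} (g : ∀ i, X i → Q i)
    (hg : ∀ i, Submodule.span K (Set.range (g i)) = ⊤) {N : Type w} [AddCommGroup N] [Module K N]
    (Φ : (∀ i, X i) → N)
    (h : ∀ (x : ∀ i, X i) (i : I), ∃ L : Q i →ₗ[K] N, ∀ y, L (g i y) = Φ (Function.update x i y)) :
    ∃ Ψ : MultilinearMap K Q N, ∀ x, Ψ (fun i => g i (x i)) = Φ x := by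
  have hb : ∀ i, ∃ (s : Type w) (b : Module.Basis s K (Q i)) (p : s → X i),
      ∀ y, b y = g i (p y) := by
    intro i
    let b := Module.Basis.extendLe (linearIndepOn_empty K id : LinearIndepOn K id (∅ : Set (Q i)))
      (Set.empty_subset (Set.range (g i))) (hg i).ge
    have hsub : ∀ y, ∃ x : X i, g i x = b y := fun y => by
      have : b y ∈ Set.range b := ⟨y, rfl⟩
      exact Module.Basis.extendLe_subset (linearIndepOn_empty K id)
        (Set.empty_subset (Set.range (g i))) (hg i).ge this
    choose p hp using hsub
    exact ⟨_, b, p, fun y => (hp y).symm⟩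
  choose s b p hp using hb
  let Ψ : MultilinearMap K Q N :=
    ((Basis.piTensorProduct b).constr K (fun j => Φ (fun i => p i (j i)))).compMultilinearMap
      (PiTensorProduct.tprod K)
  have hΨ : ∀ j : ∀ i, s i, Ψ (fun i => b i (j i)) = Φ (fun i => p i (j i)) := by
    intro j
    change ((Basis.piTensorProduct b).constr K (fun j => Φ (fun i => p i (j i))))
      (PiTensorProduct.tprod K fun i => b i (j i)) = _
    rw [← Basis.piTensorProduct_apply, Module.Basis.constr_basis]
  have : Fintype I := Fintype.ofFinite I
  have key : ∀ t : Finset I, ∀ x : ∀ i, X i, (∀ i, i ∉ t → x i ∈ Set.range (p i)) →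
      Ψ (fun i => g i (x i)) = Φ x := by
    intro t
    induction t using Finset.induction_on with
    | empty =>
      intro x hx
      choose j hj using fun i => hx i (Finset.notMem_empty i)
      obtain rfl : (fun i => p i (j i)) = x := funext hj
      simp only [← hp]
      exact hΨ j
    | insert i t hi ih =>
      intro x hx
      obtain ⟨L, hL⟩ := h x i
      have e : L = Ψ.toLinearMap (fun i => g i (x i)) i := by
        apply (b i).ext
        intro y
        have := ih (Function.update x i (p i y)) (fun k hk => by
          by_cases hki : k = i
          · subst hki
            simp
          · rw [Function.update_of_ne hki]
            exact hx k (by simp [hki, hk]))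
        rw [hp, hL, ← this]
        change _ = Ψ (Function.update (fun i => g i (x i)) i (g i (p i y)))
        congr 1
        funext k
        by_cases hki : k = i
        · subst hki
          simp
        · simp [Function.update_of_ne hki]
      have e2 := hL (x i)
      rw [Function.update_eq_self, e] at e2
      rw [← e2]
      change _ = Ψ (Function.update (fun i => g i (x i)) i (g i (x i)))
      rw [Function.update_eq_self]
  refine ⟨Ψ, fun x => key Finset.univ x (by simp)⟩

end Multilinear

open scoped ModuleCat MulOpposite TensorProduct

section Ind

variable {K : Type w} [Field K] {I : Type} {A : I → Type w} [∀ i, Ring (A i)]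
  [∀ i, Algebra K (A i)] {B : Type w} [Ring B] [Algebra K B] (φ : ∀ i, A i →ₐ[K] B)
  (M : ∀ i, ModuleCat.{w} (A i)ᵐᵒᵖ)

/-- The relations `φ_i(a) ⊗ (⋯ ⊗ m_i ⊗ ⋯) = 1 ⊗ (⋯ ⊗ m_i a ⊗ ⋯)`. -/
def Ind.rel : Submodule Bᵐᵒᵖ (B ⊗[K] (PiTensorProduct K fun i => (M i : Type w))) :=
  Submodule.span Bᵐᵒᵖ {x | ∃ (i : I) (a : A i) (m m' : ∀ i, M i),
    m' i = MulOpposite.op a • m i ∧ (∀ j, j ≠ i → m' j = m j) ∧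
    x = (1 : B) ⊗ₜ[K] PiTensorProduct.tprod K m' - φ i a ⊗ₜ[K] PiTensorProduct.tprod K m}

/-- The right `B`-module `(⨂_i M_i) ⊗_{⨂_i A_i} B` induced by right `A_i`-modules `M_i` along
algebra morphisms `φ_i : A_i → B` with mutually commuting images. -/
def Ind : ModuleCat.{w} Bᵐᵒᵖ :=
  ModuleCat.of Bᵐᵒᵖ ((B ⊗[K] (PiTensorProduct K fun i => (M i : Type w))) ⧸ Ind.rel φ M)

/-- Balanced multilinear maps. -/
def IsBalanced {N : ModuleCat.{w} Bᵐᵒᵖ} (Ψ : MultilinearMap K (fun i => (M i : Type w)) N) : Prop :=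
  ∀ (i : I) (a : A i) (m m' : ∀ i, M i), m' i = MulOpposite.op a • m i →
    (∀ j, j ≠ i → m' j = m j) → Ψ m' = MulOpposite.op (φ i a) • Ψ m

namespace Ind

/-- The projection. -/
def mk : (B ⊗[K] (PiTensorProduct K fun i => (M i : Type w))) →ₗ[Bᵐᵒᵖ] Ind φ M :=
  (Ind.rel φ M).mkQ

lemma mk_surjective : Function.Surjective (mk φ M) := Submodule.mkQ_surjective _

lemma mk_smul (r : K) (x : B ⊗[K] (PiTensorProduct K fun i => (M i : Type w))) :
    mk φ M (r • x) = r • mk φ M x := by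
  have e : r • x = algebraMap K Bᵐᵒᵖ r • x := by
    induction x with
    | zero => simp
    | add x y hx hy => rw [smul_add, smul_add, hx, hy]
    | tmul b v =>
      rw [TensorProduct.smul_tmul', TensorProduct.smul_tmul', algebraMap_smul]
  rw [e, map_smul, algebraMap_smul]

/-- The canonical balanced multilinear map `(m_i) ↦ [1 ⊗ ⨂ m_i]`. -/
def tau : MultilinearMap K (fun i => (M i : Type w)) (Ind φ M) where
  toFun m := mk φ M ((1 : B) ⊗ₜ[K] PiTensorProduct.tprod K m)
  map_update_add' m i x y := by
    rw [MultilinearMap.map_update_add, TensorProduct.tmul_add, map_add]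
  map_update_smul' m i r x := by
    rw [MultilinearMap.map_update_smul, TensorProduct.tmul_smul, mk_smul]

lemma mk_tmul (b : B) (m : ∀ i, M i) :
    mk φ M (b ⊗ₜ[K] PiTensorProduct.tprod K m) = MulOpposite.op b • tau φ M m := by
  have : b ⊗ₜ[K] PiTensorProduct.tprod K m =
      MulOpposite.op b • ((1 : B) ⊗ₜ[K] PiTensorProduct.tprod K m) := by
    rw [TensorProduct.smul_tmul', op_smul_eq_mul, one_mul]
  rw [this, map_smul]
  rfl

lemma tau_balanced : IsBalanced φ M (tau φ M) := by
  intro i a m m' h h'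
  rw [← mk_tmul, ← sub_eq_zero]
  change mk φ M _ - mk φ M _ = 0
  rw [← map_sub]
  exact (Submodule.Quotient.mk_eq_zero _).mpr (Submodule.subset_span ⟨i, a, m, m', h, h', rfl⟩)

variable {φ M}

/-- The universal property of the induced module. -/
def lift {N : ModuleCat.{w} Bᵐᵒᵖ} (Ψ : MultilinearMap K (fun i => (M i : Type w)) N)
    (hΨ : IsBalanced φ M Ψ) : Ind φ M ⟶ N :=
  ModuleCat.ofHom ((Ind.rel φ M).liftQ
    (TensorProduct.AlgebraTensorModule.lift
      { toFun := fun b => MulOpposite.op b • PiTensorProduct.lift Ψ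
        map_add' := fun b b' => by rw [MulOpposite.op_add, add_smul]
        map_smul' := fun b b' => by
          rw [RingHom.id_apply, smul_smul]
          rfl }) (by
      rw [Ind.rel, Submodule.span_le]
      rintro x ⟨i, a, m, m', h, h', rfl⟩
      have := hΨ i a m m' h h'
      simp [this]))

@[simp]
lemma lift_tau {N : ModuleCat.{w} Bᵐᵒᵖ} (Ψ : MultilinearMap K (fun i => (M i : Type w)) N)
    (hΨ : IsBalanced φ M Ψ) (m : ∀ i, M i) : (lift Ψ hΨ).hom (tau φ M m) = Ψ m := by
  change MulOpposite.op (1 : B) • PiTensorProduct.lift Ψ (PiTensorProduct.tprod K m) = _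
  rw [MulOpposite.op_one, one_smul, PiTensorProduct.lift.tprod]

lemma span_tau : Submodule.span Bᵐᵒᵖ (Set.range (tau φ M)) = ⊤ := by
  rw [eq_top_iff]
  intro x _
  obtain ⟨x, rfl⟩ := mk_surjective φ M x
  induction x with
  | zero => simp
  | add x y hx hy =>
    rw [map_add]
    exact add_mem (hx trivial) (hy trivial)
  | tmul b v =>
    induction v using PiTensorProduct.induction_on with
    | smul_tprod r m =>
      rw [TensorProduct.tmul_smul, TensorProduct.smul_tmul', mk_tmul]
      exact Submodule.smul_mem _ _ (Submodule.subset_span ⟨m, rfl⟩)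
    | add x y hx hy =>
      rw [TensorProduct.tmul_add, map_add]
      exact add_mem (hx trivial) (hy trivial)

lemma hom_ext {N : ModuleCat.{w} Bᵐᵒᵖ} {F G : Ind φ M ⟶ N}
    (h : ∀ m, F.hom (tau φ M m) = G.hom (tau φ M m)) : F = G := by
  ext x
  have := LinearMap.ext_on_range (f := F.hom) (g := G.hom) (v := tau φ M) span_tau h
  rw [this]

end Ind
end Ind
end QFT

namespace QFT
open scoped ModuleCat MulOpposite TensorProduct

namespace Ind

section Basic

variable {K : Type w} [Field K] {I : Type} {A : I → Type w} [∀ i, Ring (A i)]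
  [∀ i, Algebra K (A i)] {B : Type w} [Ring B] [Algebra K B] {φ : ∀ i, A i →ₐ[K] B}
  {M : ∀ i, ModuleCat.{w} (A i)ᵐᵒᵖ}

/-- Balanced maps are determined by their values on generators. -/
lemma balanced_ext [Finite I] {N : ModuleCat.{w} Bᵐᵒᵖ}
    {Ψ Ψ' : MultilinearMap K (fun i => (M i : Type w)) N} (h : IsBalanced φ M Ψ)
    (h' : IsBalanced φ M Ψ') (S : ∀ i, Set (M i)) (hS : ∀ i, Submodule.span (A i)ᵐᵒᵖ (S i) = ⊤)
    (e : ∀ m : ∀ i, M i, (∀ i, m i ∈ S i) → Ψ m = Ψ' m) : Ψ = Ψ' := by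
  classical
  have : Fintype I := Fintype.ofFinite I
  have key : ∀ t : Finset I, ∀ m : ∀ i, M i, (∀ i, i ∉ t → m i ∈ S i) → Ψ m = Ψ' m := by
    intro t
    induction t using Finset.induction_on with
    | empty => exact fun m hm => e m (fun i => hm i (Finset.notMem_empty i))
    | insert i t hi ih =>
      intro m hm
      have : ∀ y : M i, y ∈ Submodule.span (A i)ᵐᵒᵖ (S i) →
          Ψ (Function.update m i y) = Ψ' (Function.update m i y) := by
        intro y hy
        induction hy using Submodule.span_induction with
        | mem y hy =>
          apply ih
          intro k hk
          by_cases hki : k = i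
          · subst hki
            simpa using hy
          · rw [Function.update_of_ne hki]
            exact hm k (by simp [hki, hk])
        | zero => rw [MultilinearMap.map_update_zero, MultilinearMap.map_update_zero]
        | add y z _ _ hy hz =>
          rw [MultilinearMap.map_update_add, MultilinearMap.map_update_add, hy, hz]
        | smul a y _ hy =>
          rw [h i a.unop (Function.update m i y) (Function.update m i (a • y)) (by simp)
              (fun j hj => by simp [Function.update_of_ne hj]), hy,
            h' i a.unop (Function.update m i y) (Function.update m i (a • y)) (by simp)
              (fun j hj => by simp [Function.update_of_ne hj])]
      have := this (m i) (by rw [hS]; trivial)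
      rwa [Function.update_eq_self] at this
  ext m
  exact key Finset.univ m (by simp)

lemma compHom_balanced {N N' : ModuleCat.{w} Bᵐᵒᵖ}
    {Ψ : MultilinearMap K (fun i => (M i : Type w)) N} (h : IsBalanced φ M Ψ) (F : N ⟶ N') :
    IsBalanced φ M ((F.hom.restrictScalars K).compMultilinearMap Ψ) := by
  intro i a m m' e e'
  change F.hom (Ψ m') = MulOpposite.op (φ i a) • F.hom (Ψ m)
  rw [h i a m m' e e', map_smul]

/-- Morphisms out of an induced module are determined on generators of the `M i`. -/
lemma hom_ext' [Finite I] {N : ModuleCat.{w} Bᵐᵒᵖ} {F G : Ind φ M ⟶ N} (S : ∀ i, Set (M i))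
    (hS : ∀ i, Submodule.span (A i)ᵐᵒᵖ (S i) = ⊤)
    (h : ∀ m : ∀ i, M i, (∀ i, m i ∈ S i) → F.hom (tau φ M m) = G.hom (tau φ M m)) : F = G := by
  apply hom_ext
  intro m
  exact DFunLike.congr_fun (balanced_ext (compHom_balanced (tau_balanced φ M) F)
    (compHom_balanced (tau_balanced φ M) G) S hS h) m

lemma span_tau' [Finite I] (S : ∀ i, Set (M i))
    (hS : ∀ i, Submodule.span (A i)ᵐᵒᵖ (S i) = ⊤) :
    Submodule.span Bᵐᵒᵖ (tau φ M '' {m | ∀ i, m i ∈ S i}) = ⊤ := by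
  let W := Submodule.span Bᵐᵒᵖ (tau φ M '' {m | ∀ i, m i ∈ S i})
  have : (ModuleCat.ofHom W.mkQ : Ind φ M ⟶ ModuleCat.of Bᵐᵒᵖ (Ind φ M ⧸ W)) = 0 := by
    apply hom_ext' S hS
    intro m hm
    exact (Submodule.Quotient.mk_eq_zero _).mpr (Submodule.subset_span ⟨m, hm, rfl⟩)
  rw [eq_top_iff]
  intro x _
  have h2 : W.mkQ x = 0 := congrArg (fun F : Ind φ M ⟶ ModuleCat.of Bᵐᵒᵖ (Ind φ M ⧸ W) => F.hom x) this
  exact (Submodule.Quotient.mk_eq_zero _).mp h2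

variable (φ) in
/-- Functoriality. -/
def map {M' : ∀ i, ModuleCat.{w} (A i)ᵐᵒᵖ} (h : ∀ i, M i ⟶ M' i) : Ind φ M ⟶ Ind φ M' :=
  lift ((tau φ M').compLinearMap (fun i => (h i).hom.restrictScalars K)) (by
    intro i a m m' e e'
    refine tau_balanced φ M' i a _ _ ?_ (fun j hj => ?_)
    · change (h i).hom (m' i) = _ • (h i).hom (m i)
      rw [e, map_smul]
    · change (h j).hom (m' j) = (h j).hom (m j)
      rw [e' j hj])

@[simp]
lemma map_tau {M' : ∀ i, ModuleCat.{w} (A i)ᵐᵒᵖ} (h : ∀ i, M i ⟶ M' i) (m : ∀ i, M i) :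
    (map φ h).hom (tau φ M m) = tau φ M' (fun i => (h i).hom (m i)) :=
  lift_tau _ _ _

lemma map_id : map φ (fun i => 𝟙 (M i)) = 𝟙 _ := by
  apply hom_ext
  intro m
  simp

lemma map_comp {M' M'' : ∀ i, ModuleCat.{w} (A i)ᵐᵒᵖ} (h : ∀ i, M i ⟶ M' i)
    (h' : ∀ i, M' i ⟶ M'' i) : map φ (fun i => h i ≫ h' i) = map φ h ≫ map φ h' := by
  apply hom_ext
  intro m
  simp

lemma map_update_add [DecidableEq I] {M' : ∀ i, ModuleCat.{w} (A i)ᵐᵒᵖ} (h : ∀ i, M i ⟶ M' i)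
    (i : I) (g g' : M i ⟶ M' i) : map φ (Function.update h i (g + g')) =
      map φ (Function.update h i g) + map φ (Function.update h i g') := by
  apply hom_ext
  intro m
  have e : ∀ g : M i ⟶ M' i, (fun j => (Function.update h i g j).hom (m j)) =
      Function.update (fun j => (h j).hom (m j)) i (g.hom (m i)) := by
    intro g
    funext j
    by_cases hj : j = i
    · subst hj; simp
    · simp [Function.update_of_ne hj]
  rw [ModuleCat.hom_add, LinearMap.add_apply]
  rw [map_tau, map_tau, map_tau, e, e, e, ModuleCat.hom_add, LinearMap.add_apply,
    MultilinearMap.map_update_add]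

lemma map_update_smul [DecidableEq I] {M' : ∀ i, ModuleCat.{w} (A i)ᵐᵒᵖ} (h : ∀ i, M i ⟶ M' i)
    (i : I) (r : K) (g : M i ⟶ M' i) : map φ (Function.update h i (r • g)) =
      r • map φ (Function.update h i g) := by
  apply hom_ext
  intro m
  have e : ∀ g : M i ⟶ M' i, (fun j => (Function.update h i g j).hom (m j)) =
      Function.update (fun j => (h j).hom (m j)) i (g.hom (m i)) := by
    intro g
    funext j
    by_cases hj : j = i
    · subst hj; simp
    · simp [Function.update_of_ne hj]
  have h1 : (r • map φ (Function.update h i g)).hom (tau φ M m) =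
      r • (map φ (Function.update h i g)).hom (tau φ M m) := rfl
  have h2 : (r • g).hom (m i) = r • g.hom (m i) := rfl
  rw [h1, map_tau, map_tau, e, e, h2, MultilinearMap.map_update_smul]

lemma update_reindex {J : Type} [DecidableEq I] [DecidableEq J] {X : I → Type w} (e : J ≃ I)
    (m : ∀ i, X i) (j : J) (x : X (e j)) :
    (fun k => Function.update m (e j) x (e k)) = Function.update (fun k => m (e k)) j x := by
  funext k
  by_cases hk : k = j
  · subst hk; simp
  · rw [Function.update_of_ne hk, Function.update_of_ne (e.injective.ne hk)]

lemma piCongrLeft_update {J : Type} [DecidableEq I] [DecidableEq J] {X : I → Type w} (e : J ≃ I)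
    (m : ∀ j, X (e j)) (j : J) (x : X (e j)) :
    e.piCongrLeft X (Function.update m j x) = Function.update (e.piCongrLeft X m) (e j) x := by
  apply (e.piCongrLeft X).symm.injective
  rw [Equiv.symm_apply_apply]
  funext k
  change _ = Function.update (e.piCongrLeft X m) (e j) x (e k)
  rw [congrFun (update_reindex e (e.piCongrLeft X m) j x) k]
  congr 1
  funext k
  exact (Equiv.piCongrLeft_apply_apply X e m k).symm

/-- Renaming the index set (and replacing `φ` by an equal family). -/
def reindexHom {J : Type} (e : J ≃ I) {φ' : ∀ j, A (e j) →ₐ[K] B} (hφ : ∀ j, φ' j = φ (e j)) :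
    Ind φ M ⟶ Ind φ' (fun j => M (e j)) :=
  lift
    { toFun := fun m => tau φ' (fun j => M (e j)) (fun j => m (e j))
      map_update_add' := fun m i x y => by
        classical
        obtain ⟨j, rfl⟩ := e.surjective i
        rw [update_reindex, update_reindex, update_reindex]
        exact MultilinearMap.map_update_add _ _ _ _ _
      map_update_smul' := fun m i r x => by
        classical
        obtain ⟨j, rfl⟩ := e.surjective i
        rw [update_reindex, update_reindex]
        exact MultilinearMap.map_update_smul _ _ _ _ _ } (by
      intro i a m m' h h'
      obtain ⟨j, rfl⟩ := e.surjective i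
      rw [← hφ j]
      exact tau_balanced φ' (fun j => M (e j)) j a _ _ h (fun k hk => h' _ (e.injective.ne hk)))

@[simp]
lemma reindexHom_tau {J : Type} (e : J ≃ I) {φ' : ∀ j, A (e j) →ₐ[K] B}
    (hφ : ∀ j, φ' j = φ (e j)) (m : ∀ i, M i) :
    (reindexHom (M := M) e hφ).hom (tau φ M m) =
      tau φ' (fun j => M (e j)) (fun j => m (e j)) :=
  lift_tau _ _ _

/-- The inverse of `reindexHom`. -/
def reindexInv {J : Type} (e : J ≃ I) {φ' : ∀ j, A (e j) →ₐ[K] B} (hφ : ∀ j, φ' j = φ (e j)) :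
    Ind φ' (fun j => M (e j)) ⟶ Ind φ M :=
  lift
    { toFun := fun m => tau φ M (e.piCongrLeft (fun i => (M i : Type w)) m)
      map_update_add' := fun m i x y => by
        classical
        rw [piCongrLeft_update, piCongrLeft_update, piCongrLeft_update]
        exact MultilinearMap.map_update_add _ _ _ _ _
      map_update_smul' := fun m i r x => by
        classical
        rw [piCongrLeft_update, piCongrLeft_update]
        exact MultilinearMap.map_update_smul _ _ _ _ _ } (by
      intro j a m m' h h'
      rw [hφ j]
      refine tau_balanced φ M (e j) a _ _ ?_ (fun i hi => ?_)
      · rw [Equiv.piCongrLeft_apply_apply, Equiv.piCongrLeft_apply_apply, h]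
      · obtain ⟨k, rfl⟩ := e.surjective i
        rw [Equiv.piCongrLeft_apply_apply, Equiv.piCongrLeft_apply_apply, h']
        rintro rfl
        exact hi rfl)

lemma reindexInv_tau {J : Type} (e : J ≃ I) {φ' : ∀ j, A (e j) →ₐ[K] B}
    (hφ : ∀ j, φ' j = φ (e j)) (m : ∀ i, M i) :
    (reindexInv (M := M) e hφ).hom (tau φ' (fun j => M (e j)) (fun j => m (e j))) =
      tau φ M m :=
  (lift_tau _ _ _).trans
    (congrArg (tau φ M) ((e.piCongrLeft (fun i => (M i : Type w))).apply_symm_apply m))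

/-- Renaming the index set (and replacing `φ` by an equal family). -/
def reindex {J : Type} (e : J ≃ I) {φ' : ∀ j, A (e j) →ₐ[K] B} (hφ : ∀ j, φ' j = φ (e j)) :
    Ind φ M ≅ Ind φ' (fun j => M (e j)) where
  hom := reindexHom e hφ
  inv := reindexInv e hφ
  hom_inv_id := by
    apply hom_ext
    intro m
    simp only [ModuleCat.hom_comp, LinearMap.comp_apply, reindexHom_tau, reindexInv_tau]
    rfl
  inv_hom_id := by
    apply hom_ext
    intro m
    obtain ⟨m, rfl⟩ : ∃ m' : ∀ i, M i, m = fun j => m' (e j) :=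
      ⟨e.piCongrLeft (fun i => (M i : Type w)) m, by
        funext j
        exact (Equiv.piCongrLeft_apply_apply (fun i => (M i : Type w)) e m j).symm⟩
    simp only [ModuleCat.hom_comp, LinearMap.comp_apply, reindexHom_tau, reindexInv_tau]
    rfl

@[simp]
lemma reindex_hom_tau {J : Type} (e : J ≃ I) {φ' : ∀ j, A (e j) →ₐ[K] B}
    (hφ : ∀ j, φ' j = φ (e j)) (m : ∀ i, M i) :
    (reindex (M := M) e hφ).hom.hom (tau φ M m) =
      tau φ' (fun j => M (e j)) (fun j => m (e j)) :=
  reindexHom_tau e hφ m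

section Unit

variable {R : Type w} [Ring R] [Algebra K R] {χ : Fin 1 → R →ₐ[K] R}
  (hχ : ∀ i, χ i = AlgHom.id K R) (M : Fin 1 → ModuleCat.{w} Rᵐᵒᵖ)

/-- The canonical morphism `M → M ⊗_R R`. -/
def unitHom : M 0 ⟶ Ind χ M :=
  ModuleCat.ofHom (show M 0 →ₗ[Rᵐᵒᵖ] Ind χ M from
    { toFun := fun x => tau χ M (Function.update (fun i => (0 : M i)) 0 x)
      map_add' := fun x y => MultilinearMap.map_update_add _ _ _ _ _
      map_smul' := fun a x => by
        have := tau_balanced χ M 0 a.unop (Function.update (fun i => (0 : M i)) 0 x)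
          (Function.update (fun i => (0 : M i)) 0 (a • x)) (by simp)
          (fun j hj => (hj (Subsingleton.elim j 0)).elim)
        rw [this, hχ]
        rfl })

lemma unitHom_apply (m : ∀ i, M i) : (unitHom hχ M).hom (m 0) = tau χ M m := by
  change tau χ M _ = _
  congr 1
  funext i
  obtain rfl := Subsingleton.elim 0 i
  simp

/-- The canonical morphism `M ⊗_R R → M`. -/
def unitInv : Ind χ M ⟶ M 0 :=
  lift
    { toFun := fun m => m 0
      map_update_add' := fun m i x y => by
        obtain rfl := Subsingleton.elim 0 i
        simp
      map_update_smul' := fun m i r x => by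
        obtain rfl := Subsingleton.elim 0 i
        simp } (by
      intro i a m m' h h'
      obtain rfl := Subsingleton.elim 0 i
      rw [hχ]
      exact h)

lemma unitInv_tau (m : ∀ i, M i) : (unitInv hχ M).hom (tau χ M m) = m 0 :=
  lift_tau _ _ _

/-- The canonical isomorphism `M ≅ M ⊗_R R`. -/
def unit : M 0 ≅ Ind χ M where
  hom := unitHom hχ M
  inv := unitInv hχ M
  hom_inv_id := by
    ext x
    let m : ∀ i, M i := Function.update (fun i => (0 : M i)) 0 x
    have hm : m 0 = x := by simp [m]
    rw [← hm]
    simp only [ModuleCat.hom_comp, LinearMap.comp_apply, unitHom_apply, unitInv_tau]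
    rfl
  inv_hom_id := by
    apply hom_ext
    intro m
    simp only [ModuleCat.hom_comp, LinearMap.comp_apply, unitHom_apply, unitInv_tau]
    rfl

end Unit

end Basic

section Nest

variable {K : Type w} [Field K] {I : Type} {J : I → Type} {A : ∀ i, J i → Type w}
  [∀ i j, Ring (A i j)] [∀ i j, Algebra K (A i j)] {B : I → Type w} [∀ i, Ring (B i)]
  [∀ i, Algebra K (B i)] {E : Type w} [Ring E] [Algebra K E] (φ : ∀ i, B i →ₐ[K] E)
  (ψ : ∀ i j, A i j →ₐ[K] B i) (M : ∀ i j, ModuleCat.{w} (A i j)ᵐᵒᵖ)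

/-- The induced module of the family `(M_{ij})`. -/
abbrev Flat : ModuleCat.{w} Eᵐᵒᵖ :=
  Ind (fun p : (Σ i, J i) => (φ p.1).comp (ψ p.1 p.2)) (fun p => M p.1 p.2)

/-- Generators of `Flat`. -/
abbrev flatTau (m : ∀ i j, M i j) : Flat φ ψ M :=
  tau (fun p : (Σ i, J i) => (φ p.1).comp (ψ p.1 p.2)) (fun p => M p.1 p.2) (fun p => m p.1 p.2)

/-- The iterated induced module. -/
abbrev Nest : ModuleCat.{w} Eᵐᵒᵖ := Ind φ (fun i => Ind (ψ i) (M i))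

/-- Generators of `Nest`. -/
abbrev nestTau (m : ∀ i j, M i j) : Nest φ ψ M :=
  tau φ (fun i => Ind (ψ i) (M i)) (fun i => tau (ψ i) (M i) (m i))

/-- The canonical morphism from the induced module of the family `(M_{ij})` to the iterated induced
module. -/
def unnest : Flat φ ψ M ⟶ Nest φ ψ M :=
  lift ((tau φ (fun i => Ind (ψ i) (M i))).compMultilinearMap (fun i => tau (ψ i) (M i))) (by
    rintro ⟨i, j⟩ a m m' h h'
    refine tau_balanced φ (fun i => Ind (ψ i) (M i)) i (ψ i j a) _ _ ?_ (fun i' hi' => ?_)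
    · refine tau_balanced (ψ i) (M i) j a _ _ h (fun j' hj' => h' ⟨i, j'⟩ ?_)
      rintro e
      exact hj' (eq_of_heq (Sigma.mk.inj e).2)
    · change tau (ψ i') (M i') _ = tau (ψ i') (M i') _
      congr 1
      funext j'
      refine h' ⟨i', j'⟩ ?_
      rintro e
      exact hi' (Sigma.mk.inj e).1)

lemma unnest_tau (m : ∀ i j, M i j) :
    (unnest φ ψ M).hom (flatTau φ ψ M m) = nestTau φ ψ M m :=
  lift_tau _ _ _

end Nest

end Ind
end QFT

namespace QFT
open scoped ModuleCat MulOpposite TensorProduct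

/-- Restriction of right modules along an algebra morphism. -/
noncomputable def resMod {K : Type w} [Field K] {B E : Type w} [Ring B] [Algebra K B] [Ring E] [Algebra K E]
    (φ : B →ₐ[K] E) (N : ModuleCat.{w} Eᵐᵒᵖ) : ModuleCat.{w} Bᵐᵒᵖ :=
  (ModuleCat.restrictScalars φ.toRingHom.op).obj N

/-- The underlying vector space of a restricted module. -/
noncomputable def resEquiv {K : Type w} [Field K] {B E : Type w} [Ring B] [Algebra K B] [Ring E] [Algebra K E]
    (φ : B →ₐ[K] E) (N : ModuleCat.{w} Eᵐᵒᵖ) : N ≃ₗ[K] resMod φ N where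
  toFun n := n
  invFun n := n
  left_inv _ := rfl
  right_inv _ := rfl
  map_add' _ _ := rfl
  map_smul' r n := by
    have e : (algebraMap K Bᵐᵒᵖ r) • (show resMod φ N from n) =
        (show resMod φ N from (algebraMap K Eᵐᵒᵖ r) • n) := by
      change MulOpposite.op (φ (algebraMap K B r)) • n = _
      rw [AlgHom.commutes]
      rfl
    have e1 : r • n = algebraMap K Eᵐᵒᵖ r • n := (algebraMap_smul _ _ _).symm
    have e2 : r • (show resMod φ N from n) = algebraMap K Bᵐᵒᵖ r • (show resMod φ N from n) :=
      (algebraMap_smul _ _ _).symm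
    exact (e1.trans e.symm).trans e2.symm

lemma resEquiv_smul {K : Type w} [Field K] {B E : Type w} [Ring B] [Algebra K B] [Ring E]
    [Algebra K E] (φ : B →ₐ[K] E) (N : ModuleCat.{w} Eᵐᵒᵖ) (b : B) (n : N) :
    MulOpposite.op b • resEquiv φ N n = resEquiv φ N (MulOpposite.op (φ b) • n) := rfl

namespace Ind

lemma span_smul_tau {K : Type w} [Field K] {I : Type} {A : I → Type w} [∀ i, Ring (A i)]
    [∀ i, Algebra K (A i)] {B : Type w} [Ring B] [Algebra K B] (φ : ∀ i, A i →ₐ[K] B)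
    (M : ∀ i, ModuleCat.{w} (A i)ᵐᵒᵖ) :
    Submodule.span K (Set.range (fun x : B × (∀ i, M i) => MulOpposite.op x.1 • tau φ M x.2)) =
      ⊤ := by
  rw [eq_top_iff]
  intro x _
  obtain ⟨x, rfl⟩ := mk_surjective φ M x
  induction x with
  | zero => simp
  | add x y hx hy =>
    rw [map_add]
    exact add_mem (hx trivial) (hy trivial)
  | tmul b v =>
    induction v using PiTensorProduct.induction_on with
    | smul_tprod r m =>
      rw [TensorProduct.tmul_smul, mk_smul, mk_tmul]
      exact Submodule.smul_mem _ _ (Submodule.subset_span ⟨(b, m), rfl⟩)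
    | add x y hx hy =>
      rw [TensorProduct.tmul_add, map_add]
      exact add_mem (hx trivial) (hy trivial)

section Nest

variable {K : Type w} [Field K] {I : Type} {J : I → Type} {A : ∀ i, J i → Type w}
  [∀ i j, Ring (A i j)] [∀ i j, Algebra K (A i j)] {B : I → Type w} [∀ i, Ring (B i)]
  [∀ i, Algebra K (B i)] {E : Type w} [Ring E] [Algebra K E] (φ : ∀ i, B i →ₐ[K] E)
  (ψ : ∀ i j, A i j →ₐ[K] B i) (M : ∀ i j, ModuleCat.{w} (A i j)ᵐᵒᵖ)

lemma flat_update [DecidableEq I] [DecidableEq (Σ i, J i)] [∀ i, DecidableEq (J i)]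
    {X : ∀ i, J i → Type w} (m : ∀ i j, X i j) (i : I) (y : ∀ j, X i j) (j : J i) (z : X i j) :
    (fun p : (Σ i, J i) => Function.update m i (Function.update y j z) p.1 p.2) =
      Function.update (fun p : (Σ i, J i) => Function.update m i y p.1 p.2) ⟨i, j⟩ z := by
  funext ⟨i', j'⟩
  by_cases hi : i' = i
  · subst hi
    by_cases hj : j' = j
    · subst hj
      simp
    · rw [Function.update_of_ne (a := (⟨i', j'⟩ : Σ i, J i))]
      · simp [Function.update_of_ne hj]
      · rintro e
        exact hj (eq_of_heq (Sigma.mk.inj e).2)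
  · rw [Function.update_of_ne (a := (⟨i', j'⟩ : Σ i, J i))]
    · simp [Function.update_of_ne hi]
    · rintro e
      exact hi (Sigma.mk.inj e).1

/-- The `i`-th slot of the flattened generator, as a multilinear map. -/
noncomputable def slot [DecidableEq I] (m : ∀ i j, M i j) (i : I) :
    MultilinearMap K (fun j => (M i j : Type w)) (Flat φ ψ M) where
  toFun y := flatTau φ ψ M (Function.update m i y)
  map_update_add' := by
    intro inst y j z z'
    classical
    rw [Subsingleton.elim inst (fun a b => Classical.propDecidable (a = b))]
    simp only [flatTau, flat_update (X := fun i j => (M i j : Type w)),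
      MultilinearMap.map_update_add]
  map_update_smul' := by
    intro inst y j r z
    classical
    rw [Subsingleton.elim inst (fun a b => Classical.propDecidable (a = b))]
    simp only [flatTau, flat_update (X := fun i j => (M i j : Type w)),
      MultilinearMap.map_update_smul]

lemma exists_nest [Finite I]
    (hφ : Pairwise fun i i' => ∀ (x : B i) (y : B i'), Commute (φ i x) (φ i' y)) :
    ∃ F : Nest φ ψ M ⟶ Flat φ ψ M, ∀ m, F.hom (nestTau φ ψ M m) = flatTau φ ψ M m := by
  classical
  have : Fintype I := Fintype.ofFinite I
  let N := Flat φ ψ M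
  let π : (∀ i, B i) →* E := MonoidHom.noncommPiCoprod (fun i => (φ i : B i →* E)) hφ
  have hπ : ∀ (b : ∀ i, B i) (i : I) (x : B i),
      π (Function.update b i (b i * x)) = π b * φ i x := by
    intro b i x
    have : Function.update b i (b i * x) = b * Pi.mulSingle i x := by
      funext k
      by_cases hk : k = i
      · subst hk; simp
      · simp [Function.update_of_ne hk, Pi.mulSingle_eq_of_ne hk]
    rw [this, map_mul]
    congr 1
    exact MonoidHom.noncommPiCoprod_mulSingle _ _ _
  let g : ∀ i, (B i × (∀ j, M i j)) → Ind (ψ i) (M i) :=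
    fun i x => MulOpposite.op x.1 • tau (ψ i) (M i) x.2
  let Φ : (∀ i, (B i × (∀ j, M i j))) → N := fun x =>
    MulOpposite.op (π fun i => (x i).1) • flatTau φ ψ M (fun i => (x i).2)
  obtain ⟨Ψ, hΨ⟩ := exists_multilinear (K := K) g (fun i => span_smul_tau _ _) (N := N) Φ (by
    intro x i
    let b : ∀ i, B i := fun i => (x i).1
    let m : ∀ i j, M i j := fun i => (x i).2
    let Ψ₀ : MultilinearMap K (fun j => (M i j : Type w)) (resMod (φ i) N) :=
      ((resEquiv (φ i) N).toLinearMap.comp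
        (Algebra.lsmul K K N (MulOpposite.op (π (Function.update b i 1))))).compMultilinearMap
        (slot φ ψ M m i)
    have hb : ∀ y, Ψ₀ y = resEquiv (φ i) N (MulOpposite.op (π (Function.update b i 1)) •
        slot φ ψ M m i y) := fun y => rfl
    have hcomm : ∀ y : B i, φ i y * π (Function.update b i 1) =
        π (Function.update b i 1) * φ i y := by
      intro y
      have e1 := hπ (Function.update b i 1) i y
      have e2 : π (Pi.mulSingle i y) = φ i y := MonoidHom.noncommPiCoprod_mulSingle _ _ _
      rw [← e2, ← map_mul, ← map_mul]
      congr 1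
      funext k
      by_cases hk : k = i
      · subst hk; simp
      · simp [Pi.mulSingle_eq_of_ne hk]
    have hbal : IsBalanced (ψ i) (M i) Ψ₀ := by
      intro j a y y' h h'
      rw [hb, hb, resEquiv_smul]
      congr 1
      have e : slot φ ψ M m i y' = MulOpposite.op (φ i (ψ i j a)) • slot φ ψ M m i y := by
        refine tau_balanced (fun p : (Σ i, J i) => (φ p.1).comp (ψ p.1 p.2)) (fun p => M p.1 p.2)
          ⟨i, j⟩ a _ _ ?_ ?_
        · simpa using h
        · rintro ⟨i', j'⟩ hne
          by_cases hi : i' = i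
          · subst hi
            simp only [Function.update_self]
            refine h' j' ?_
            rintro rfl
            exact hne rfl
          · simp [Function.update_of_ne hi]
      rw [e, smul_smul, smul_smul, ← MulOpposite.op_mul, ← MulOpposite.op_mul, hcomm]
    refine ⟨(resEquiv (φ i) N).symm.toLinearMap.comp ((lift Ψ₀ hbal).hom.restrictScalars K), ?_⟩
    rintro ⟨c, y⟩
    change (resEquiv (φ i) N).symm ((lift Ψ₀ hbal).hom (MulOpposite.op c • tau (ψ i) (M i) y)) = _
    rw [map_smul, lift_tau, hb, resEquiv_smul, LinearEquiv.symm_apply_apply, smul_smul,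
      ← MulOpposite.op_mul]
    have e1 := hπ (Function.update b i 1) i c
    simp only [Function.update_self, one_mul, Function.update_idem] at e1
    rw [← e1]
    change _ • flatTau φ ψ M _ = MulOpposite.op _ • flatTau φ ψ M _
    congr 2
    · congr 1
      funext k
      by_cases hk : k = i
      · subst hk; simp
      · simp [Function.update_of_ne hk, b]
    · funext k
      by_cases hk : k = i
      · subst hk; simp
      · simp [Function.update_of_ne hk, m])
  have hact : ∀ (c : ∀ i, B i) (q : ∀ i, Ind (ψ i) (M i)),
      Ψ (fun i => MulOpposite.op (c i) • q i) = MulOpposite.op (π c) • Ψ q := by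
    intro c
    have e : Ψ.compLinearMap (fun i => Algebra.lsmul K K (Ind (ψ i) (M i))
        (MulOpposite.op (c i))) =
        LinearMap.compMultilinearMap (Algebra.lsmul K K N (MulOpposite.op (π c))) Ψ := by
      refine MultilinearMap.ext_of_span_eq_top (g := g) (fun i => span_smul_tau _ _) ?_
      intro x
      have h1 := hΨ x
      have h2 := hΨ (fun i => ((x i).1 * c i, (x i).2))
      change Ψ (fun i => MulOpposite.op (c i) • g i (x i)) =
        MulOpposite.op (π c) • Ψ (fun i => g i (x i))
      rw [h1]
      have h3 : (fun i => MulOpposite.op (c i) • g i (x i)) =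
          fun i => g i ((x i).1 * c i, (x i).2) := by
        funext i
        simp only [g]
        rw [smul_smul, ← MulOpposite.op_mul]
      rw [h3, h2]
      simp only [Φ]
      rw [smul_smul, ← MulOpposite.op_mul, ← map_mul]
      rfl
    intro q
    exact DFunLike.congr_fun e q
  have hbal : IsBalanced φ (fun i => Ind (ψ i) (M i)) Ψ := by
    intro i a q q' h h'
    have h1 := hact (Pi.mulSingle i a) q
    have h2 : π (Pi.mulSingle i a) = φ i a := MonoidHom.noncommPiCoprod_mulSingle _ _ _
    rw [h2] at h1
    rw [← h1]
    congr 1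
    funext k
    by_cases hk : k = i
    · subst hk; simpa using h
    · simp [Pi.mulSingle_eq_of_ne hk, h' k hk]
  refine ⟨lift Ψ hbal, fun m => ?_⟩
  rw [lift_tau]
  have := hΨ (fun i => (1, m i))
  simp only [g, MulOpposite.op_one, one_smul, Φ] at this
  rw [this]
  have h1 : π (fun i => 1) = 1 := map_one π
  rw [h1, MulOpposite.op_one, one_smul]

/-- `unnest` is invertible. -/
lemma isIso_unnest [Finite I] [∀ i, Finite (J i)]
    (hφ : Pairwise fun i i' => ∀ (x : B i) (y : B i'), Commute (φ i x) (φ i' y)) :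
    IsIso (unnest φ ψ M) := by
  obtain ⟨F, hF⟩ := exists_nest φ ψ M hφ
  refine ⟨F, ?_, ?_⟩
  · apply hom_ext
    intro m
    have : tau (fun p : (Σ i, J i) => (φ p.1).comp (ψ p.1 p.2)) (fun p => M p.1 p.2) m =
      flatTau φ ψ M (fun i j => m ⟨i, j⟩) := rfl
    rw [this, ModuleCat.hom_comp, LinearMap.comp_apply, unnest_tau, hF]
    rfl
  · apply hom_ext' (fun i => Set.range (tau (ψ i) (M i))) (fun i => span_tau)
    intro m hm
    choose m' hm' using hm
    obtain rfl : (fun i => tau (ψ i) (M i) (m' i)) = m := funext hm'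
    change (unnest φ ψ M).hom (F.hom (nestTau φ ψ M m')) = nestTau φ ψ M m'
    rw [hF, unnest_tau]

/-- The canonical isomorphism from the iterated induced module to the induced module of the family
`(M_{ij})`. -/
noncomputable def nest [Finite I] [∀ i, Finite (J i)]
    (hφ : Pairwise fun i i' => ∀ (x : B i) (y : B i'), Commute (φ i x) (φ i' y)) :
    Nest φ ψ M ≅ Flat φ ψ M :=
  have := isIso_unnest φ ψ M hφ
  (asIso (unnest φ ψ M)).symm

lemma nest_hom_tau [Finite I] [∀ i, Finite (J i)]
    (hφ : Pairwise fun i i' => ∀ (x : B i) (y : B i'), Commute (φ i x) (φ i' y))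
    (m : ∀ i j, M i j) :
    (nest φ ψ M hφ).hom.hom (nestTau φ ψ M m) = flatTau φ ψ M m := by
  rw [← unnest_tau]
  change ((nest φ ψ M hφ).inv ≫ (nest φ ψ M hφ).hom).hom _ = _
  rw [Iso.inv_hom_id]
  rfl

lemma nest_inv_tau [Finite I] [∀ i, Finite (J i)]
    (hφ : Pairwise fun i i' => ∀ (x : B i) (y : B i'), Commute (φ i x) (φ i' y))
    (m : ∀ i j, M i j) :
    (nest φ ψ M hφ).inv.hom (flatTau φ ψ M m) = nestTau φ ψ M m :=
  unnest_tau φ ψ M m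

end Nest

end Ind
end QFT

namespace QFT
open scoped ModuleCat MulOpposite TensorProduct

/-! ### Categories of modules are locally presentable -/

/-- Evaluation at `1` identifies the functor represented by `R` with the forgetful functor. -/
noncomputable def coyonedaSelfIso (R : Type w) [Ring R] :
    coyoneda.obj (Opposite.op (ModuleCat.of R R)) ≅ forget (ModuleCat.{w} R) :=
  NatIso.ofComponents (fun M => Equiv.toIso
    { toFun := fun f => f.hom 1
      invFun := fun x => ModuleCat.ofHom (LinearMap.toSpanSingleton R M x)
      left_inv := fun f => ModuleCat.hom_ext (LinearMap.ext_ring (by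
        simp [LinearMap.toSpanSingleton]))
      right_inv := fun x => by simp [LinearMap.toSpanSingleton] }) (by
      intro M N f
      ext g
      rfl)

instance isLocallyPresentable_moduleCat (R : Type w) [Ring R] :
    IsLocallyPresentable.{w} (ModuleCat.{w} R) := by
  have : Fact Cardinal.aleph0.{w}.IsRegular := Cardinal.fact_isRegular_aleph0
  refine ⟨⟨Cardinal.aleph0, inferInstance, ?_⟩⟩
  rw [IsCardinalLocallyPresentable.iff_exists_isStrongGenerator]
  refine ⟨.singleton (ModuleCat.of R R), inferInstance, ?_, ?_⟩
  · rw [ObjectProperty.isStrongGenerator_iff]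
    refine ⟨?_, fun X Y i hi h => ?_⟩
    · intro X Y f g h
      ext x
      have := h (ModuleCat.of R R) (by simp) (ModuleCat.ofHom (LinearMap.toSpanSingleton R X x))
      have := congrArg (fun k : ModuleCat.of R R ⟶ Y => k.hom (1 : R)) this
      simpa [LinearMap.toSpanSingleton] using this
    · have h1 : Function.Injective i.hom := (ModuleCat.mono_iff_injective i).mp hi
      have h2 : Function.Surjective i.hom := by
        intro y
        obtain ⟨f, hf⟩ := h (ModuleCat.of R R) (by simp)
          (ModuleCat.ofHom (LinearMap.toSpanSingleton R Y y))
        refine ⟨f.hom (1 : R), ?_⟩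
        have := congrArg (fun k : ModuleCat.of R R ⟶ Y => k.hom (1 : R)) hf
        simpa [LinearMap.toSpanSingleton] using this
      exact (ConcreteCategory.isIso_iff_bijective i).mpr ⟨h1, h2⟩
  · simp only [ObjectProperty.singleton_le_iff]
    change (coyoneda.obj (Opposite.op (ModuleCat.of R R))).IsCardinalAccessible _
    have : (forget (ModuleCat.{w} R)).IsCardinalAccessible Cardinal.aleph0.{w} :=
      Functor.isFinitelyAccessible_iff_preservesFilteredColimits.mpr inferInstance
    exact Functor.isCardinalAccessible_of_natIso (coyonedaSelfIso R).symm _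

/-! ### Cocontinuity of induction in each variable -/

namespace Ind

variable {K : Type w} [Field K] {I : Type} {A : I → Type w} [∀ i, Ring (A i)]
  [∀ i, Algebra K (A i)] {B : Type w} [Ring B] [Algebra K B] (φ : ∀ i, A i →ₐ[K] B)

/-- The functor `(M_i) ↦ (⨂_i M_i) ⊗_{⨂_i A_i} B`. -/
def functor : (∀ i, ModuleCat.{w} (A i)ᵐᵒᵖ) ⥤ ModuleCat.{w} Bᵐᵒᵖ where
  obj M := Ind φ M
  map h := map φ h
  map_id _ := map_id
  map_comp h h' := map_comp h h'

section SlotHom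

variable {φ} {M : ∀ i, ModuleCat.{w} (A i)ᵐᵒᵖ} {N : ModuleCat.{w} Bᵐᵒᵖ}

open Classical in
/-- The linear map in the `i`-th variable given by a morphism out of an induced module. -/
noncomputable def slotHom (F : Ind φ M ⟶ N) (m : ∀ i, M i) (i : I) : M i ⟶ resMod (φ i) N :=
  ModuleCat.ofHom (X := M i) (Y := resMod (φ i) N)
    { toFun := fun y => resEquiv (φ i) N (F.hom (tau φ M (Function.update m i y)))
      map_add' := fun y y' => by
        rw [MultilinearMap.map_update_add, map_add, map_add]
      map_smul' := fun a y => by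
        have := tau_balanced φ M i a.unop (Function.update m i y)
          (Function.update m i (a • y)) (by simp)
          (fun j hj => by simp [Function.update_of_ne hj])
        rw [this, map_smul]
        exact (resEquiv_smul _ _ _ _).symm }

open Classical in
lemma slotHom_apply (F : Ind φ M ⟶ N) (m : ∀ i, M i) (i : I) (y : M i) :
    (slotHom F m i).hom y = resEquiv (φ i) N (F.hom (tau φ M (Function.update m i y))) := rfl

/-- The endomorphism of a restricted module given by the action of a commuting element. -/
noncomputable def actLin {R : Type w} [Ring R] [Algebra K R] (χ : R →ₐ[K] B) (b : B)
    (hb : ∀ x, Commute (χ x) b) (N : ModuleCat.{w} Bᵐᵒᵖ) : resMod χ N →ₗ[Rᵐᵒᵖ] resMod χ N where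
  toFun y := resEquiv χ N (MulOpposite.op b • (resEquiv χ N).symm y)
  map_add' y y' := by rw [map_add, smul_add, map_add]
  map_smul' a y := by
    obtain ⟨n, rfl⟩ := (resEquiv χ N).surjective y
    obtain ⟨a, rfl⟩ := MulOpposite.op_surjective a
    rw [RingHom.id_apply, resEquiv_smul, LinearEquiv.symm_apply_apply,
      LinearEquiv.symm_apply_apply, resEquiv_smul, smul_smul, smul_smul, ← MulOpposite.op_mul,
      ← MulOpposite.op_mul, hb a]

/-- `actLin` as a morphism. -/
noncomputable def actHom {R : Type w} [Ring R] [Algebra K R] (χ : R →ₐ[K] B) (b : B)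
    (hb : ∀ x, Commute (χ x) b) (N : ModuleCat.{w} Bᵐᵒᵖ) : resMod χ N ⟶ resMod χ N :=
  ModuleCat.ofHom (X := resMod χ N) (Y := resMod χ N) (actLin χ b hb N)

lemma actHom_apply {R : Type w} [Ring R] [Algebra K R] (χ : R →ₐ[K] B) (b : B)
    (hb : ∀ x, Commute (χ x) b) (N : ModuleCat.{w} Bᵐᵒᵖ) (n : N) :
    (actHom χ b hb N).hom (resEquiv χ N n) = resEquiv χ N (MulOpposite.op b • n) := rfl

end SlotHom

section Cocontinuous

variable {D : Type*} [Category D] (G : D ⥤ (∀ i, ModuleCat.{w} (A i)ᵐᵒᵖ)) (i : I)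
  (hG : ∀ {X Y : D} (g : X ⟶ Y) (j : I), j ≠ i → IsIso (G.map g j))

open Classical in
/-- The inverses of the components `j ≠ i` of `G.map g`. -/
noncomputable def compInv {X Y : D} (g : X ⟶ Y) (j : I) : G.obj Y j ⟶ G.obj X j :=
  if h : j = i then 0 else @CategoryTheory.inv _ _ _ _ (G.map g j) (hG g j h)

lemma compInv_hom {X Y : D} (g : X ⟶ Y) (j : I) (hj : j ≠ i) (x : G.obj X j) :
    (compInv G i hG g j).hom ((G.map g j).hom x) = x := by
  have := hG g j hj
  rw [compInv, dif_neg hj]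
  change (G.map g j ≫ CategoryTheory.inv (G.map g j)).hom x = x
  rw [IsIso.hom_inv_id]
  rfl

lemma hom_compInv {X Y : D} (g : X ⟶ Y) (j : I) (hj : j ≠ i) (y : G.obj Y j) :
    (G.map g j).hom ((compInv G i hG g j).hom y) = y := by
  have := hG g j hj
  rw [compInv, dif_neg hj]
  change (CategoryTheory.inv (G.map g j) ≫ G.map g j).hom y = y
  rw [IsIso.inv_hom_id]
  rfl

open Classical in
/-- The tuple with `i`-th entry `x` and all other entries pulled back along `G.map g`. -/
noncomputable def pull {X Y : D} (g : X ⟶ Y) (m : ∀ j, G.obj Y j) (x : G.obj X i) :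
    ∀ j, G.obj X j :=
  Function.update (fun j => (compInv G i hG g j).hom (m j)) i x

open Classical in
lemma pull_update {X Y : D} (g : X ⟶ Y) (m : ∀ j, G.obj Y j) (x : G.obj X i) (k : I) (hk : k ≠ i)
    (z : G.obj Y k) : pull G i hG g (Function.update m k z) x =
      Function.update (pull G i hG g m x) k ((compInv G i hG g k).hom z) := by
  funext j
  by_cases hj : j = i
  · subst hj
    rw [Function.update_of_ne hk.symm]
    simp [pull]
  · by_cases hjk : j = k
    · subst hjk
      simp [pull, Function.update_of_ne hj]
    · simp [pull, Function.update_of_ne hj, Function.update_of_ne hjk]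

open Classical in
lemma pull_congr {X Y : D} (g : X ⟶ Y) (m m' : ∀ j, G.obj Y j) (x : G.obj X i)
    (h : ∀ j, j ≠ i → m j = m' j) : pull G i hG g m x = pull G i hG g m' x := by
  funext j
  by_cases hj : j = i
  · subst hj
    simp [pull]
  · simp [pull, Function.update_of_ne hj, h j hj]

lemma map_pull {X Y Z : D} (f : X ⟶ Y) (g : Y ⟶ Z) (m : ∀ j, G.obj Z j) (x : G.obj X i) :
    (fun j => (G.map f j).hom (pull G i hG (f ≫ g) m x j)) =
      pull G i hG g m ((G.map f i).hom x) := by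
  classical
  funext j
  by_cases hj : j = i
  · subst hj
    simp [pull]
  · simp only [pull, Function.update_of_ne hj]
    rw [← compInv_hom G i hG g j hj ((G.map f j).hom _)]
    congr 1
    have : G.map (f ≫ g) j = G.map f j ≫ G.map g j := by
      rw [G.map_comp]
      rfl
    have h2 := hom_compInv G i hG (f ≫ g) j hj (m j)
    rw [this] at h2
    exact h2

variable {J : Type w} [Category.{w} J] {F : J ⥤ D} {p : D} (ι : ∀ x, F.obj x ⟶ p)

open Classical in
lemma exists_desc
    (hφ : Pairwise fun i i' => ∀ (x : A i) (y : A i'), Commute (φ i x) (φ i' y))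
    (hG : ∀ {X Y : D} (g : X ⟶ Y) (j : I), j ≠ i → IsIso (G.map g j))
    (hι : ∀ {x y : J} (f : x ⟶ y), F.map f ≫ ι y = ι x)
    (hex : ∀ (N : ModuleCat.{w} (A i)ᵐᵒᵖ) (l : ∀ x, G.obj (F.obj x) i ⟶ N),
      (∀ {x y : J} (f : x ⟶ y), G.map (F.map f) i ≫ l y = l x) →
        ∃ d : G.obj p i ⟶ N, ∀ x, G.map (ι x) i ≫ d = l x)
    (hun : ∀ (N : ModuleCat.{w} (A i)ᵐᵒᵖ) (d d' : G.obj p i ⟶ N),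
      (∀ x, G.map (ι x) i ≫ d = G.map (ι x) i ≫ d') → d = d')
    (N : ModuleCat.{w} Bᵐᵒᵖ) (l : ∀ x, Ind φ (G.obj (F.obj x)) ⟶ N)
    (hl : ∀ {x y : J} (f : x ⟶ y), map φ (G.map (F.map f)) ≫ l y = l x) :
    ∃ d : Ind φ (G.obj p) ⟶ N, ∀ x, map φ (G.map (ι x)) ≫ d = l x := by
  have hl' : ∀ {x y : J} (f : x ⟶ y) (m : ∀ j, G.obj (F.obj x) j),
      (l y).hom (tau φ _ fun j => (G.map (F.map f) j).hom (m j)) = (l x).hom (tau φ _ m) := by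
    intro x y f m
    rw [← hl f, ModuleCat.hom_comp, LinearMap.comp_apply, map_tau]
  let base : ∀ (m : ∀ j, G.obj p j) (x : J) (j : I), G.obj (F.obj x) j :=
    fun m x j => (compInv G i hG (ι x) j).hom (m j)
  have hpull : ∀ m x y, pull G i hG (ι x) m y = Function.update (base m x) i y :=
    fun m x y => rfl
  have h1 : ∀ m : ∀ j, G.obj p j, ∃ d : G.obj p i ⟶ resMod (φ i) N,
      ∀ x, G.map (ι x) i ≫ d = slotHom (l x) (base m x) i := by
    intro m
    refine hex _ _ ?_
    intro x y f
    ext z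
    rw [ModuleCat.hom_comp, LinearMap.comp_apply, slotHom_apply, slotHom_apply]
    congr 1
    rw [← hpull, ← hpull, ← hl' f]
    congr 2
    rw [← map_pull, hι f]
  choose d hd using h1
  have hd' : ∀ m x y, (d m).hom ((G.map (ι x) i).hom y) =
      resEquiv (φ i) N ((l x).hom (tau φ _ (Function.update (base m x) i y))) := by
    intro m x y
    rw [← slotHom_apply, ← hd]
    rfl
  have hdi : ∀ (m : ∀ j, G.obj p j) (z : G.obj p i), d (Function.update m i z) = d m := by
    intro m z
    apply hun
    intro x
    ext y
    rw [ModuleCat.hom_comp, LinearMap.comp_apply, hd', ModuleCat.hom_comp, LinearMap.comp_apply,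
      hd']
    rw [← hpull, ← hpull, pull_congr G i hG (ι x) (Function.update m i z) m y
      (fun j hj => by simp [Function.update_of_ne hj])]
  have hdk : ∀ (m : ∀ j, G.obj p j) (k : I) (hk : k ≠ i) (z : G.obj p k) (x : J)
      (y : G.obj (F.obj x) i), (d (Function.update m k z)).hom ((G.map (ι x) i).hom y) =
      resEquiv (φ i) N ((l x).hom (tau φ _ (Function.update (Function.update (base m x) i y) k
        ((compInv G i hG (ι x) k).hom z)))) := by
    intro m k hk z x y
    rw [hd', ← hpull, ← hpull, pull_update G i hG _ _ _ _ hk]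
  have hdadd : ∀ (m : ∀ j, G.obj p j) (k : I) (hk : k ≠ i) (z z' : G.obj p k),
      d (Function.update m k (z + z')) = d (Function.update m k z) + d (Function.update m k z') := by
    intro m k hk z z'
    apply hun
    intro x
    ext y
    rw [ModuleCat.hom_comp, LinearMap.comp_apply, ModuleCat.hom_comp, LinearMap.comp_apply,
      ModuleCat.hom_add, LinearMap.add_apply, hdk m k hk, hdk m k hk, hdk m k hk, map_add,
      MultilinearMap.map_update_add, map_add, map_add]
  have hdsmul : ∀ (m : ∀ j, G.obj p j) (k : I) (hk : k ≠ i) (r : K) (z : G.obj p k),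
      d (Function.update m k (r • z)) = r • d (Function.update m k z) := by
    intro m k hk r z
    apply hun
    intro x
    ext y
    have e : ∀ (f : G.obj p i ⟶ resMod (φ i) N) (y : G.obj p i), (r • f).hom y = r • f.hom y :=
      fun _ _ => rfl
    have e2 : (compInv G i hG (ι x) k).hom (r • z) = r • (compInv G i hG (ι x) k).hom z :=
      ((compInv G i hG (ι x) k).hom.restrictScalars K).map_smul r z
    have e3 : ∀ q, (l x).hom (r • q) = r • (l x).hom q :=
      ((l x).hom.restrictScalars K).map_smul r
    rw [ModuleCat.hom_comp, LinearMap.comp_apply, ModuleCat.hom_comp, LinearMap.comp_apply,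
      e, hdk m k hk, hdk m k hk, e2, MultilinearMap.map_update_smul, e3, map_smul]
  have hdbal : ∀ (k : I) (hk : k ≠ i) (a : A k) (m m' : ∀ j, G.obj p j),
      m' k = MulOpposite.op a • m k → (∀ j, j ≠ k → m' j = m j) →
      d m' = d m ≫ actHom (φ i) (φ k a) (fun x => hφ hk.symm x a) N := by
    intro k hk a m m' h h'
    apply hun
    intro x
    ext y
    rw [ModuleCat.hom_comp, LinearMap.comp_apply, ModuleCat.hom_comp, LinearMap.comp_apply,
      ModuleCat.hom_comp, LinearMap.comp_apply, hd', hd', actHom_apply]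
    congr 1
    rw [← map_smul]
    congr 1
    refine tau_balanced φ _ k a _ _ ?_ (fun j hj => ?_)
    · simp only [Function.update_of_ne hk, base]
      rw [h, map_smul]
    · by_cases hji : j = i
      · subst hji; simp
      · simp [Function.update_of_ne hji, base, h' j hj]
  let Ψ : MultilinearMap K (fun j => (G.obj p j : Type w)) N :=
    { toFun := fun m => (resEquiv (φ i) N).symm ((d m).hom (m i))
      map_update_add' := by
        intro inst m k z z'
        obtain rfl : inst = fun a b => Classical.propDecidable (a = b) := Subsingleton.elim _ _
        by_cases hk : k = i
        · subst hk
          rw [hdi, hdi, hdi]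
          simp
        · rw [hdadd m k hk]
          simp [Function.update_of_ne (Ne.symm hk)]
      map_update_smul' := by
        intro inst m k r z
        obtain rfl : inst = fun a b => Classical.propDecidable (a = b) := Subsingleton.elim _ _
        by_cases hk : k = i
        · subst hk
          rw [hdi, hdi]
          have e : ∀ q, (d m).hom (r • q) = r • (d m).hom q :=
            ((d m).hom.restrictScalars K).map_smul r
          simp [e]
        · rw [hdsmul m k hk]
          have e : ∀ (f : G.obj p i ⟶ resMod (φ i) N) (y : G.obj p i),
            (r • f).hom y = r • f.hom y := fun _ _ => rfl
          rw [e, map_smul]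
          simp [Function.update_of_ne (Ne.symm hk)] }
  have hΨ : ∀ m, Ψ m = (resEquiv (φ i) N).symm ((d m).hom (m i)) := fun _ => rfl
  have hbal : IsBalanced φ (G.obj p) Ψ := by
    intro k a m m' h h'
    rw [hΨ, hΨ]
    by_cases hk : k = i
    · subst hk
      have e : d m' = d m := by
        rw [← hdi m (m' k)]
        congr 1
        funext j
        by_cases hj : j = k
        · subst hj; simp
        · rw [Function.update_of_ne hj, h' j hj]
      rw [e, h, map_smul]
      obtain ⟨n, hn⟩ := (resEquiv (φ k) N).surjective ((d m).hom (m k))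
      rw [← hn, resEquiv_smul, LinearEquiv.symm_apply_apply, LinearEquiv.symm_apply_apply]
    · rw [hdbal k hk a m m' h h', h' i (Ne.symm hk), ModuleCat.hom_comp, LinearMap.comp_apply]
      obtain ⟨n, hn⟩ := (resEquiv (φ i) N).surjective ((d m).hom (m i))
      rw [← hn, actHom_apply, LinearEquiv.symm_apply_apply, LinearEquiv.symm_apply_apply]
  refine ⟨lift Ψ hbal, fun x => hom_ext fun m => ?_⟩
  rw [ModuleCat.hom_comp, LinearMap.comp_apply, map_tau, lift_tau, hΨ, hd',
    LinearEquiv.symm_apply_apply]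
  congr 2
  funext j
  by_cases hj : j = i
  · subst hj; simp
  · rw [Function.update_of_ne hj]
    exact compInv_hom G i hG (ι x) j hj (m j)

open Classical in
lemma desc_unique (hG : ∀ {X Y : D} (g : X ⟶ Y) (j : I), j ≠ i → IsIso (G.map g j))
    (hun : ∀ (N : ModuleCat.{w} (A i)ᵐᵒᵖ) (d d' : G.obj p i ⟶ N),
      (∀ x, G.map (ι x) i ≫ d = G.map (ι x) i ≫ d') → d = d')
    (N : ModuleCat.{w} Bᵐᵒᵖ) (d d' : Ind φ (G.obj p) ⟶ N)
    (h : ∀ x, map φ (G.map (ι x)) ≫ d = map φ (G.map (ι x)) ≫ d') : d = d' := by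
  apply hom_ext
  intro m
  have key : slotHom d m i = slotHom d' m i := by
    apply hun
    intro x
    ext y
    rw [ModuleCat.hom_comp, LinearMap.comp_apply, ModuleCat.hom_comp, LinearMap.comp_apply,
      slotHom_apply, slotHom_apply]
    congr 1
    have e : Function.update m i ((G.map (ι x) i).hom y) =
        fun j => (G.map (ι x) j).hom (pull G i hG (ι x) m y j) := by
      funext j
      by_cases hj : j = i
      · subst hj; simp [pull]
      · simp only [pull, Function.update_of_ne hj]
        exact (hom_compInv G i hG (ι x) j hj (m j)).symm
    rw [e, ← map_tau]
    exact congrArg (fun f : Ind φ (G.obj (F.obj x)) ⟶ N => f.hom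
      (tau φ _ (pull G i hG (ι x) m y))) (h x)
  have := congrArg (fun f : G.obj p i ⟶ resMod (φ i) N => f.hom (m i)) key
  simp only [slotHom_apply, Function.update_eq_self] at this
  exact (resEquiv (φ i) N).injective this

end Cocontinuous

end Ind
end QFT

namespace QFT
open PrLin
open scoped ModuleCat MulOpposite TensorProduct

namespace Ind

lemma preservesColimits {K : Type w} [Field K] {I : Type} {A : I → Type w} [∀ i, Ring (A i)]
    [∀ i, Algebra K (A i)] {B : Type w} [Ring B] [Algebra K B] (φ : ∀ i, A i →ₐ[K] B)
    (hφ : Pairwise fun i i' => ∀ (x : A i) (y : A i'), Commute (φ i x) (φ i' y))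
    {D : Type*} [Category D] (G : D ⥤ (∀ i, ModuleCat.{w} (A i)ᵐᵒᵖ)) (i : I)
    (hG : ∀ {X Y : D} (g : X ⟶ Y) (j : I), j ≠ i → IsIso (G.map g j))
    (hGi : PreservesColimitsOfSize.{w, w} (G ⋙ Pi.eval _ i)) :
    PreservesColimitsOfSize.{w, w} (G ⋙ functor φ) := by
  refine ⟨fun {J} _ => ⟨fun {F} => ⟨fun {c} hc => ?_⟩⟩⟩
  have hci : IsColimit ((G ⋙ Pi.eval _ i).mapCocone c) := isColimitOfPreserves _ hc
  have hex : ∀ (N : ModuleCat.{w} (A i)ᵐᵒᵖ) (l : ∀ x, G.obj (F.obj x) i ⟶ N),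
      (∀ {x y : J} (f : x ⟶ y), G.map (F.map f) i ≫ l y = l x) →
        ∃ d : G.obj c.pt i ⟶ N, ∀ x, G.map (c.ι.app x) i ≫ d = l x := by
    intro N l hl
    let s : Cocone (F ⋙ G ⋙ Pi.eval _ i) :=
      { pt := N
        ι :=
          { app := l
            naturality := fun x y f => (hl f).trans (Category.comp_id _).symm } }
    exact ⟨hci.desc s, fun x => hci.fac s x⟩
  have hun : ∀ (N : ModuleCat.{w} (A i)ᵐᵒᵖ) (d d' : G.obj c.pt i ⟶ N),
      (∀ x, G.map (c.ι.app x) i ≫ d = G.map (c.ι.app x) i ≫ d') → d = d' :=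
    fun N d d' h => hci.hom_ext h
  have hι : ∀ {x y : J} (f : x ⟶ y), F.map f ≫ c.ι.app y = c.ι.app x := fun f => c.w f
  have hd : ∀ s : Cocone (F ⋙ G ⋙ functor φ), ∃ d : Ind φ (G.obj c.pt) ⟶ s.pt,
      ∀ x, map φ (G.map (c.ι.app x)) ≫ d = s.ι.app x := fun s =>
    exists_desc φ G i (fun x => c.ι.app x) hφ hG hι hex hun s.pt (fun x => s.ι.app x)
      (fun f => s.w f)
  choose d hd using hd
  exact ⟨{ desc := d
           fac := hd
           uniq := fun s m hm => desc_unique φ G i (fun x => c.ι.app x) hG hun s.pt m (d s)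
             (fun x => (hm x).trans (hd s x).symm) }⟩

end Ind

namespace PrLin

variable {K : Type w} [Field K]

lemma insertVar_eval_self {n : ℕ} {D : Fin n → PrLin K} (X : ∀ j, D j) (i : Fin n) :
    insertVar X i ⋙ Pi.eval _ i = 𝟭 (D i) := by
  rw [insertVar, Functor.pi'_eval, dif_pos rfl]
  rfl

lemma insertVar_eval_ne {n : ℕ} {D : Fin n → PrLin K} (X : ∀ j, D j) (i j : Fin n) (h : i ≠ j) :
    insertVar X i ⋙ Pi.eval _ j = (Functor.const _).obj (X j) := by
  rw [insertVar, Functor.pi'_eval, dif_neg h]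

lemma isIso_insertVar_map {n : ℕ} {D : Fin n → PrLin K} (X : ∀ j, D j) (i j : Fin n) (h : j ≠ i)
    {Y Z : D i} (g : Y ⟶ Z) : IsIso ((insertVar X i).map g j) := by
  have : ∀ F : D i ⥤ D j, F = (Functor.const _).obj (X j) → IsIso (F.map g) := by
    rintro _ rfl
    change IsIso (𝟙 _)
    infer_instance
  exact this _ (insertVar_eval_ne X i j h.symm)

/-- The category of right modules over a `K`-algebra. -/
def mod (K : Type w) [Field K] (R : Type w) [Ring R] [Algebra K R] : PrLin K where
  carrier := ModuleCat.{w} Rᵐᵒᵖ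

end PrLin

/-! ### The inclusion -/

namespace AQFT

variable {K : Type w} [Field K] {C : Type u} [Category.{v} C] {P : Orthogonality C}

/-- The algebra assigned to an object. -/
abbrev alg (A : AQFT K P) (c : C) : Type w := A.obj.obj c

/-- The algebra morphisms assigned to a tuple of morphisms. -/
def act (A : AQFT K P) {I : Type} {c : I → C} {t : C} (f : OrthTuple P c t) (i : I) :
    A.alg (c i) →ₐ[K] A.alg t := (A.obj.map (f.hom i)).hom

lemma act_commute (A : AQFT K P) {I : Type} {c : I → C} {t : C} (f : OrthTuple P c t) :
    Pairwise fun i i' => ∀ x y, Commute (A.act f i x) (A.act f i' y) :=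
  fun i i' h x y => A.property _ _ (f.perp i i' h) x y

/-- The factorization products of the inclusion. -/
def op (A : AQFT K P) {n : ℕ} {c : Fin n → C} {t : C} (f : OrthTuple P c t) :
    MultFunctor (fun i => PrLin.mod K (A.alg (c i))) (PrLin.mod K (A.alg t)) where
  toFunctor := Ind.functor (A.act f)
  map_add h i g g' := Ind.map_update_add h i g g'
  map_smul h i r g := Ind.map_update_smul h i r g
  cocontinuous X i := by
    refine Ind.preservesColimits (A.act f) (A.act_commute f) (insertVar X i) i
      (fun g j h => isIso_insertVar_map X i j h g) ?_
    have : insertVar X i ⋙ Pi.eval _ i = 𝟭 _ := insertVar_eval_self X i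
    change PreservesColimitsOfSize.{w, w} (insertVar X i ⋙ Pi.eval _ i)
    rw [this]
    infer_instance

end AQFT
end QFT

namespace QFT
open PrLin
open scoped ModuleCat MulOpposite TensorProduct

namespace PrLin

variable {K : Type w} [Field K] {R : Type w} [Ring R] [Algebra K R]

/-- An object of the category of modules, as a module. -/
abbrev asMod (M : PrLin.mod K R) : ModuleCat.{w} Rᵐᵒᵖ := M

/-- A morphism of modules, as a linear map. -/
abbrev asHom {M N : PrLin.mod K R} (f : M ⟶ N) : asMod M ⟶ asMod N := f

/-- Elements of a module. -/
abbrev El (M : PrLin.mod K R) : Type w := asMod M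

/-- The underlying function of a morphism of modules. -/
def ev {M N : PrLin.mod K R} (f : M ⟶ N) (x : El M) : El N :=
  (asHom f).hom x

lemma ev_comp {M N L : PrLin.mod K R} (f : M ⟶ N) (g : N ⟶ L) (x : El M) :
    ev (f ≫ g) x = ev g (ev f x) := rfl

lemma ev_id {M : PrLin.mod K R} (x : El M) : ev (𝟙 M) x = x := rfl

lemma ev_ext {M N : PrLin.mod K R} {f g : M ⟶ N} (h : ∀ x, ev f x = ev g x) : f = g :=
  ModuleCat.hom_ext (M := asMod M) (N := asMod N) (LinearMap.ext h)

lemma ev_comp₂ {M N L : PrLin.mod K R} {f : M ⟶ N} {g : N ⟶ L} {x : El M} {y : El N} {z : El L}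
    (h₁ : ev f x = y) (h₂ : ev g y = z) : ev (f ≫ g) x = z := by
  rw [ev_comp, h₁, h₂]

lemma ev_comp₃ {M N L L' : PrLin.mod K R} {f : M ⟶ N} {g : N ⟶ L} {g' : L ⟶ L'} {x : El M}
    {y : El N} {z : El L} {z' : El L'} (h₁ : ev f x = y) (h₂ : ev g y = z) (h₃ : ev g' z = z') :
    ev (f ≫ g ≫ g') x = z' :=
  ev_comp₂ h₁ (ev_comp₂ h₂ h₃)

end PrLin

namespace AQFT

variable {K : Type w} [Field K] {C : Type u} [Category.{v} C] {P : Orthogonality C}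
  (A : AQFT K P)

lemma act_comp {n : ℕ} {k : Fin n → ℕ} {a : Fin n → C} {b : ∀ i, Fin (k i) → C} {t : C}
    (f : OrthTuple P a t) (g : ∀ i, OrthTuple P (b i) (a i)) (p : Fin (∑ i, k i)) :
    A.act (f.comp g) p = (A.act f (seq k p).1).comp (A.act (g (seq k p).1) (seq k p).2) := by
  change (A.obj.map ((g (seq k p).1).hom (seq k p).2 ≫ f.hom (seq k p).1)).hom = _
  rw [Functor.map_comp]
  rfl

lemma act_one (t : C) (i : Fin 1) : A.act (OrthTuple.one P t) i = AlgHom.id K (A.alg t) := by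
  change (A.obj.map (𝟙 t)).hom = _
  rw [CategoryTheory.Functor.map_id]
  rfl

/-- The data of the 2AQFT associated to an AQFT. -/
noncomputable def inclData : TwoAQFTData K P where
  cat c := PrLin.mod K (A.alg c)
  op f := A.op f
  compIso {_ k _ _ _} f g X :=
    Ind.nest (A.act f) (fun i => A.act (g i)) X (A.act_commute f) ≪≫
      Ind.reindex (seq k) (A.act_comp f g)
  unitIso t X := Ind.unit (A.act_one t) X
  permIso _ σ _ := Ind.reindex σ (fun _ => rfl)

/-- Generators of the factorization products. -/
def gen {n : ℕ} {c : Fin n → C} {t : C} (f : OrthTuple P c t)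
    (X : ∀ i, PrLin.mod K (A.alg (c i))) (m : ∀ i, El (X i)) : El ((A.op f).obj X) :=
  Ind.tau (A.act f) X m

lemma ext₁ {n : ℕ} {c : Fin n → C} {t : C} {f : OrthTuple P c t}
    {X : ∀ i, PrLin.mod K (A.alg (c i))} {N : PrLin.mod K (A.alg t)} {F G : (A.op f).obj X ⟶ N}
    (h : ∀ m, ev F (A.gen f X m) = ev G (A.gen f X m)) : F = G :=
  Ind.hom_ext h

lemma span_gen {n : ℕ} {c : Fin n → C} {t : C} (f : OrthTuple P c t)
    (X : ∀ i, PrLin.mod K (A.alg (c i))) :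
    Submodule.span (A.alg t)ᵐᵒᵖ (Set.range (A.gen f X)) = ⊤ :=
  Ind.span_tau

lemma ext₂ {n : ℕ} {k : Fin n → ℕ} {a : Fin n → C} {b : ∀ i, Fin (k i) → C} {t : C}
    {f : OrthTuple P a t} {g : ∀ i, OrthTuple P (b i) (a i)}
    {X : ∀ i j, PrLin.mod K (A.alg (b i j))} {N : PrLin.mod K (A.alg t)}
    {F G : (A.op f).obj (fun i => (A.op (g i)).obj (X i)) ⟶ N}
    (h : ∀ m : ∀ i j, El (X i j), ev F (A.gen f _ (fun i => A.gen (g i) (X i) (m i))) =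
      ev G (A.gen f _ (fun i => A.gen (g i) (X i) (m i)))) : F = G := by
  refine Ind.hom_ext' (fun i => Set.range (A.gen (g i) (X i))) (fun i => A.span_gen _ _) ?_
  intro m hm
  choose m' hm' using hm
  obtain rfl : (fun i => A.gen (g i) (X i) (m' i)) = m := funext hm'
  exact h m'

lemma ext₃ {n : ℕ} {k : Fin n → ℕ} {l : ∀ i, Fin (k i) → ℕ} {a : Fin n → C}
    {b : ∀ i, Fin (k i) → C} {d : ∀ i j, Fin (l i j) → C} {t : C}
    {f : OrthTuple P a t} {g : ∀ i, OrthTuple P (b i) (a i)}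
    {h : ∀ i j, OrthTuple P (d i j) (b i j)} {X : ∀ i j r, PrLin.mod K (A.alg (d i j r))}
    {N : PrLin.mod K (A.alg t)}
    {F G : (A.op f).obj (fun i => (A.op (g i)).obj (fun j => (A.op (h i j)).obj (X i j))) ⟶ N}
    (H : ∀ m : ∀ i j r, El (X i j r),
      ev F (A.gen f _ (fun i => A.gen (g i) _ (fun j => A.gen (h i j) (X i j) (m i j)))) =
      ev G (A.gen f _ (fun i => A.gen (g i) _ (fun j => A.gen (h i j) (X i j) (m i j))))) :
    F = G := by
  refine Ind.hom_ext' (fun i => A.gen (g i) (fun j => (A.op (h i j)).obj (X i j)) ''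
      {m | ∀ j, m j ∈ Set.range (A.gen (h i j) (X i j))})
    (fun i => Ind.span_tau' _ (fun j => A.span_gen _ _)) ?_
  intro m hm
  choose m' hm' hm'' using hm
  choose m₁ hm₁ using hm'
  obtain rfl : (fun i => A.gen (g i) (fun j => (A.op (h i j)).obj (X i j)) (m' i)) = m :=
    funext hm''
  obtain rfl : (fun i j => A.gen (h i j) (X i j) (m₁ i j)) = m' := by
    funext i j
    exact hm₁ i j
  exact H m₁

lemma ev_mapFam {n : ℕ} {c : Fin n → C} {t : C} (f : OrthTuple P c t)
    {X Y : ∀ i, PrLin.mod K (A.alg (c i))} (h : ∀ i, X i ⟶ Y i) (m : ∀ i, El (X i)) :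
    ev ((A.op f).mapFam h) (A.gen f X m) = A.gen f Y (fun i => ev (h i) (m i)) :=
  Ind.map_tau h m

lemma ev_compIso {n : ℕ} {k : Fin n → ℕ} {a : Fin n → C} {b : ∀ i, Fin (k i) → C} {t : C}
    (f : OrthTuple P a t) (g : ∀ i, OrthTuple P (b i) (a i))
    (X : ∀ i j, PrLin.mod K (A.alg (b i j))) (m : ∀ i j, El (X i j)) :
    ev (A.inclData.compIso f g X).hom (A.gen f _ (fun i => A.gen (g i) (X i) (m i))) =
      A.gen (f.comp g) (fun p => X (seq k p).1 (seq k p).2)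
        (fun p => m (seq k p).1 (seq k p).2) := by
  have h1 := Ind.nest_hom_tau (A.act f) (fun i => A.act (g i)) X (A.act_commute f) m
  have h2 := Ind.reindexHom_tau (φ := fun p : (Σ i, Fin (k i)) =>
    (A.act f p.1).comp (A.act (g p.1) p.2)) (M := fun p : (Σ i, Fin (k i)) => X p.1 p.2) (seq k)
    (A.act_comp f g) (fun p => m p.1 p.2)
  exact (congrArg (Ind.reindexHom (φ := fun p : (Σ i, Fin (k i)) =>
    (A.act f p.1).comp (A.act (g p.1) p.2)) (M := fun p : (Σ i, Fin (k i)) => X p.1 p.2) (seq k)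
    (A.act_comp f g)).hom h1).trans h2

lemma ev_unitIso (t : C) (X : Fin 1 → PrLin.mod K (A.alg t)) (m : ∀ i, El (X i)) :
    ev (A.inclData.unitIso t X).hom (m 0) = A.gen (OrthTuple.one P t) X m :=
  Ind.unitHom_apply (A.act_one t) X m

lemma ev_permIso {n m : ℕ} {c : Fin n → C} {t : C} (f : OrthTuple P c t) (σ : Fin m ≃ Fin n)
    (X : ∀ i, PrLin.mod K (A.alg (c i))) (x : ∀ i, El (X i)) :
    ev (A.inclData.permIso f σ X).hom (A.gen f X x) =
      A.gen (f.reindex σ) (fun j => X (σ j)) (fun j => x (σ j)) :=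
  Ind.reindexHom_tau (M := X) σ (fun _ => rfl) x

lemma ev_renum {I : Type} {c : I → C} {t : C} {F F' : OrthTuple P c t} (h : F = F')
    {n m : ℕ} (e₁ : Fin n ≃ I) (e₂ : Fin m ≃ I) (X : ∀ i, PrLin.mod K (A.alg (c i)))
    (x : ∀ i, El (X i)) :
    ev (A.inclData.renum h e₁ e₂ X) (A.gen (F.reindex e₁) _ (fun i => x (e₁ i))) =
      A.gen (F'.reindex e₂) _ (fun i => x (e₂ i)) := by
  subst h
  have key : ∀ (e : Fin m ≃ I) (he : e = e₂)
      (p : (A.op (F.reindex e)).obj (fun i => X (e i)) =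
        (A.op (F.reindex e₂)).obj (fun i => X (e₂ i))),
      ev (eqToHom p) (A.gen (F.reindex e) _ (fun i => x (e i))) =
        A.gen (F.reindex e₂) _ (fun i => x (e₂ i)) := by
    rintro _ rfl p
    rfl
  have h1 := A.ev_permIso (F.reindex e₁) (e₂.trans e₁.symm) (fun i => X (e₁ i))
    (fun i => x (e₁ i))
  refine (congrArg (ev (eqToHom (A.inclData.renum_aux rfl e₁ e₂ X))) h1).trans ?_
  exact key ((e₂.trans e₁.symm).trans e₁) (by ext; simp) _

/-- The 2AQFT associated to an AQFT. -/
noncomputable def incl : TwoAQFT K P where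
  toTwoAQFTData := A.inclData
  comp_naturality f g X Y h := A.ext₂ fun m =>
    (ev_comp₂ ((A.ev_mapFam f _ _).trans
      (congrArg (A.gen f _) (funext fun i => A.ev_mapFam (g i) (h i) (m i))))
      (A.ev_compIso f g Y _)).trans
    (ev_comp₂ (A.ev_compIso f g X m) (A.ev_mapFam (f.comp g) _ _)).symm
  unit_naturality t X Y h := by
    refine ev_ext fun x => ?_
    obtain ⟨m, rfl⟩ : ∃ m : ∀ i, El (X i), m 0 = x :=
      ⟨Function.update (fun i => (0 : asMod (X i))) 0 x, by simp⟩
    exact (ev_comp₂ rfl (A.ev_unitIso t Y (fun i => ev (h i) (m i)))).trans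
      (ev_comp₂ (A.ev_unitIso t X m) (A.ev_mapFam (OrthTuple.one P t) h m)).symm
  perm_naturality f σ X Y h := A.ext₁ fun m =>
    (ev_comp₂ (A.ev_mapFam f h m) (A.ev_permIso f σ Y _)).trans
      (ev_comp₂ (A.ev_permIso f σ X m) (A.ev_mapFam (f.reindex σ) _ _)).symm
  comp_assoc {n k l a b d t} f g h X := A.ext₃ fun m =>
    (ev_comp₃ (A.ev_compIso f g (fun i j => (A.op (h i j)).obj (X i j))
        (fun i j => A.gen (h i j) (X i j) (m i j)))
      (A.ev_compIso (f.comp g)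
        (fun p => h (seq k p).1 (seq k p).2) (fun p => X (seq k p).1 (seq k p).2)
        (fun p => m (seq k p).1 (seq k p).2))
      (A.ev_renum (OrthTuple.sigma_assoc f g h) (seqL l) (seqR l)
        (fun s => X s.1 s.2.1 s.2.2) (fun s => m s.1 s.2.1 s.2.2))).trans
    (ev_comp₂ ((A.ev_mapFam f _ _).trans
      (congrArg (A.gen f _) (funext fun i => A.ev_compIso (g i) (h i) (X i) (m i))))
      (A.ev_compIso f (fun i => (g i).comp (h i))
        (fun i p => X i (seq (l i) p).1 (seq (l i) p).2)
        (fun i p => m i (seq (l i) p).1 (seq (l i) p).2))).symm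
  one_comp {n c t} f X := A.ext₁ fun m =>
    ev_comp₃ (A.ev_unitIso t (fun _ => (A.op f).obj X) (fun _ => A.gen f X m))
      (A.ev_compIso (OrthTuple.one P t) (fun _ => f) (fun _ => X) (fun _ => m))
      (A.ev_renum (OrthTuple.one_sigma f) (seq (fun _ : Fin 1 => n)) (oneSigma n)
        (fun s => X s.2) (fun s => m s.2))
  comp_one {n c t} f X := A.ext₁ fun m =>
    ev_comp₃ ((A.ev_mapFam f _ _).trans (congrArg (A.gen f _) (funext fun i =>
        A.ev_unitIso (c i) (fun _ => X i) (fun _ => m i))))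
      (A.ev_compIso f (fun i => OrthTuple.one P (c i)) (fun i _ => X i) (fun i _ => m i))
      (A.ev_renum (OrthTuple.sigma_one f) (seq (fun _ : Fin n => 1)) (sigmaOne n)
        (fun s => X s.1) (fun s => m s.1))
  perm_refl f X := A.ext₁ fun m => A.ev_permIso f (Equiv.refl _) X m
  perm_trans f σ σ' X := A.ext₁ fun m =>
    (ev_comp₂ (A.ev_permIso f σ X m)
      (A.ev_permIso (f.reindex σ) σ' (fun j => X (σ j)) (fun j => m (σ j)))).trans
    (A.ev_permIso f (σ'.trans σ) X m).symm
  comp_perm_left {n m k a b t} f g σ X := A.ext₂ fun x =>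
    (ev_comp₂ (A.ev_compIso f g X x)
      (A.ev_renum (F := f.sigma g) rfl (seq k) ((seq (fun i => k (σ i))).trans
        (Equiv.sigmaCongrLeft (β := fun i => Fin (k i)) σ)) (fun p => X p.1 p.2)
        (fun p => x p.1 p.2))).trans
    (ev_comp₂ (A.ev_permIso f σ (fun i => (A.op (g i)).obj (X i))
        (fun i => A.gen (g i) (X i) (x i)))
      (A.ev_compIso (f.reindex σ) (fun i => g (σ i)) (fun i => X (σ i))
        (fun i => x (σ i)))).symm
  comp_perm_right {n k k' a b t} f g σ X := A.ext₂ fun x =>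
    (ev_comp₂ (A.ev_compIso f g X x)
      (A.ev_renum (F := f.sigma g) rfl (seq k) ((seq k').trans (Equiv.sigmaCongrRight σ))
        (fun p => X p.1 p.2) (fun p => x p.1 p.2))).trans
    (ev_comp₂ ((A.ev_mapFam f _ _).trans (congrArg (A.gen f _)
        (funext fun i => A.ev_permIso (g i) (σ i) (X i) (x i))))
      (A.ev_compIso f (fun i => (g i).reindex (σ i)) (fun i j => X i (σ i j))
        (fun i j => x i (σ i j)))).symm

end AQFT
end QFT

namespace QFT
open PrLin
open scoped ModuleCat MulOpposite TensorProduct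

namespace PrLin

variable {K : Type w} [Field K] {R S : Type w} [Ring R] [Algebra K R] [Ring S] [Algebra K S]

lemma _root_.QFT.Ind.map₁_add (χ : R →ₐ[K] S) {M N : ModuleCat.{w} Rᵐᵒᵖ} (g g' : M ⟶ N) :
    Ind.map (fun _ : Fin 1 => χ) (fun _ => g + g') =
      Ind.map (fun _ : Fin 1 => χ) (fun _ => g) + Ind.map (fun _ : Fin 1 => χ) (fun _ => g') := by
  have key : ∀ g : M ⟶ N, (fun _ : Fin 1 => g) = Function.update (fun _ => 0) 0 g := by
    intro g
    funext i
    rw [Subsingleton.elim i 0, Function.update_self]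
  have := Ind.map_update_add (φ := fun _ : Fin 1 => χ) (M := fun _ => M)
    (M' := fun _ => N) (fun _ => 0) 0 g g'
  rw [← key, ← key, ← key] at this
  exact this

lemma _root_.QFT.Ind.map₁_smul (χ : R →ₐ[K] S) {M N : ModuleCat.{w} Rᵐᵒᵖ} (r : K) (g : M ⟶ N) :
    Ind.map (fun _ : Fin 1 => χ) (fun _ => r • g) =
      r • Ind.map (fun _ : Fin 1 => χ) (fun _ => g) := by
  have key : ∀ g : M ⟶ N, (fun _ : Fin 1 => g) = Function.update (fun _ => 0) 0 g := by
    intro g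
    funext i
    rw [Subsingleton.elim i 0, Function.update_self]
  have := Ind.map_update_smul (φ := fun _ : Fin 1 => χ) (M := fun _ => M)
    (M' := fun _ => N) (fun _ => 0) 0 r g
  rw [← key, ← key] at this
  exact this

/-- The induction functor `– ⊗_R S` along an algebra morphism. -/
def indFunctor (χ : R →ₐ[K] S) : LinFunctor (PrLin.mod K R) (PrLin.mod K S) where
  toFunctor :=
    { obj := fun M => Ind (fun _ : Fin 1 => χ) (fun _ => asMod M)
      map := fun g => Ind.map (fun _ : Fin 1 => χ) (fun _ => asHom g)
      map_id := fun _ => Ind.map_id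
      map_comp := fun g g' => Ind.map_comp (fun _ => asHom g) (fun _ => asHom g') }
  map_add g g' := Ind.map₁_add χ (asHom g) (asHom g')
  map_smul r g := Ind.map₁_smul χ r (asHom g)
  cocontinuous := Ind.preservesColimits (fun _ : Fin 1 => χ)
    (fun i j h => (h (Subsingleton.elim i j)).elim)
    (Functor.pi' (fun _ : Fin 1 => 𝟭 (ModuleCat.{w} Rᵐᵒᵖ))) 0
    (fun _ j h => (h (Subsingleton.elim j 0)).elim)
    (inferInstanceAs (PreservesColimitsOfSize.{w, w} (𝟭 (ModuleCat.{w} Rᵐᵒᵖ))))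

/-- The generators `m ⊗ 1` of `M ⊗_R S`. -/
def indGen (χ : R →ₐ[K] S) (M : PrLin.mod K R) (x : El M) : El ((indFunctor χ).obj M) :=
  Ind.tau (fun _ : Fin 1 => χ) (fun _ => asMod M) (fun _ => x)

lemma const_fin_one {X : Type*} (m : Fin 1 → X) : m = fun _ => m 0 := by
  funext i
  rw [Subsingleton.elim i 0]

lemma ev_indMap (χ : R →ₐ[K] S) {M N : PrLin.mod K R} (g : M ⟶ N) (x : El M) :
    ev ((indFunctor χ).map g) (indGen χ M x) = indGen χ N (ev g x) :=
  Ind.map_tau (φ := fun _ : Fin 1 => χ) (fun _ => asHom g) (fun _ => x)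

lemma ind_ext {χ : R →ₐ[K] S} {M : PrLin.mod K R} {N : PrLin.mod K S}
    {F G : (indFunctor χ).obj M ⟶ N} (h : ∀ x, ev F (indGen χ M x) = ev G (indGen χ M x)) :
    F = G := by
  refine Ind.hom_ext fun m => ?_
  rw [const_fin_one (X := El M) m]
  exact h (m 0)

lemma span_indGen (χ : R →ₐ[K] S) (M : PrLin.mod K R) :
    Submodule.span Sᵐᵒᵖ (Set.range (indGen χ M)) = ⊤ := by
  refine top_le_iff.mp ((Ind.span_tau (φ := fun _ : Fin 1 => χ) (M := fun _ => asMod M)).ge.trans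
    (Submodule.span_mono ?_))
  rintro _ ⟨m, rfl⟩
  rw [const_fin_one (X := El M) m]
  exact ⟨m 0, rfl⟩

end PrLin

namespace AQFT

variable {K : Type w} [Field K] {C : Type u} [Category.{v} C] {P : Orthogonality C}
  {A B D E : AQFT K P}

/-- The components of a morphism of AQFTs. -/
def comp (ζ : A ⟶ B) (c : C) : A.alg c →ₐ[K] B.alg c := (ζ.hom.app c).hom

lemma comp_naturality (ζ : A ⟶ B) {I : Type} {c : I → C} {t : C} (f : OrthTuple P c t) (i : I) :
    (comp ζ t).comp (A.act f i) = (B.act f i).comp (comp ζ (c i)) := by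
  have := ζ.hom.naturality (f.hom i)
  exact congrArg AlgCat.Hom.hom this

/-- `(Σ _ : Fin 1, Fin n) ≃ (Σ _ : Fin n, Fin 1)`. -/
def swapSigma (n : ℕ) : (Σ _ : Fin 1, Fin n) ≃ (Σ _ : Fin n, Fin 1) where
  toFun p := ⟨p.2, 0⟩
  invFun p := ⟨0, p.1⟩
  left_inv := by rintro ⟨i, j⟩; rw [Subsingleton.elim i 0]
  right_inv := by rintro ⟨i, j⟩; rw [Subsingleton.elim j 0]

lemma pairwise_fin_one {Q : Fin 1 → Fin 1 → Prop} : Pairwise Q :=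
  fun i j h => (h (Subsingleton.elim i j)).elim

/-- The coherence isomorphisms of `inclHom ζ`,
`⨂_i (X_i ⊗_{A(c_i)} B(c_i)) ⊗ B(t) ≅ (⨂_i X_i ⊗ A(t)) ⊗_{A(t)} B(t)`. -/
noncomputable def inclNatIso (ζ : A ⟶ B) {n : ℕ} {c : Fin n → C} {t : C} (f : OrthTuple P c t)
    (X : ∀ i, PrLin.mod K (A.alg (c i))) :
    (B.op f).obj (fun i => (indFunctor (comp ζ (c i))).obj (X i)) ≅
      (indFunctor (comp ζ t)).obj ((A.op f).obj X) :=
  Ind.nest (B.act f) (fun i (_ : Fin 1) => comp ζ (c i)) (fun i _ => asMod (X i))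
      (B.act_commute f) ≪≫
    Ind.reindex (φ := fun p : (Σ _ : Fin n, Fin 1) => (B.act f p.1).comp (comp ζ (c p.1)))
      (M := fun p => asMod (X p.1)) (swapSigma n)
      (φ' := fun p : (Σ _ : Fin 1, Fin n) => (comp ζ t).comp (A.act f p.2))
      (fun p => comp_naturality ζ f p.2) ≪≫
    (Ind.nest (fun _ : Fin 1 => comp ζ t) (fun _ => A.act f) (fun _ i => asMod (X i))
      pairwise_fin_one).symm

lemma ev_inclNatIso (ζ : A ⟶ B) {n : ℕ} {c : Fin n → C} {t : C} (f : OrthTuple P c t)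
    (X : ∀ i, PrLin.mod K (A.alg (c i))) (m : ∀ i, El (X i)) :
    ev (inclNatIso ζ f X).hom (B.gen f _ (fun i => indGen (comp ζ (c i)) (X i) (m i))) =
      indGen (comp ζ t) _ (A.gen f X m) :=
  ev_comp₃ (R := B.alg t)
    (Ind.nest_hom_tau (B.act f) (fun i (_ : Fin 1) => comp ζ (c i)) (fun i _ => asMod (X i))
      (B.act_commute f) (fun i _ => m i))
    (Ind.reindexHom_tau (φ := fun p : (Σ _ : Fin n, Fin 1) => (B.act f p.1).comp (comp ζ (c p.1)))
      (M := fun p => asMod (X p.1)) (swapSigma n)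
      (φ' := fun p : (Σ _ : Fin 1, Fin n) => (comp ζ t).comp (A.act f p.2))
      (fun p => comp_naturality ζ f p.2) (fun p => m p.1))
    (Ind.nest_inv_tau (fun _ : Fin 1 => comp ζ t) (fun _ => A.act f) (fun _ i => asMod (X i))
      pairwise_fin_one (fun _ i => m i))

lemma ext_ind (B : AQFT K P) {n : ℕ} {a : Fin n → C} {t : C} {f : OrthTuple P a t}
    {R : Fin n → Type w} [∀ i, Ring (R i)] [∀ i, Algebra K (R i)]
    {χ : ∀ i, R i →ₐ[K] B.alg (a i)} {X : ∀ i, PrLin.mod K (R i)} {N : PrLin.mod K (B.alg t)}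
    {F G : (B.op f).obj (fun i => (indFunctor (χ i)).obj (X i)) ⟶ N}
    (h : ∀ m : ∀ i, El (X i), ev F (B.gen f _ (fun i => indGen (χ i) (X i) (m i))) =
      ev G (B.gen f _ (fun i => indGen (χ i) (X i) (m i)))) : F = G := by
  refine Ind.hom_ext' (fun i => Set.range (indGen (χ i) (X i))) (fun i => span_indGen _ _) ?_
  intro m hm
  choose m' hm' using hm
  obtain rfl : (fun i => indGen (χ i) (X i) (m' i)) = m := funext hm'
  exact h m'

lemma ext_ind₂ (B : AQFT K P) {n : ℕ} {k : Fin n → ℕ} {a : Fin n → C} {b : ∀ i, Fin (k i) → C}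
    {t : C} {f : OrthTuple P a t} {g : ∀ i, OrthTuple P (b i) (a i)}
    {R : ∀ i, Fin (k i) → Type w} [∀ i j, Ring (R i j)] [∀ i j, Algebra K (R i j)]
    {χ : ∀ i j, R i j →ₐ[K] B.alg (b i j)} {X : ∀ i j, PrLin.mod K (R i j)}
    {N : PrLin.mod K (B.alg t)}
    {F G : (B.op f).obj (fun i => (B.op (g i)).obj fun j => (indFunctor (χ i j)).obj (X i j)) ⟶ N}
    (h : ∀ m : ∀ i j, El (X i j),
      ev F (B.gen f _ (fun i => B.gen (g i) _ (fun j => indGen (χ i j) (X i j) (m i j)))) =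
      ev G (B.gen f _ (fun i => B.gen (g i) _ (fun j => indGen (χ i j) (X i j) (m i j))))) :
    F = G := by
  refine Ind.hom_ext' (fun i => B.gen (g i) (fun j => (indFunctor (χ i j)).obj (X i j)) ''
      {m | ∀ j, m j ∈ Set.range (indGen (χ i j) (X i j))})
    (fun i => Ind.span_tau' _ (fun j => span_indGen _ _)) ?_
  intro m hm
  choose m' hm' hm'' using hm
  choose m₁ hm₁ using hm'
  obtain rfl : (fun i => B.gen (g i) (fun j => (indFunctor (χ i j)).obj (X i j)) (m' i)) = m :=
    funext hm''
  obtain rfl : (fun i j => indGen (χ i j) (X i j) (m₁ i j)) = m' := by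
    funext i j
    exact hm₁ i j
  exact h m₁

/-- The 1-morphism of 2AQFTs associated to a morphism of AQFTs. -/
noncomputable def inclHom (ζ : A ⟶ B) : A.incl ⟶ B.incl :=
  TwoAQFT.Hom.mk (A := A.incl) (B := B.incl)
    (app := fun c => indFunctor (comp ζ c))
    (natIso := fun f X => inclNatIso ζ f X)
    (naturality := fun {_ c t} f X Y h => ext_ind B fun m =>
      (ev_comp₂ ((B.ev_mapFam f _ _).trans
        (congrArg (B.gen f _) (funext fun i => ev_indMap (comp ζ (c i)) (h i) (m i))))
        (ev_inclNatIso ζ f Y _)).trans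
      (ev_comp₂ (ev_inclNatIso ζ f X m) ((ev_indMap (comp ζ t) _ _).trans
        (congrArg (indGen (comp ζ t) _) (A.ev_mapFam f h m)))).symm)
    (natIso_comp := fun {_ k a b t} f g X => ext_ind₂ B fun m =>
      (ev_comp₂ (B.ev_compIso f g (fun i j => (indFunctor (comp ζ (b i j))).obj (X i j))
          (fun i j => indGen (comp ζ (b i j)) (X i j) (m i j)))
        (ev_inclNatIso ζ (f.comp g) (fun p => X (seq k p).1 (seq k p).2)
          (fun p => m (seq k p).1 (seq k p).2))).trans
      (ev_comp₃ ((B.ev_mapFam f _ _).trans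
        (congrArg (B.gen f _) (funext fun i => ev_inclNatIso ζ (g i) (X i) (m i))))
        (ev_inclNatIso ζ f (fun i => (A.op (g i)).obj (X i))
          (fun i => A.gen (g i) (X i) (m i))) ((ev_indMap (comp ζ t) _ _).trans
        (congrArg (indGen (comp ζ t) _) (A.ev_compIso f g X m)))).symm)
    (natIso_one := fun t X => ind_ext fun x => by
      obtain ⟨m, rfl⟩ : ∃ m : ∀ i, El (X i), m 0 = x :=
        ⟨Function.update (fun i => (0 : asMod (X i))) 0 x, by simp⟩
      exact (ev_comp₂ (B.ev_unitIso t _ (fun i => indGen (comp ζ t) (X i) (m i)))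
        (ev_inclNatIso ζ (OrthTuple.one P t) X m)).trans
        ((ev_indMap (comp ζ t) _ _).trans
          (congrArg (indGen (comp ζ t) _) (A.ev_unitIso t X m))).symm)
    (natIso_perm := fun {_ _ c t} f σ X => ext_ind B fun m =>
      (ev_comp₂ (B.ev_permIso f σ (fun i => (indFunctor (comp ζ (c i))).obj (X i))
          (fun i => indGen (comp ζ (c i)) (X i) (m i)))
        (ev_inclNatIso ζ (f.reindex σ) (fun j => X (σ j)) (fun j => m (σ j)))).trans
      (ev_comp₂ (ev_inclNatIso ζ f X m) ((ev_indMap (comp ζ t) _ _).trans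
        (congrArg (indGen (comp ζ t) _) (A.ev_permIso f σ X m)))).symm)

end AQFT
end QFT

namespace QFT
open PrLin
open scoped ModuleCat MulOpposite TensorProduct

namespace PrLin

variable {K : Type w} [Field K] {R S T : Type w} [Ring R] [Algebra K R] [Ring S] [Algebra K S]
  [Ring T] [Algebra K T]

lemma ev_inv {M N : PrLin.mod K R} (e : M ≅ N) {x : El M} {y : El N} (h : ev e.hom x = y) :
    ev e.inv y = x := by
  rw [← h, ← ev_comp, e.hom_inv_id, ev_id]

/-- `M ⊗_R R ≅ M`. -/
noncomputable def indId {χ : R →ₐ[K] R} (h : χ = AlgHom.id K R) (M : PrLin.mod K R) :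
    (indFunctor χ).obj M ≅ M :=
  (Ind.unit (fun _ : Fin 1 => h) (fun _ => asMod M)).symm

lemma ev_indId {χ : R →ₐ[K] R} (h : χ = AlgHom.id K R) (M : PrLin.mod K R) (x : El M) :
    ev (indId h M).hom (indGen χ M x) = x :=
  ev_inv (indId h M).symm (Ind.unitHom_apply (fun _ : Fin 1 => h) (fun _ => asMod M) (fun _ => x))

/-- The natural isomorphism `M ⊗_R R ≅ M`. -/
noncomputable def indIdNat {χ : R →ₐ[K] R} (h : χ = AlgHom.id K R) :
    (indFunctor χ).toFunctor ≅ 𝟭 (PrLin.mod K R) :=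
  NatIso.ofComponents (fun M => indId h M) fun {M N} g => ind_ext fun x =>
    (ev_comp₂ (ev_indMap χ g x) (ev_indId h N _)).trans
      (ev_comp₂ (ev_indId h M x) rfl).symm

/-- `M ⊗_R T ≅ (M ⊗_R S) ⊗_S T`. -/
noncomputable def indComp {χ : R →ₐ[K] S} {ψ : S →ₐ[K] T} {ω : R →ₐ[K] T} (h : ω = ψ.comp χ)
    (M : PrLin.mod K R) :
    (indFunctor ω).obj M ≅ (indFunctor ψ).obj ((indFunctor χ).obj M) :=
  (Ind.nest (fun _ : Fin 1 => ψ) (fun _ (_ : Fin 1) => χ) (fun _ _ => asMod M)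
      (fun i j h => (h (Subsingleton.elim i j)).elim) ≪≫
    Ind.reindex (φ := fun _ : (Σ _ : Fin 1, Fin 1) => ψ.comp χ)
      (M := fun _ : (Σ _ : Fin 1, Fin 1) => asMod M) (oneSigma 1)
      (φ' := fun _ : Fin 1 => ω) (fun _ => h)).symm

lemma ev_indComp {χ : R →ₐ[K] S} {ψ : S →ₐ[K] T} {ω : R →ₐ[K] T} (h : ω = ψ.comp χ)
    (M : PrLin.mod K R) (x : El M) :
    ev (indComp h M).hom (indGen ω M x) = indGen ψ _ (indGen χ M x) :=
  ev_inv (indComp h M).symm (ev_comp₂ (R := T)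
    (Ind.nest_hom_tau (fun _ : Fin 1 => ψ) (fun _ (_ : Fin 1) => χ) (fun _ _ => asMod M)
      (fun i j h => (h (Subsingleton.elim i j)).elim) (fun _ _ => x))
    (Ind.reindexHom_tau (φ := fun _ : (Σ _ : Fin 1, Fin 1) => ψ.comp χ)
      (M := fun _ : (Σ _ : Fin 1, Fin 1) => asMod M) (oneSigma 1)
      (φ' := fun _ : Fin 1 => ω) (fun _ => h) (fun _ => x)))

/-- The natural isomorphism `M ⊗_R T ≅ (M ⊗_R S) ⊗_S T`. -/
noncomputable def indCompNat {χ : R →ₐ[K] S} {ψ : S →ₐ[K] T} {ω : R →ₐ[K] T}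
    (h : ω = ψ.comp χ) :
    (indFunctor ω).toFunctor ≅ (indFunctor χ).toFunctor ⋙ (indFunctor ψ).toFunctor :=
  NatIso.ofComponents (fun M => indComp h M) fun {M N} g => ind_ext fun x =>
    (ev_comp₂ (ev_indMap ω g x) (ev_indComp h N _)).trans
      (ev_comp₂ (ev_indComp h M x) ((ev_indMap ψ _ _).trans
        (congrArg (indGen ψ _) (ev_indMap χ g x)))).symm

end PrLin

namespace AQFT

variable {K : Type w} [Field K] {C : Type u} [Category.{v} C] {P : Orthogonality C}
  {A B D E : AQFT K P}

lemma comp_id (A : AQFT K P) (c : C) : comp (𝟙 A) c = AlgHom.id K (A.alg c) := rfl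

lemma comp_comp (ζ : A ⟶ B) (κ : B ⟶ D) (c : C) :
    comp (ζ ≫ κ) c = (comp κ c).comp (comp ζ c) := rfl

/-- The coherence isomorphism of `ι` for identities. -/
noncomputable def inclMapId (A : AQFT K P) : inclHom (𝟙 A) ≅ 𝟙 A.incl :=
  TwoAQFT.isoMk (A := A.incl) (B := A.incl) (ζ := inclHom (𝟙 A)) (κ := 𝟙 A.incl)
    (fun c => indIdNat (comp_id A c))
    (fun {_ c t} f X => ext_ind A fun m =>
      (ev_comp₂ ((A.ev_mapFam f _ _).trans
        (congrArg (A.gen f _) (funext fun i => ev_indId (comp_id A (c i)) (X i) (m i)))) rfl).trans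
      (ev_comp₂ (ev_inclNatIso (𝟙 A) f X m) (ev_indId (comp_id A t) _ _)).symm)

/-- The coherence isomorphism of `ι` for compositions. -/
noncomputable def inclMapComp (ζ : A ⟶ B) (κ : B ⟶ D) :
    inclHom (ζ ≫ κ) ≅ inclHom ζ ≫ inclHom κ :=
  TwoAQFT.isoMk (A := A.incl) (B := D.incl) (ζ := inclHom (ζ ≫ κ)) (κ := inclHom ζ ≫ inclHom κ)
    (fun c => indCompNat (comp_comp ζ κ c))
    (fun {_ c t} f X => ext_ind D fun m =>
      (ev_comp₃ ((D.ev_mapFam f _ _).trans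
        (congrArg (D.gen f _) (funext fun i => ev_indComp (comp_comp ζ κ (c i)) (X i) (m i))))
        (ev_inclNatIso κ f (fun i => (indFunctor (comp ζ (c i))).obj (X i))
          (fun i => indGen (comp ζ (c i)) (X i) (m i)))
        ((ev_indMap (comp κ t) _ _).trans
          (congrArg (indGen (comp κ t) _) (ev_inclNatIso ζ f X m)))).trans
      (ev_comp₂ (ev_inclNatIso (ζ ≫ κ) f X m) (ev_indComp (comp_comp ζ κ t) _ _)).symm)

lemma ev_eqToHom_incl {ζ ζ' : A ⟶ B} (h : ζ = ζ') (p : inclHom ζ = inclHom ζ') (c : C)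
    (M : PrLin.mod K (A.alg c)) (x : El M) :
    ev (R := B.alg c) ((TwoAQFT.Hom₂.app (eqToHom p) c).app M) (indGen (comp ζ c) M x) =
      indGen (comp ζ' c) M x := by
  subst h
  rfl

lemma inclHom_ext {ζ : A ⟶ B} {κ : A.incl ⟶ B.incl} {Γ Δ : inclHom ζ ⟶ κ}
    (h : ∀ c (M : PrLin.mod K (A.alg c)) (x : El M),
      ev (R := B.alg c) ((TwoAQFT.Hom₂.app Γ c).app M) (indGen (comp ζ c) M x) =
        ev (R := B.alg c) ((TwoAQFT.Hom₂.app Δ c).app M) (indGen (comp ζ c) M x)) : Γ = Δ :=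
  TwoAQFT.hom₂_ext fun c M => ind_ext (h c M)

open Bicategory

lemma incl_associator (ζ : A ⟶ B) (κ : B ⟶ D) (ξ : D ⟶ E)
    (p : inclHom ((ζ ≫ κ) ≫ ξ) = inclHom (ζ ≫ κ ≫ ξ)) :
    (inclMapComp (ζ ≫ κ) ξ).hom ≫ (inclMapComp ζ κ).hom ▷ inclHom ξ ≫ (α_ _ _ _).hom ≫
      inclHom ζ ◁ (inclMapComp κ ξ).inv ≫ (inclMapComp ζ (κ ≫ ξ)).inv = eqToHom p := by
  refine inclHom_ext fun c M x => ?_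
  refine Eq.trans ?_ (ev_eqToHom_incl (Category.assoc ζ κ ξ) p c M x).symm
  refine ev_comp₃ (R := E.alg c) (ev_indComp (comp_comp (ζ ≫ κ) ξ c) M x)
    ((ev_indMap (comp ξ c) _ _).trans (congrArg (indGen (comp ξ c) _)
      (ev_indComp (comp_comp ζ κ c) M x))) ?_
  refine ev_comp₃ (R := E.alg c) rfl (ev_inv (indComp (comp_comp κ ξ c) _)
    (ev_indComp (comp_comp κ ξ c) _ _)) (ev_inv (indComp (comp_comp ζ (κ ≫ ξ) c) M)
    (ev_indComp (comp_comp ζ (κ ≫ ξ) c) M x))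

lemma incl_left_unitor (ζ : A ⟶ B) (p : inclHom (𝟙 A ≫ ζ) = inclHom ζ) :
    (inclMapComp (𝟙 A) ζ).hom ≫ (inclMapId A).hom ▷ inclHom ζ ≫ (λ_ _).hom = eqToHom p := by
  refine inclHom_ext fun c M x => ?_
  refine Eq.trans ?_ (ev_eqToHom_incl (Category.id_comp ζ) p c M x).symm
  exact ev_comp₃ (R := B.alg c) (ev_indComp (comp_comp (𝟙 A) ζ c) M x)
    ((ev_indMap (comp ζ c) _ _).trans (congrArg (indGen (comp ζ c) _)
      (ev_indId (comp_id A c) M x))) rfl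

lemma incl_right_unitor (ζ : A ⟶ B) (p : inclHom (ζ ≫ 𝟙 B) = inclHom ζ) :
    (inclMapComp ζ (𝟙 B)).hom ≫ inclHom ζ ◁ (inclMapId B).hom ≫ (ρ_ _).hom = eqToHom p := by
  refine inclHom_ext fun c M x => ?_
  refine Eq.trans ?_ (ev_eqToHom_incl (Category.comp_id ζ) p c M x).symm
  exact ev_comp₃ (R := B.alg c) (ev_indComp (comp_comp ζ (𝟙 B) c) M x)
    (ev_indId (comp_id B c) _ _) rfl

end AQFT

/-- The inclusion pseudo-functor `ι`. -/
noncomputable def inclusion (K : Type w) [Field K] {C : Type u} [Category.{v} C]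
    (P : Orthogonality C) : Pseudofunctor (LocallyDiscrete (AQFT K P)) (TwoAQFT K P) :=
  LocallyDiscrete.mkPseudofunctor (fun A => A.incl) (fun ζ => AQFT.inclHom ζ)
    (fun A => AQFT.inclMapId A) (fun ζ κ => AQFT.inclMapComp ζ κ)
    (fun ζ κ ξ => AQFT.incl_associator ζ κ ξ _) (fun ζ => AQFT.incl_left_unitor ζ _)
    (fun ζ => AQFT.incl_right_unitor ζ _)

end QFT

namespace QFT
open PrLin
open scoped ModuleCat MulOpposite TensorProduct

/-! ### The unit -/

namespace AQFT

variable {K : Type w} [Field K] {C : Type u} [Category.{v} C] {P : Orthogonality C}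

section

variable (A : AQFT K P)

/-- The pointing of the associated 2AQFT, which is the free right module of rank one. -/
noncomputable def ptMod (c : C) : PrLin.mod K (A.alg c) := A.incl.pt c

/-- The unit `1` of `A(c)`, as an element of the pointing of the associated 2AQFT (which is the
free right module of rank one). -/
noncomputable def ptGen (c : C) : El (A.ptMod c) :=
  A.gen (OrthTuple.star P c) (fun i => i.elim0) (fun i => i.elim0)

lemma pt_ext {c : C} {N : PrLin.mod K (A.alg c)} {F G : A.ptMod c ⟶ N}
    (h : ev F (A.ptGen c) = ev G (A.ptGen c)) : F = G :=
  A.ext₁ (f := OrthTuple.star P c) (X := fun i => i.elim0) fun m => by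
    obtain rfl : (fun i => i.elim0) = m := by funext i; exact i.elim0
    exact h

lemma ev_op_empty {n : ℕ} (hn : n = 0) {c : Fin n → C} {t : C} (F : OrthTuple P c t)
    (X : ∀ i, PrLin.mod K (A.alg (c i))) (m : ∀ i, El (X i)) :
    ev (R := A.alg t) (eqToHom (A.incl.op_empty hn F X)) (A.gen F X m) = A.ptGen t := by
  subst hn
  obtain rfl : c = fun i => i.elim0 := Subsingleton.elim _ _
  obtain rfl : F = OrthTuple.star P t := by ext i; exact i.elim0
  obtain rfl : X = fun i => i.elim0 := by funext i; exact i.elim0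
  obtain rfl : m = fun i => i.elim0 := by funext i; exact i.elim0
  rfl

lemma ev_theta {n : ℕ} {c : Fin n → C} {t : C} (f : OrthTuple P c t) :
    ev (R := A.alg t) (A.incl.theta f).hom
      (A.gen f (fun i => A.ptMod (c i)) (fun i => A.ptGen (c i))) = A.ptGen t :=
  ev_comp₂ (R := A.alg t)
    (A.ev_compIso f (fun i => OrthTuple.star P (c i)) (fun _ j => j.elim0) (fun _ j => j.elim0))
    (A.ev_op_empty (by simp) (f.comp (fun i => OrthTuple.star P (c i)))
      (fun p => ((seq (fun _ => 0) p).2).elim0) (fun p => ((seq (fun _ => 0) p).2).elim0))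

end

end AQFT
namespace PrLin
variable {K : Type w} [Field K] {R : Type w} [Ring R] [Algebra K R]

lemma ev_add {M N : PrLin.mod K R} (f g : M ⟶ N) (x : El M) : ev (f + g) x = ev f x + ev g x := rfl

lemma ev_smul {M N : PrLin.mod K R} (r : K) (f : M ⟶ N) (x : El M) :
    ev (r • f) x = r • ev f x := rfl

lemma ev_op_smul {M N : PrLin.mod K R} (f : M ⟶ N) (a : R) (x : El M) :
    ev f (MulOpposite.op a • x) = MulOpposite.op a • ev f x :=
  (asHom f).hom.map_smul _ _

lemma algebraMap_smul' {M : PrLin.mod K R} (r : K) (x : El M) :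
    MulOpposite.op (algebraMap K R r) • x = r • x :=
  algebraMap_smul Rᵐᵒᵖ r x

end PrLin
namespace AQFT
variable {K : Type w} [Field K] {C : Type u} [Category.{v} C] {P : Orthogonality C}
variable (A : AQFT K P)

/-- Left multiplication by `a`, as an endomorphism of the free right module of rank one. -/
noncomputable def leftMul (c : C) (a : A.alg c) : A.ptMod c ⟶ A.ptMod c :=
  Ind.lift (φ := A.act (OrthTuple.star P c)) (M := fun i => i.elim0) (N := asMod (A.ptMod c))
    (MultilinearMap.constOfIsEmpty K _ (MulOpposite.op a • A.ptGen c)) (fun i => i.elim0)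

lemma ev_leftMul (c : C) (a : A.alg c) :
    ev (A.leftMul c a) (A.ptGen c) = MulOpposite.op a • A.ptGen c :=
  Ind.lift_tau (φ := A.act (OrthTuple.star P c)) (M := fun i => i.elim0) (N := asMod (A.ptMod c))
    (MultilinearMap.constOfIsEmpty K _ (MulOpposite.op a • A.ptGen c)) (fun i => i.elim0)
    (fun i => i.elim0)

lemma leftMul_add (c : C) (a b : A.alg c) :
    A.leftMul c (a + b) = A.leftMul c a + A.leftMul c b :=
  A.pt_ext (by rw [ev_add, ev_leftMul, ev_leftMul, ev_leftMul, MulOpposite.op_add, add_smul])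

lemma leftMul_smul (c : C) (r : K) (a : A.alg c) :
    A.leftMul c (r • a) = r • A.leftMul c a :=
  A.pt_ext (by
    rw [ev_smul, ev_leftMul, ev_leftMul, MulOpposite.op_smul, smul_assoc])

lemma leftMul_one (c : C) : A.leftMul c 1 = 𝟙 (A.ptMod c) :=
  A.pt_ext (by rw [ev_leftMul, MulOpposite.op_one, one_smul, ev_id])

lemma leftMul_mul (c : C) (a b : A.alg c) :
    A.leftMul c (a * b) = A.leftMul c b ≫ A.leftMul c a :=
  A.pt_ext (by
    rw [ev_comp, ev_leftMul, ev_leftMul, ev_op_smul, ev_leftMul, MulOpposite.op_mul, mul_smul])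

/-- The components `A(c) ⟶ End(A(c))` of the unit. -/
noncomputable def unitApp (c : C) : A.alg c →ₐ[K] End (A.incl.pt c) :=
  AlgHom.ofLinearMap
    { toFun := fun a => A.leftMul c a
      map_add' := A.leftMul_add c
      map_smul' := A.leftMul_smul c }
    (A.leftMul_one c) (A.leftMul_mul c)

lemma ev_unitApp (c : C) (a : A.alg c) :
    ev (R := A.alg c) (M := A.ptMod c) (N := A.ptMod c) (A.unitApp c a) (A.ptGen c) =
      MulOpposite.op a • A.ptGen c :=
  A.ev_leftMul c a

lemma gen_op_smul {n : ℕ} {c : Fin n → C} {t : C} (f : OrthTuple P c t)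
    (X : ∀ i, PrLin.mod K (A.alg (c i))) (i : Fin n) (a : A.alg (c i)) (m m' : ∀ i, El (X i))
    (h : m' i = MulOpposite.op a • m i) (h' : ∀ j, j ≠ i → m' j = m j) :
    A.gen f X m' = MulOpposite.op (A.act f i a) • A.gen f X m :=
  Ind.tau_balanced (A.act f) X i a m m' h h'

lemma span_ptGen (c : C) (x : El (A.ptMod c)) : ∃ a : A.alg c, x = MulOpposite.op a • A.ptGen c := by
  have h := A.span_gen (OrthTuple.star P c) (fun i => i.elim0)
  have e : Set.range (A.gen (OrthTuple.star P c) (fun i => i.elim0)) = {A.ptGen c} := by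
    ext y
    constructor
    · rintro ⟨m, rfl⟩
      obtain rfl : (fun i => i.elim0) = m := by funext i; exact i.elim0
      rfl
    · rintro rfl
      exact ⟨_, rfl⟩
  have hx : x ∈ Submodule.span (A.alg c)ᵐᵒᵖ {A.ptGen c} :=
    ((congrArg (Submodule.span (A.alg c)ᵐᵒᵖ) e).symm.trans h).ge trivial
  obtain ⟨a, rfl⟩ := Submodule.mem_span_singleton.mp hx
  exact ⟨a.unop, rfl⟩

lemma ext_single {c t : C} {f : c ⟶ t} {N : PrLin.mod K (A.alg t)}
    {F G : (A.op (OrthTuple.single P f)).obj (fun _ => A.ptMod c) ⟶ N}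
    (h : ev F (A.gen (OrthTuple.single P f) (fun _ => A.ptMod c) (fun _ => A.ptGen c)) =
      ev G (A.gen (OrthTuple.single P f) (fun _ => A.ptMod c) (fun _ => A.ptGen c))) : F = G :=
  A.ext₁ fun m => by
    obtain ⟨a, ha⟩ := A.span_ptGen c (m 0)
    have := A.gen_op_smul (OrthTuple.single P f) (fun _ => A.ptMod c) 0 a (fun _ => A.ptGen c) m
      ha (fun j hj => (hj (Subsingleton.elim j 0)).elim)
    rw [this, ev_op_smul, ev_op_smul, h]

lemma unitApp_naturality {c t : C} (f : c ⟶ t) (a : A.alg c) :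
    A.unitApp t (A.act (OrthTuple.single P f) 0 a) = A.incl.truncAlgHom f (A.unitApp c a) := by
  refine ((Iso.inv_comp_eq (A.incl.theta (OrthTuple.single P f))).mpr (A.ext_single ?_)).symm
  exact (ev_comp₂ (R := A.alg t) ((A.ev_mapFam (OrthTuple.single P f) _ _).trans
      (A.gen_op_smul (OrthTuple.single P f) (fun _ => A.ptMod c) 0 a (fun _ => A.ptGen c) _
        (A.ev_leftMul c a) (fun j hj => (hj (Subsingleton.elim j 0)).elim)))
    ((ev_op_smul _ _ _).trans (congrArg (MulOpposite.op (A.act (OrthTuple.single P f) 0 a) • ·)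
      (A.ev_theta (OrthTuple.single P f))))).trans
    (ev_comp₂ (R := A.alg t) (A.ev_theta (OrthTuple.single P f)) (A.ev_leftMul t _)).symm

/-- The unit `A ⟶ π ι A`, given by left multiplication. -/
noncomputable def unitHom : A ⟶ A.incl.trunc :=
  ObjectProperty.homMk
    { app := fun c => AlgCat.ofHom (A.unitApp c)
      naturality := fun c t f => by
        ext a
        exact A.unitApp_naturality f a }

variable {A} {B : AQFT K P}

lemma indGen_op_smul {R S : Type w} [Ring R] [Algebra K R] [Ring S] [Algebra K S]
    (χ : R →ₐ[K] S) (M : PrLin.mod K R) (a : R) (x : El M) :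
    indGen χ M (MulOpposite.op a • x) = MulOpposite.op (χ a) • indGen χ M x :=
  Ind.tau_balanced (fun _ : Fin 1 => χ) (fun _ => asMod M) 0 a (fun _ => x) _ rfl
    (fun j hj => (hj (Subsingleton.elim j 0)).elim)

lemma ev_starIso (ζ : A ⟶ B) (c : C) :
    ev (R := B.alg c) (M := B.ptMod c) (N := (indFunctor (comp ζ c)).obj (A.ptMod c))
      (TwoAQFT.starIso (inclHom ζ) c).hom (B.ptGen c) = indGen (comp ζ c) _ (A.ptGen c) :=
  ev_comp₂ (R := B.alg c) (ev_inv (eqToIso (B.incl.op_empty rfl (OrthTuple.star P c) _))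
      (B.ev_op_empty rfl (OrthTuple.star P c)
        (fun i => (indFunctor (comp ζ ((fun i : Fin 0 => i.elim0) i))).obj (i.elim0))
        (fun i => i.elim0)))
    ((congrArg _ (congrArg (B.gen (OrthTuple.star P c) _) (by funext i; exact i.elim0))).trans
      (ev_inclNatIso ζ (OrthTuple.star P c) (fun i => i.elim0) (fun i => i.elim0)))

lemma unitApp_comp (ζ : A ⟶ B) (c : C) (a : A.alg c) :
    B.unitApp c (comp ζ c a) = TwoAQFT.truncHomApp (inclHom ζ) c (A.unitApp c a) := by
  rw [TwoAQFT.truncHomApp_apply, ← Category.assoc]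
  refine (Iso.eq_comp_inv (TwoAQFT.starIso (inclHom ζ) c)).mpr (B.pt_ext ?_)
  exact (ev_comp₂ (R := B.alg c) (B.ev_leftMul c _) ((ev_op_smul _ _ _).trans
      (congrArg (MulOpposite.op (comp ζ c a) • ·) (ev_starIso ζ c)))).trans
    (ev_comp₂ (R := B.alg c) (ev_starIso ζ c) ((ev_indMap (comp ζ c) _ _).trans
      ((congrArg (indGen (comp ζ c) _) (A.ev_leftMul c a)).trans
        (indGen_op_smul (comp ζ c) _ a _)))).symm

lemma unitHom_naturality (ζ : A ⟶ B) :
    ζ ≫ B.unitHom = A.unitHom ≫ TwoAQFT.truncHom (inclHom ζ) := by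
  apply ObjectProperty.hom_ext
  ext c a
  exact unitApp_comp ζ c a

end AQFT

/-- Strong transformations between pseudofunctors with values in a category, regarded as a
2-category with only identity 2-morphisms. -/
def strongTransOfEq {B : Type*} [Bicategory B] {D : Type*} [Category D]
    {F G : Pseudofunctor B (LocallyDiscrete D)} (app : ∀ a, F.obj a ⟶ G.obj a)
    (h : ∀ {a b : B} (f : a ⟶ b), F.map f ≫ app b = app a ≫ G.map f) :
    Pseudofunctor.StrongTrans F G where
  app := app
  naturality f := eqToIso (h f)
  naturality_naturality _ := Subsingleton.elim _ _
  naturality_id _ := Subsingleton.elim _ _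
  naturality_comp _ _ := Subsingleton.elim _ _

/-- The unit `η : id ⟶ π ι`. -/
noncomputable def truncationUnit (K : Type w) [Field K] {C : Type u} [Category.{v} C]
    (P : Orthogonality C) :
    Pseudofunctor.StrongTrans (Pseudofunctor.id (LocallyDiscrete (AQFT K P)))
      ((inclusion K P).comp (truncation K P)) :=
  strongTransOfEq (fun A => (AQFT.unitHom A.as).toLoc)
    (fun ζ => congrArg Quiver.Hom.toLoc (AQFT.unitHom_naturality ζ.as))

/-! ### Biadjunctions -/

section Biadjunction

open Bicategory

universe w₁ w₂ v₁ v₂ u₁ u₂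

variable {B : Type u₁} [Bicategory.{w₁, v₁} B] {D : Type u₂} [Bicategory.{w₂, v₂} D]

/-- The functor `(L a ⟶ b) ⥤ (a ⟶ R b)`, `ζ ↦ R(ζ) ∘ η_a`, associated to a transformation
`η : id ⟶ R L`. -/
def homComparison {L : Pseudofunctor B D} {R : Pseudofunctor D B}
    (η : Pseudofunctor.StrongTrans (Pseudofunctor.id B) (L.comp R)) (a : B) (b : D) :
    (L.obj a ⟶ b) ⥤ (a ⟶ R.obj b) where
  obj ζ := η.app a ≫ R.map ζ
  map Γ := η.app a ◁ R.map₂ Γ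
  map_id ζ := by
    rw [R.map₂_id]
    exact Bicategory.whiskerLeft_id _ _
  map_comp _ _ := by
    rw [R.map₂_comp]
    exact Bicategory.whiskerLeft_comp _ _ _

/-- A biadjunction `L ⊣ R`: pseudo-natural transformations `η : id ⟶ R L` and `ε : L R ⟶ id`,
invertible modifications filling the two triangles, and the two swallowtail identities. -/
structure Biadjunction (L : Pseudofunctor B D) (R : Pseudofunctor D B) where
  unit : Pseudofunctor.StrongTrans (Pseudofunctor.id B) (L.comp R)
  counit : Pseudofunctor.StrongTrans (R.comp L) (Pseudofunctor.id D)
  /-- the left triangle -/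
  left : ∀ a : B, L.map (unit.app a) ≫ counit.app (L.obj a) ≅ 𝟙 (L.obj a)
  /-- the right triangle -/
  right : ∀ b : D, unit.app (R.obj b) ≫ R.map (counit.app b) ≅ 𝟙 (R.obj b)
  left_naturality : ∀ {a a' : B} (f : a ⟶ a'),
    L.map f ◁ (left a').hom ≫ (ρ_ (L.map f)).hom =
      (α_ (L.map f) (L.map (unit.app a')) (counit.app (L.obj a'))).inv ≫
      ((L.mapComp f (unit.app a')).inv ≫ L.map₂ (unit.naturality f).hom ≫
        (L.mapComp (unit.app a) (R.map (L.map f))).hom) ▷ counit.app (L.obj a') ≫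
      (α_ (L.map (unit.app a)) (L.map (R.map (L.map f))) (counit.app (L.obj a'))).hom ≫
      L.map (unit.app a) ◁ (counit.naturality (L.map f)).hom ≫
      (α_ (L.map (unit.app a)) (counit.app (L.obj a)) (L.map f)).inv ≫
      (left a).hom ▷ L.map f ≫ (λ_ (L.map f)).hom
  right_naturality : ∀ {b b' : D} (g : b ⟶ b'),
    R.map g ◁ (right b').hom ≫ (ρ_ (R.map g)).hom =
      (α_ (R.map g) (unit.app (R.obj b')) (R.map (counit.app b'))).inv ≫
      (unit.naturality (R.map g)).hom ▷ R.map (counit.app b') ≫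
      (α_ (unit.app (R.obj b)) (R.map (L.map (R.map g))) (R.map (counit.app b'))).hom ≫
      unit.app (R.obj b) ◁ ((R.mapComp (L.map (R.map g)) (counit.app b')).inv ≫
        R.map₂ (counit.naturality g).hom ≫ (R.mapComp (counit.app b) g).hom) ≫
      (α_ (unit.app (R.obj b)) (R.map (counit.app b)) (R.map g)).inv ≫
      (right b).hom ▷ R.map g ≫ (λ_ (R.map g)).hom
  swallowtail_unit : ∀ a : B,
    unit.app a ◁ (right (L.obj a)).hom =
      (α_ (unit.app a) (unit.app (R.obj (L.obj a))) (R.map (counit.app (L.obj a)))).inv ≫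
      (unit.naturality (unit.app a)).hom ▷ R.map (counit.app (L.obj a)) ≫
      (α_ (unit.app a) (R.map (L.map (unit.app a))) (R.map (counit.app (L.obj a)))).hom ≫
      unit.app a ◁ ((R.mapComp (L.map (unit.app a)) (counit.app (L.obj a))).inv ≫
        R.map₂ (left a).hom ≫ (R.mapId (L.obj a)).hom)
  swallowtail_counit : ∀ b : D,
    (left (R.obj b)).hom ▷ counit.app b =
      (α_ (L.map (unit.app (R.obj b))) (counit.app (L.obj (R.obj b))) (counit.app b)).hom ≫
      L.map (unit.app (R.obj b)) ◁ (counit.naturality (counit.app b)).inv ≫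
      (α_ (L.map (unit.app (R.obj b))) (L.map (R.map (counit.app b))) (counit.app b)).inv ≫
      ((L.mapComp (unit.app (R.obj b)) (R.map (counit.app b))).inv ≫
        L.map₂ (right b).hom ≫ (L.mapId (R.obj b)).hom) ▷ counit.app b

end Biadjunction

end QFT

/-!
# Algebraic quantum field theories as a coreflective 2-category of 2AQFTs

Right modules over an algebra `R` are generated under colimits by the free module of rank one, so a
co-continuous linear functor from right `R`-modules to a cocomplete linear category is determined by
its value `d` at `R` together with the algebra map `R → End(d)`, and every such pair occurs: the
functor is `(-) ⊗_R d`, the left adjoint of `Hom(d, -)` (`PrLin.tensorFunctor`, `PrLin.exists_adj`).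

Let `A` be an AQFT and `B` a 2AQFT.  A 1-morphism `ζ : ι A ⟶ B` identifies the value of `ζ_c` at the
free module `A(c)` with the pointing `b_c`, so `ζ_c` is `(-) ⊗_{A(c)} b_c`, for the action
`AQFT.mate ζ c : A(c) → End(b_c)`, which is the component of `π(ζ) ∘ η_A`.  In particular `ζ_c(M)`
is generated by morphisms `b_c ⟶ ζ_c(M)` indexed by the elements of `M` (`AQFT.homGen`).  The
coherences of 1-morphisms prescribe what the structure isomorphisms of `ζ` do on generators
(`AQFT.mapFam_homGen`), and 2-morphisms preserve generators.  Hence parallel 2-morphisms are equal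
(`AQFT.hom₂_eq`), and 1-morphisms with equal mates are isomorphic (`AQFT.exists_iso`).

Conversely, a morphism `φ : A ⟶ π B` extends to a 1-morphism with components `(-) ⊗_{A(c)} b_c`
(`AQFT.extend`).  A tuple of elements `x i` of modules `X i` gives the factorization product of the
generators `x i ⊗ -`; this is multilinear and, by naturality of `φ`, balanced, so it defines a
comparison morphism `AQFT.extOpHom` out of the image of the relative tensor product.  It is natural,
both sides are co-continuous in each variable, and for free modules of rank one it is a coherence
isomorphism of `B`; replacing the free modules one at a time shows that it is always invertible
(`PrLin.isIso_app_of_isFreeGenerator`).  Its coherence conditions are checked on generators.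

This gives the equivalence of morphism categories.  The unit `η_A` is invertible because
endomorphisms of the free module of rank one are left multiplications
(`AQFT.unitApp_bijective`).  The counit is the extension of the identity of `π B`, its naturality
and the triangles are isomorphisms between 1-morphisms with equal mates, and all equations between
2-morphisms hold because both sides are parallel 2-morphisms between 1-morphisms out of some `ι A`,
or lie in a 2-category with only identity 2-morphisms (`Biadjunction.ofSubsingleton`).  Full faithfulness of `ι`
follows from the equivalence of morphism categories and the invertibility of `η`.
-/

namespace QFT
open PrLin
open scoped ModuleCat MulOpposite TensorProduct

/-! ### Modules are generated under colimits by the ring -/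

/-- A property of modules which is inherited by small colimits holds for all modules as soon as it
holds for the ring: every module is the cokernel of a map between free modules. -/
lemma moduleCat_induction {S : Type w} [Ring S] (P : ObjectProperty (ModuleCat.{w} S))
    (hP : ∀ (J : Type w) [SmallCategory J] (F : J ⥤ ModuleCat.{w} S) (c : Cocone F), IsColimit c →
      (∀ j, P (F.obj j)) → P c.pt)
    (hS : P (ModuleCat.of S S)) (M : ModuleCat.{w} S) : P M := by
  have hfree : ∀ I : Type w, P (∐ fun _ : I => ModuleCat.of S S) := fun I =>
    hP _ _ _ (colimit.isColimit _) (fun _ => hS)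
  have hcov : ∀ N : ModuleCat.{w} S, Epi (Sigma.desc (fun x : N =>
      ModuleCat.ofHom (LinearMap.toSpanSingleton S N x))) := by
    intro N
    rw [ModuleCat.epi_iff_surjective]
    intro x
    refine ⟨(Sigma.ι (fun _ : N => ModuleCat.of S S) x).hom (1 : S), ?_⟩
    rw [← LinearMap.comp_apply, ← ModuleCat.hom_comp, Sigma.ι_desc]
    simp [LinearMap.toSpanSingleton]
  let p := Sigma.desc (fun x : M => ModuleCat.ofHom (LinearMap.toSpanSingleton S M x))
  have := hcov M
  have := hcov (kernel p)
  have hc := isCokernelEpiComp (Abelian.epiIsCokernelOfKernel (f := p) _ (kernelIsKernel p))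
    (Sigma.desc (fun x : (kernel p : ModuleCat.{w} S) =>
      ModuleCat.ofHom (LinearMap.toSpanSingleton S (kernel p : ModuleCat.{w} S) x))) rfl
  -- `hP` quantifies over index categories in the universe `w`, so the cokernel diagram is lifted
  -- to that universe.
  let e : WalkingParallelPair ≌ ULiftHom.{w} (ULift.{w} WalkingParallelPair) :=
    ULiftHomULiftCategory.equiv _
  refine hP _ _ _ (hc.whiskerEquivalence e.symm) ?_
  intro j
  rw [Functor.comp_obj]
  cases e.symm.functor.obj j <;> exact hfree _

lemma existsUnique_hom_of_self {S : Type w} [Ring S] (M : ModuleCat.{w} S) (x : M) :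
    ∃! g : ModuleCat.of S S ⟶ M, g.hom (1 : S) = x := by
  refine ⟨ModuleCat.ofHom (LinearMap.toSpanSingleton S M x),
    LinearMap.toSpanSingleton_apply_one _ _ _, ?_⟩
  intro g hg
  refine ModuleCat.hom_ext (LinearMap.ext_ring (hg.trans ?_))
  exact (LinearMap.toSpanSingleton_apply_one _ _ _).symm

/-! ### Hom functors into right modules -/

namespace PrLin
variable {K : Type w} [Field K] {R : Type w} [Ring R] [Algebra K R] {D : PrLin K}

/-- The morphism of right modules given by an additive function which respects the right action. -/
def homOfEl {M N : PrLin.mod K R} (h : El M → El N) (h_add : ∀ x y, h (x + y) = h x + h y)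
    (h_smul : ∀ (a : R) x, h (MulOpposite.op a • x) = MulOpposite.op a • h x) : M ⟶ N :=
  show asMod M ⟶ asMod N from ModuleCat.ofHom (X := (asMod M : Type w)) (Y := (asMod N : Type w))
    { toFun := h, map_add' := h_add, map_smul' := fun a x => h_smul a.unop x }

@[simp]
lemma ev_homOfEl {M N : PrLin.mod K R} (h : El M → El N) (h_add : ∀ x y, h (x + y) = h x + h y)
    (h_smul : ∀ (a : R) x, h (MulOpposite.op a • x) = MulOpposite.op a • h x) (x : El M) :
    ev (homOfEl h h_add h_smul) x = h x := rfl

/-- The functor `Y ↦ Hom(d, Y)` to right `R`-modules, where `R` acts on `Hom(d, Y)` by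
precomposition through `ρ : R → End(d)`. -/
noncomputable def homFunctor {d : D} (ρ : R →ₐ[K] End d) : D ⥤ PrLin.mod K R :=
  preadditiveCoyonedaObj d ⋙ ModuleCat.restrictScalars ρ.toRingHom.op

variable {d : D} (ρ : R →ₐ[K] End d)

/-- Elements of the right module `Hom(d, Y)` are the morphisms `d ⟶ Y`. -/
def homEl {Y : D} : El ((homFunctor ρ).obj Y) ≃+ (d ⟶ Y) where
  toFun h := h
  invFun h := h
  left_inv _ := rfl
  right_inv _ := rfl
  map_add' _ _ := rfl

lemma homEl_op_smul {Y : D} (a : R) (h : El ((homFunctor ρ).obj Y)) :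
    homEl ρ (MulOpposite.op a • h) = ρ a ≫ homEl ρ h := rfl

lemma homEl_smul {Y : D} (r : K) (h : El ((homFunctor ρ).obj Y)) :
    homEl ρ (r • h) = r • homEl ρ h := by
  rw [← algebraMap_smul', homEl_op_smul, AlgHom.commutes, Algebra.algebraMap_eq_smul_one]
  exact (Linear.smul_comp _ _ _ _ _ _).trans (congrArg (r • ·) (Category.id_comp _))

lemma hasColimits (D : PrLin K) : HasColimitsOfSize.{w, w} D := by
  obtain ⟨κ, _, _⟩ := IsLocallyPresentable.exists_cardinal.{w} D
  exact IsCardinalLocallyPresentable.toHasColimitsOfSize κ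

/-! ### Free modules of rank one -/

/-- `u` is a basis of the right module `U`, in the form of a universal property: morphisms out of
`U` are determined by the image of `u`, which is arbitrary. -/
def IsFreeGenerator {U : PrLin.mod K R} (u : El U) : Prop :=
  ∀ (M : PrLin.mod K R) (x : El M), ∃! g : U ⟶ M, ev g u = x

/-- The free right `R`-module of rank one. -/
def free (K R : Type w) [Field K] [Ring R] [Algebra K R] : PrLin.mod K R := ModuleCat.of Rᵐᵒᵖ Rᵐᵒᵖ

/-- The unit of `R`, as an element of the free right module of rank one. -/
def freeOne (K R : Type w) [Field K] [Ring R] [Algebra K R] : El (free K R) := (1 : Rᵐᵒᵖ)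

lemma isFreeGenerator_freeOne : IsFreeGenerator (freeOne K R) :=
  fun M x => existsUnique_hom_of_self (asMod M) x

namespace IsFreeGenerator
variable {U V : PrLin.mod K R} {u : El U} {v : El V}

lemma hom_ext (hu : IsFreeGenerator u) {M : PrLin.mod K R} {g g' : U ⟶ M}
    (h : ev g u = ev g' u) : g = g' := (hu M _).unique h rfl

/-- The morphism which sends the generator to `x`. -/
noncomputable def hom (hu : IsFreeGenerator u) {M : PrLin.mod K R} (x : El M) : U ⟶ M :=
  (hu M x).choose

lemma ev_hom (hu : IsFreeGenerator u) {M : PrLin.mod K R} (x : El M) : ev (hu.hom x) u = x :=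
  (hu M x).choose_spec.1

/-- Free modules of rank one are isomorphic. -/
noncomputable def iso (hu : IsFreeGenerator u) (hv : IsFreeGenerator v) : U ≅ V where
  hom := hu.hom v
  inv := hv.hom u
  hom_inv_id := hu.hom_ext (by rw [ev_comp, ev_hom, ev_hom, ev_id])
  inv_hom_id := hv.hom_ext (by rw [ev_comp, ev_hom, ev_hom, ev_id])

/-- A property of right modules which is inherited by small colimits holds for all of them as soon
as it holds for one free module of rank one. -/
lemma induction (hu : IsFreeGenerator u) (P : ObjectProperty (PrLin.mod K R))
    [P.IsClosedUnderIsomorphisms]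
    (hP : ∀ (J : Type w) [SmallCategory J] (F : J ⥤ PrLin.mod K R) (c : Cocone F), IsColimit c →
      (∀ j, P (F.obj j)) → P c.pt)
    (hU : P U) (M : PrLin.mod K R) : P M :=
  moduleCat_induction P hP (P.prop_of_iso (hu.iso isFreeGenerator_freeOne) hU) M

/-- A transformation between co-continuous functors on right modules is invertible as soon as its
component at one free module of rank one is. -/
lemma isIso_app (hu : IsFreeGenerator u) {E : Type*} [Category E] {F G : PrLin.mod K R ⥤ E}
    [PreservesColimitsOfSize.{w, w} F] [PreservesColimitsOfSize.{w, w} G] (α : F ⟶ G)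
    (hU : IsIso (α.app U)) (M : PrLin.mod K R) : IsIso (α.app M) := by
  let P : ObjectProperty (PrLin.mod K R) := fun M => IsIso (α.app M)
  have : P.IsClosedUnderIsomorphisms := ⟨fun e h => (NatTrans.isIso_app_iff_of_iso α e).mp h⟩
  refine hu.induction P (fun J _ T c hc h => ?_) hU M
  have : IsIso (Functor.whiskerLeft T α) :=
    (NatTrans.isIso_iff_isIso_app _).mpr h
  exact isIso_app_coconePt_of_preservesColimit T α c hc

end IsFreeGenerator

/-! ### Co-continuous functors on right modules -/

/-- `Hom(d, -)` has a left adjoint, the functor `(-) ⊗_R d`.  The modules at which a left adjoint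
is defined are closed under colimits, and they contain the free module of rank one, where the value
is `d`. -/
instance isRightAdjoint_homFunctor : (homFunctor ρ).IsRightAdjoint := by
  have := hasColimits D
  refine Functor.isRightAdjoint_of_leftAdjointObjIsDefined_eq_top (top_le_iff.mp fun M _ => ?_)
  refine moduleCat_induction (homFunctor ρ).leftAdjointObjIsDefined
    (fun J _ F c hc h => Functor.leftAdjointObjIsDefined_of_isColimit hc h) ?_ M
  have hf := isFreeGenerator_freeOne (K := K) (R := R)
  let e : ((homFunctor ρ) ⋙ coyoneda.obj (Opposite.op (free K R))).CorepresentableBy d :=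
    { homEquiv := fun {Y} =>
        { toFun := fun g => hf.hom ((homEl ρ).symm g)
          invFun := fun h => homEl ρ (ev (K := K) (R := R) (M := free K R) h (freeOne K R))
          left_inv := fun g => (congrArg (homEl ρ) (hf.ev_hom _)).trans rfl
          right_inv := fun h => hf.hom_ext (hf.ev_hom _) }
      homEquiv_comp := fun g f => hf.hom_ext (by
        refine (hf.ev_hom _).trans ?_
        exact (congrArg (ev ((homFunctor ρ).map g)) (hf.ev_hom ((homEl ρ).symm f))).symm) }
  exact e.isCorepresentable

variable {ρ}

/-- For a left adjoint `F` of `Hom(d, -)`, the morphism `d ⟶ F(M)` which corresponds to an element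
`x` of `M` under the unit; it is `x ⊗ -` when `F` is written as `(-) ⊗_R d`. -/
noncomputable def adjGen {F : PrLin.mod K R ⥤ D} (adj : F ⊣ homFunctor ρ) {M : PrLin.mod K R}
    (x : El M) : d ⟶ F.obj M := homEl ρ (ev (adj.unit.app M) x)

section adj
variable {F : PrLin.mod K R ⥤ D} (adj : F ⊣ homFunctor ρ)

lemma adjGen_add {M : PrLin.mod K R} (x y : El M) :
    adjGen adj (x + y) = adjGen adj x + adjGen adj y := by
  unfold adjGen
  rw [← map_add]
  exact congrArg (homEl ρ) (map_add (asHom (adj.unit.app M)).hom x y)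

lemma adjGen_op_smul {M : PrLin.mod K R} (a : R) (x : El M) :
    adjGen adj (MulOpposite.op a • x) = ρ a ≫ adjGen adj x := by
  unfold adjGen
  rw [ev_op_smul, homEl_op_smul]

lemma adjGen_smul {M : PrLin.mod K R} (r : K) (x : El M) :
    adjGen adj (r • x) = r • adjGen adj x := by
  rw [← algebraMap_smul', adjGen_op_smul, AlgHom.commutes, Algebra.algebraMap_eq_smul_one]
  exact (Linear.smul_comp _ _ _ _ _ _).trans (congrArg (r • ·) (Category.id_comp _))

lemma adjGen_map {M N : PrLin.mod K R} (g : M ⟶ N) (x : El M) :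
    adjGen adj x ≫ F.map g = adjGen adj (ev g x) := by
  have := adj.unit.naturality g
  exact congrArg (fun k => homEl ρ (ev k x)) this.symm

/-- The morphism adjoint to `h` sends the generator `x ⊗ -` to `h(x)`. -/
lemma adjGen_desc {M : PrLin.mod K R} {Y : D} (h : M ⟶ (homFunctor ρ).obj Y) (x : El M) :
    adjGen adj x ≫ (adj.homEquiv M Y).symm h = homEl ρ (ev h x) := by
  have := (adj.homEquiv M Y).apply_symm_apply h
  rw [adj.homEquiv_unit] at this
  exact congrArg (fun k => homEl ρ (ev k x)) this

lemma adj_hom_ext {M : PrLin.mod K R} {Y : D} {g g' : F.obj M ⟶ Y}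
    (h : ∀ x, adjGen adj x ≫ g = adjGen adj x ≫ g') : g = g' := by
  apply (adj.homEquiv M Y).injective
  rw [adj.homEquiv_unit, adj.homEquiv_unit]
  exact ev_ext h

end adj

/-- The left adjoint `(-) ⊗_R d` of `Hom(d, -)`. -/
noncomputable def tensorFunctor (ρ : R →ₐ[K] End d) : LinFunctor (PrLin.mod K R) D where
  toFunctor := (homFunctor ρ).leftAdjoint
  map_add g g' := adj_hom_ext (Adjunction.ofIsRightAdjoint (homFunctor ρ)) fun x => by
    rw [Preadditive.comp_add, adjGen_map, adjGen_map, adjGen_map, ev_add, adjGen_add]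
  map_smul r g := adj_hom_ext (Adjunction.ofIsRightAdjoint (homFunctor ρ)) fun x => by
    rw [Linear.comp_smul, adjGen_map, adjGen_map, ev_smul, adjGen_smul]
  cocontinuous := (Adjunction.ofIsRightAdjoint (homFunctor ρ)).leftAdjoint_preservesColimits

/-- The adjunction between `(-) ⊗_R d` and `Hom(d, -)`. -/
noncomputable def tensorAdj (ρ : R →ₐ[K] End d) :
    (tensorFunctor ρ).toFunctor ⊣ homFunctor ρ := Adjunction.ofIsRightAdjoint (homFunctor ρ)

/-- A basis `u` of `U` gives an isomorphism `d ≅ U ⊗_R d`. -/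
lemma isIso_adjGen {F : PrLin.mod K R ⥤ D} (adj : F ⊣ homFunctor ρ) {U : PrLin.mod K R} {u : El U}
    (hu : IsFreeGenerator u) : IsIso (adjGen adj u) := by
  have h1 : adjGen adj u ≫ (adj.homEquiv U d).symm (hu.hom ((homEl ρ).symm (𝟙 d))) = 𝟙 d := by
    rw [adjGen_desc, hu.ev_hom]
    rfl
  refine ⟨_, h1, ?_⟩
  apply (adj.homEquiv U _).injective
  refine hu.hom_ext ?_
  rw [adj.homEquiv_unit, adj.homEquiv_unit]
  change adjGen adj u ≫ _ ≫ _ = adjGen adj u ≫ 𝟙 _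
  rw [reassoc_of% h1, Category.comp_id]

/-- The theorem of Eilenberg and Watts: a co-continuous linear functor `F` on right modules is left
adjoint to `Hom(d, -)`, where `d` is the value of `F` at a free module of rank one, on which `R`
acts through left multiplications. -/
lemma exists_adj (F : LinFunctor (PrLin.mod K R) D) {U : PrLin.mod K R} {u : El U}
    (hu : IsFreeGenerator u) (s : d ≅ F.obj U)
    (hs : ∀ (a : R), s.hom ≫ F.map (hu.hom (MulOpposite.op a • u)) = ρ a ≫ s.hom) :
    ∃ adj : F.toFunctor ⊣ homFunctor ρ, ∀ {M : PrLin.mod K R} (x : El M),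
      adjGen adj x = s.hom ≫ F.map (hu.hom x) := by
  have := F.cocontinuous
  have := (tensorFunctor ρ).cocontinuous
  -- The unit of the adjunction to be constructed: `x` is sent to `F` of the morphism which sends
  -- the basis to `x`.
  let γ : ∀ M : PrLin.mod K R, M ⟶ (homFunctor ρ).obj (F.obj M) := fun M =>
    homOfEl
      (fun x => (homEl ρ).symm (s.hom ≫ F.map (hu.hom x)))
      (fun x y => by
        rw [← map_add, ← Preadditive.comp_add, ← F.map_add]
        congr 3
        exact hu.hom_ext (by rw [ev_add, hu.ev_hom, hu.ev_hom, hu.ev_hom]))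
      (fun a x => by
        apply (homEl ρ).injective
        rw [homEl_op_smul, AddEquiv.apply_symm_apply, AddEquiv.apply_symm_apply,
          ← Category.assoc, ← hs, Category.assoc, ← F.map_comp]
        congr 2
        exact hu.hom_ext (by
          rw [ev_comp, hu.ev_hom, hu.ev_hom, ev_op_smul, hu.ev_hom]))
  have hγ : ∀ M (x : El M), homEl ρ (ev (γ M) x) = s.hom ≫ F.map (hu.hom x) := fun M x => by
    simp only [γ, ev_homOfEl, AddEquiv.apply_symm_apply]
  let α : (tensorFunctor ρ).toFunctor ⟶ F.toFunctor :=
    { app := fun M => ((tensorAdj ρ).homEquiv M _).symm (γ M)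
      naturality := fun M N g => adj_hom_ext (tensorAdj ρ) fun x => by
        rw [← Category.assoc, adjGen_map, adjGen_desc, ← Category.assoc, adjGen_desc, hγ, hγ,
          Category.assoc, ← F.map_comp]
        congr 2
        exact hu.hom_ext (by rw [ev_comp, hu.ev_hom, hu.ev_hom]) }
  have hα : ∀ M (x : El M), adjGen (tensorAdj ρ) x ≫ α.app M = s.hom ≫ F.map (hu.hom x) :=
    fun M x => (adjGen_desc (tensorAdj ρ) (γ M) x).trans (hγ M x)
  -- The comparison from `(-) ⊗_R d` is checked at the free module, where it is `s` up to the
  -- isomorphism `d ≅ U ⊗_R d`.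
  have hU : IsIso (α.app U) := by
    have h1 := isIso_adjGen (tensorAdj ρ) hu
    have h2 : adjGen (tensorAdj ρ) u ≫ α.app U = s.hom := by
      have : hu.hom u = 𝟙 U := hu.hom_ext (hu.ev_hom u)
      rw [hα, this, F.map_id, Category.comp_id]
    have h3 : IsIso (adjGen (tensorAdj ρ) u ≫ α.app U) := by rw [h2]; infer_instance
    exact IsIso.of_isIso_comp_left (adjGen (tensorAdj ρ) u) (α.app U)
  have := fun M => hu.isIso_app α hU M
  let e := NatIso.ofComponents (fun M => asIso (α.app M)) (fun g => α.naturality g)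
  refine ⟨(tensorAdj ρ).ofNatIsoLeft e, fun {M} x => ?_⟩
  rw [← hα]
  rfl

lemma adj_hom_ext_span {F : PrLin.mod K R ⥤ D} (adj : F ⊣ homFunctor ρ) {M : PrLin.mod K R}
    (S : Set (El M)) (hS : Submodule.span Rᵐᵒᵖ S = ⊤) {Y : D} {g g' : F.obj M ⟶ Y}
    (h : ∀ x ∈ S, adjGen adj x ≫ g = adjGen adj x ≫ g') : g = g' := by
  refine adj_hom_ext adj fun x => ?_
  have hx : x ∈ Submodule.span Rᵐᵒᵖ S := hS.ge trivial
  induction hx using Submodule.span_induction with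
  | mem x hx => exact h x hx
  | zero =>
    have : adjGen adj (0 : El M) = 0 := by
      have := adjGen_add adj (0 : El M) 0
      rwa [add_zero, left_eq_add] at this
    rw [this, zero_comp, zero_comp]
  | add x y _ _ hx hy => rw [adjGen_add, Preadditive.add_comp, Preadditive.add_comp, hx, hy]
  | smul a x _ hx =>
    obtain ⟨a, rfl⟩ := MulOpposite.op_surjective a
    rw [adjGen_op_smul, Category.assoc, Category.assoc, hx]

end PrLin

namespace AQFT
variable {K : Type w} [Field K] {C : Type u} [Category.{v} C] {P : Orthogonality C}
variable (A : AQFT K P)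

/-! ### The pointings of `ι A` -/

lemma isFreeGenerator_ptGen (c : C) : IsFreeGenerator (A.ptGen c) := by
  intro M x
  refine ⟨Ind.lift (φ := A.act (OrthTuple.star P c)) (M := fun i => i.elim0) (N := asMod M)
    (MultilinearMap.constOfIsEmpty K _ x) (fun i => i.elim0), ?_, ?_⟩
  · exact Ind.lift_tau (φ := A.act (OrthTuple.star P c)) (M := fun i => i.elim0) (N := asMod M)
      (MultilinearMap.constOfIsEmpty K _ x) (fun i => i.elim0) (fun i => i.elim0)
  · intro g hg
    refine A.pt_ext (hg.trans ?_)
    exact (Ind.lift_tau (φ := A.act (OrthTuple.star P c)) (M := fun i => i.elim0) (N := asMod M)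
      (MultilinearMap.constOfIsEmpty K _ x) (fun i => i.elim0) (fun i => i.elim0)).symm

/-- The morphism `A(c) → M` of right modules with `1 ↦ x`. -/
noncomputable abbrev elem {c : C} {M : PrLin.mod K (A.alg c)} (x : El M) : A.ptMod c ⟶ M :=
  (A.isFreeGenerator_ptGen c).hom x

lemma ev_elem {c : C} {M : PrLin.mod K (A.alg c)} (x : El M) : ev (A.elem x) (A.ptGen c) = x :=
  (A.isFreeGenerator_ptGen c).ev_hom x

lemma span_singleton_ptGen (c : C) :
    Submodule.span (A.alg c)ᵐᵒᵖ {A.ptGen c} = ⊤ := by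
  refine top_le_iff.mp fun x _ => ?_
  obtain ⟨a, rfl⟩ := A.span_ptGen c x
  exact Submodule.smul_mem _ _ (Submodule.mem_span_singleton_self _)

lemma ext_pt {n : ℕ} {c : Fin n → C} {t : C} {f : OrthTuple P c t} {N : PrLin.mod K (A.alg t)}
    {F G : (A.op f).obj (fun i => A.ptMod (c i)) ⟶ N}
    (h : ev F (A.gen f _ (fun i => A.ptGen (c i))) = ev G (A.gen f _ (fun i => A.ptGen (c i)))) :
    F = G := by
  refine Ind.hom_ext' (fun i => {A.ptGen (c i)}) (fun i => A.span_singleton_ptGen (c i)) ?_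
  intro m hm
  obtain rfl : m = fun i => A.ptGen (c i) := funext hm
  exact h

/-- The coherence isomorphism between the factorization product of the free modules of rank one
and the free module of rank one. -/
noncomputable def ptIso {n : ℕ} {c : Fin n → C} {t : C} (f : OrthTuple P c t) :
    (A.op f).obj (fun i => A.ptMod (c i)) ≅ A.ptMod t :=
  A.incl.theta f

lemma ev_ptIso {n : ℕ} {c : Fin n → C} {t : C} (f : OrthTuple P c t) :
    ev (A.ptIso f).hom (A.gen f _ (fun i => A.ptGen (c i))) = A.ptGen t :=
  A.ev_theta f

/-- Factorization products of the morphisms `A(c i) → X i`, `1 ↦ x i`, are again of this form, up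
to the identification of the factorization product of free modules with a free module. -/
lemma ptIso_elem {n : ℕ} {c : Fin n → C} {t : C} (f : OrthTuple P c t)
    {X : ∀ i, PrLin.mod K (A.alg (c i))} (x : ∀ i, El (X i)) :
    (A.ptIso f).hom ≫ A.elem (A.gen f X x) = (A.op f).mapFam (fun i => A.elem (x i)) := by
  refine A.ext_pt ?_
  refine (ev_comp₂ (A.ev_ptIso f) (A.ev_elem _)).trans ?_
  rw [ev_mapFam]
  exact congrArg (A.gen f X) (funext fun i => (A.ev_elem (x i)).symm)

lemma elem_op_smul {c : C} (a : A.alg c) : A.elem (MulOpposite.op a • A.ptGen c) = A.unitApp c a :=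
  A.pt_ext ((A.ev_elem _).trans (A.ev_unitApp c a).symm)

variable {A} {B : TwoAQFT K P}

/-! ### 1-morphisms out of `ι A` -/

section

variable (ζ κ : A.incl ⟶ B)

/-- The components of a 1-morphism, as functors on right modules. -/
abbrev appIncl (c : C) : LinFunctor (PrLin.mod K (A.alg c)) (B.cat c) := TwoAQFT.Hom.app ζ c

/-- The comparison of pointings, with values in the image of the free module of rank one. -/
noncomputable def ptCompare (c : C) : B.pt c ≅ (appIncl ζ c).obj (A.ptMod c) :=
  TwoAQFT.starIso ζ c

/-- The coherence isomorphisms of a 1-morphism, with the factorization products of `ι A` spelled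
out as relative tensor products. -/
noncomputable def opCompare {n : ℕ} {c : Fin n → C} {t : C} (f : OrthTuple P c t)
    (X : ∀ i, PrLin.mod K (A.alg (c i))) :
    (B.op f).obj (fun i => (appIncl ζ (c i)).obj (X i)) ≅ (appIncl ζ t).obj ((A.op f).obj X) :=
  TwoAQFT.Hom.natIso ζ f X

lemma opCompare_naturality {n : ℕ} {c : Fin n → C} {t : C} (f : OrthTuple P c t)
    {X Y : ∀ i, PrLin.mod K (A.alg (c i))} (h : ∀ i, X i ⟶ Y i) :
    (B.op f).mapFam (fun i => (appIncl ζ (c i)).map (h i)) ≫ (opCompare ζ f Y).hom =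
      (opCompare ζ f X).hom ≫ (appIncl ζ t).map ((A.op f).mapFam h) :=
  TwoAQFT.Hom.naturality ζ f h

lemma theta_ptCompare {n : ℕ} {c : Fin n → C} {t : C} (f : OrthTuple P c t) :
    (B.theta f).hom ≫ (ptCompare ζ t).hom =
      (B.op f).mapFam (fun i => (ptCompare ζ (c i)).hom) ≫
        (opCompare ζ f (fun i => A.ptMod (c i))).hom ≫ (appIncl ζ t).map (A.ptIso f).hom :=
  TwoAQFT.theta_natural ζ f

/-- The component at `c` of the morphism `π(ζ) ∘ η_A` of AQFTs which belongs to a 1-morphism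
`ζ : ι A ⟶ B`. -/
noncomputable def mate (c : C) : A.alg c →ₐ[K] End (B.pt c) :=
  (TwoAQFT.truncHomApp ζ c).comp (A.unitApp c)

lemma mate_apply (c : C) (a : A.alg c) :
    mate ζ c a = (ptCompare ζ c).hom ≫
      (appIncl ζ c).map (A.elem (MulOpposite.op a • A.ptGen c)) ≫ (ptCompare ζ c).inv := by
  rw [elem_op_smul]
  rfl

/-- For an element `x` of `M`, the morphism from the pointing to the value of a 1-morphism at `M`
which is induced by `A(c) → M`, `1 ↦ x`.  These morphisms generate the value at `M`. -/
noncomputable def homGen {c : C} {M : PrLin.mod K (A.alg c)} (x : El M) :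
    B.pt c ⟶ (appIncl ζ c).obj M :=
  (ptCompare ζ c).hom ≫ (appIncl ζ c).map (A.elem x)

/-- The component at `c` of a 1-morphism `ζ : ι A ⟶ B` is left adjoint to `Hom(b_c, -)`, where
`A(c)` acts through `mate ζ c`. -/
lemma exists_adj_mate (c : C) : ∃ adj : (appIncl ζ c).toFunctor ⊣ homFunctor (mate ζ c),
    ∀ {M : PrLin.mod K (A.alg c)} (x : El M), adjGen adj x = homGen ζ x :=
  exists_adj (appIncl ζ c) (A.isFreeGenerator_ptGen c) (ptCompare ζ c) fun a => by
    rw [mate_apply]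
    simp only [Category.assoc, Iso.inv_hom_id, Category.comp_id]

/-- The coherence isomorphisms of a 1-morphism are determined on generators: they send the
factorization product of the generators `x i` to the generator `x 1 ⊗ ⋯ ⊗ x n`. -/
lemma mapFam_homGen {n : ℕ} {c : Fin n → C} {t : C} (f : OrthTuple P c t)
    {X : ∀ i, PrLin.mod K (A.alg (c i))} (x : ∀ i, El (X i)) :
    (B.op f).mapFam (fun i => homGen ζ (x i)) ≫ (opCompare ζ f X).hom =
      (B.theta f).hom ≫ homGen ζ (A.gen f X x) := by
  have h3 := (B.op f).mapFam_comp (fun i => (ptCompare ζ (c i)).hom)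
    (fun i => (appIncl ζ (c i)).map (A.elem (x i)))
  unfold homGen
  rw [h3, Category.assoc, opCompare_naturality, ← ptIso_elem, reassoc_of% theta_ptCompare,
    Functor.map_comp]

lemma homGen_ext {c : C} {M : PrLin.mod K (A.alg c)} {Y : B.cat c}
    {g g' : (appIncl ζ c).obj M ⟶ Y} (h : ∀ x : El M, homGen ζ x ≫ g = homGen ζ x ≫ g') :
    g = g' := by
  obtain ⟨adj, hadj⟩ := exists_adj_mate ζ c
  refine adj_hom_ext adj fun x => ?_
  rw [hadj, h]

/-- Morphisms out of a factorization product of values of a 1-morphism are determined on the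
factorization products of generators. -/
lemma mapFam_homGen_ext {n : ℕ} {c : Fin n → C} {t : C} (f : OrthTuple P c t)
    {X : ∀ i, PrLin.mod K (A.alg (c i))} {Y : B.cat t}
    {g g' : (B.op f).obj (fun i => (appIncl ζ (c i)).obj (X i)) ⟶ Y}
    (h : ∀ x : ∀ i, El (X i), (B.op f).mapFam (fun i => homGen ζ (x i)) ≫ g =
      (B.op f).mapFam (fun i => homGen ζ (x i)) ≫ g') : g = g' := by
  obtain ⟨adj, hadj⟩ := exists_adj_mate ζ t
  rw [← cancel_epi (opCompare ζ f X).inv]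
  refine adj_hom_ext_span adj _ (A.span_gen f X) ?_
  rintro _ ⟨x, rfl⟩
  have h1 : adjGen adj (A.gen f X x) = (B.theta f).inv ≫
      (B.op f).mapFam (fun i => homGen ζ (x i)) ≫ (opCompare ζ f X).hom := by
    rw [hadj, mapFam_homGen, Iso.inv_hom_id_assoc]
  rw [h1]
  simp only [Category.assoc, Iso.hom_inv_id_assoc]
  rw [h]

variable {ζ κ}

/-- The components of a 2-morphism, as transformations of functors on right modules. -/
abbrev appHom (Γ : ζ ⟶ κ) (c : C) : (appIncl ζ c).toFunctor ⟶ (appIncl κ c).toFunctor :=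
  TwoAQFT.Hom₂.app Γ c

lemma ptCompare_appHom (Γ : ζ ⟶ κ) (c : C) :
    (ptCompare κ c).hom = (ptCompare ζ c).hom ≫ (appHom Γ c).app (A.ptMod c) :=
  TwoAQFT.starIso_hom₂ Γ c

lemma homGen_appHom (Γ : ζ ⟶ κ) {c : C} {M : PrLin.mod K (A.alg c)} (x : El M) :
    homGen ζ x ≫ (appHom Γ c).app M = homGen κ x := by
  unfold homGen
  rw [ptCompare_appHom Γ, Category.assoc, Category.assoc, NatTrans.naturality]

/-- Parallel 2-morphisms between 1-morphisms out of `ι A` are equal: they preserve the pointings,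
hence the generators. -/
lemma hom₂_eq (Γ Γ' : ζ ⟶ κ) : Γ = Γ' := TwoAQFT.hom₂_ext fun _ _ => homGen_ext ζ fun x =>
  (homGen_appHom Γ x).trans (homGen_appHom Γ' x).symm

/-- Components with the same mate are isomorphic, compatibly with the generators, because they are
left adjoint to the same functor. -/
lemma exists_iso_app {c : C} (h : mate ζ c = mate κ c) :
    ∃ e : (appIncl ζ c).toFunctor ≅ (appIncl κ c).toFunctor,
      ∀ (M : PrLin.mod K (A.alg c)) (x : El M), homGen ζ x ≫ e.hom.app M = homGen κ x := by
  obtain ⟨adj, hadj⟩ := exists_adj_mate ζ c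
  obtain ⟨adj', hadj'⟩ := exists_adj_mate κ c
  revert adj hadj
  rw [h]
  intro adj hadj
  refine ⟨adj.leftAdjointUniq adj', fun M x => ?_⟩
  rw [← hadj, ← hadj']
  have := Adjunction.unit_leftAdjointUniq_hom_app adj adj' M
  exact congrArg (fun k => homEl _ (ev k x)) this

/-- 1-morphisms out of `ι A` with the same mates are isomorphic.  The isomorphisms of components
are coherent since this can be checked on generators. -/
lemma exists_iso (h : ∀ c, mate ζ c = mate κ c) : Nonempty (ζ ≅ κ) := by
  choose e he using fun c => exists_iso_app (h c)
  have key : ∀ {n : ℕ} {c : Fin n → C} {t : C} (f : OrthTuple P c t)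
      (X : ∀ i, PrLin.mod K (A.alg (c i))),
      (B.op f).mapFam (fun i => (e (c i)).hom.app (X i)) ≫ (opCompare κ f X).hom =
        (opCompare ζ f X).hom ≫ (e t).hom.app ((A.op f).obj X) := by
    intro n c t f X
    refine mapFam_homGen_ext ζ f fun x => ?_
    have h1 := (B.op f).mapFam_comp (fun i => homGen ζ (x i)) (fun i => (e (c i)).hom.app (X i))
    simp only [he] at h1
    rw [← Category.assoc, ← h1, mapFam_homGen, reassoc_of% mapFam_homGen ζ f x, he]
  exact ⟨TwoAQFT.isoMk (ζ := ζ) (κ := κ) e key⟩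

end

end AQFT

/-! ### Transformations of multilinear functors on right modules -/

namespace PrLin
variable {K : Type w} [Field K] {n : ℕ} {D D' : Fin n → PrLin K} {T : PrLin K}

lemma insertVar_comp_pi (F : ∀ i, D i ⥤ D' i) (X : ∀ i, D i) (i : Fin n) :
    insertVar X i ⋙ Functor.pi F = F i ⋙ insertVar (fun j => (F j).obj (X j)) i := by
  refine Functor.pi_ext _ _ fun j => ?_
  change (insertVar X i ⋙ Pi.eval _ j) ⋙ F j = F i ⋙ insertVar _ i ⋙ Pi.eval _ j
  by_cases h : i = j
  · subst h
    rw [insertVar_eval_self, insertVar_eval_self]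
    rfl
  · rw [insertVar_eval_ne _ _ _ h, insertVar_eval_ne _ _ _ h]
    refine CategoryTheory.Functor.ext (fun _ => rfl) fun _ _ _ => ?_
    simp

lemma insertVar_obj_ne (X : ∀ j, D j) (i j : Fin n) (h : i ≠ j) (M : D i) :
    (insertVar X i).obj M j = X j :=
  Functor.congr_obj (insertVar_eval_ne X i j h) M

lemma insertVar_obj_same (X : ∀ j, D j) (i : Fin n) (M : D i) :
    (insertVar X i).obj M i = M :=
  Functor.congr_obj (insertVar_eval_self X i) M

lemma insertVar_obj_self (X : ∀ j, D j) (i : Fin n) : (insertVar X i).obj (X i) = X := by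
  funext j
  by_cases h : i = j
  · subst h
    exact insertVar_obj_same X i _
  · exact insertVar_obj_ne X i j h _

namespace MultFunctor

lemma isIso_mapFam (F : MultFunctor D T) {X Y : ∀ i, D i} (h : ∀ i, X i ⟶ Y i)
    [∀ i, IsIso (h i)] : IsIso (F.mapFam h) :=
  ⟨F.mapFam (fun i => CategoryTheory.inv (h i)), by simp [← mapFam_comp], by simp [← mapFam_comp]⟩

lemma mapFam_update_add (F : MultFunctor D T) {X Y : ∀ i, D i} (h : ∀ i, X i ⟶ Y i) (i : Fin n)
    (g g' : X i ⟶ Y i) : F.mapFam (Function.update h i (g + g')) =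
      F.mapFam (Function.update h i g) + F.mapFam (Function.update h i g') :=
  F.map_add h i g g'

lemma mapFam_update_smul (F : MultFunctor D T) {X Y : ∀ i, D i} (h : ∀ i, X i ⟶ Y i) (i : Fin n)
    (r : K) (g : X i ⟶ Y i) : F.mapFam (Function.update h i (r • g)) =
      r • F.mapFam (Function.update h i g) :=
  F.map_smul h i r g

end MultFunctor

/-- A transformation between functors of several right modules which are co-continuous in each
variable is invertible as soon as its component at one tuple of free modules of rank one is.  The
free modules are replaced by arbitrary ones, one variable at a time. -/
lemma isIso_app_of_isFreeGenerator {R : Fin n → Type w} [∀ i, Ring (R i)] [∀ i, Algebra K (R i)]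
    {U : ∀ i, PrLin.mod K (R i)} {u : ∀ i, El (U i)} (hu : ∀ i, IsFreeGenerator (u i))
    {E : Type*} [Category E] {F G : (∀ i, PrLin.mod K (R i)) ⥤ E}
    (hF : ∀ X i, PreservesColimitsOfSize.{w, w} (insertVar X i ⋙ F))
    (hG : ∀ X i, PreservesColimitsOfSize.{w, w} (insertVar X i ⋙ G)) (α : F ⟶ G)
    (hU : IsIso (α.app U)) (X : ∀ i, PrLin.mod K (R i)) : IsIso (α.app X) := by
  have key : ∀ s : Finset (Fin n), ∀ X : ∀ i, PrLin.mod K (R i), (∀ i, i ∉ s → X i = U i) →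
      IsIso (α.app X) := by
    intro s
    induction s using Finset.induction_on with
    | empty =>
      intro X hX
      obtain rfl : X = U := funext fun i => hX i (Finset.notMem_empty i)
      exact hU
    | insert i s hi ih =>
      intro X hX
      have := hF X i
      have := hG X i
      have h := (hu i).isIso_app (Functor.whiskerLeft (insertVar X i) α) (ih _ fun j hj => by
        by_cases hij : i = j
        · subst hij
          exact insertVar_obj_same X i _
        · rw [insertVar_obj_ne X i j hij]
          exact hX j (by simp [hj, Ne.symm hij])) (X i)
      have e := insertVar_obj_self X i
      change IsIso (α.app ((insertVar X i).obj (X i))) at h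
      rwa [e] at h
  exact key Finset.univ X (by simp)

end PrLin

/-! ### The pointing as the value of an empty factorization product -/

namespace TwoAQFT
variable {K : Type w} [Field K] {C : Type u} [Category.{v} C] {P : Orthogonality C}
variable (B : TwoAQFT K P)

lemma theta_star_aux {D : Type*} [Category D] {w x z p : D} {e : w = x} (e₁ : z = p) (e₂ : p = x)
    {c : w ⟶ z} {θ : x ≅ p} (h : c ≫ eqToHom e₁ = eqToHom e ≫ θ.hom)
    (h' : c ≫ eqToHom e₁ ≫ eqToHom e₂ ≫ θ.hom = eqToHom e ≫ θ.hom) :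
    θ.hom = eqToHom e₂.symm := by
  subst e e₁ e₂
  simp only [eqToHom_refl, Category.comp_id, Category.id_comp] at h h' ⊢
  subst h
  exact (cancel_epi θ.hom).mp ((by simpa using h' : θ.hom ≫ θ.hom = θ.hom).trans
    (Category.comp_id _).symm)

/-- For the empty tuple, the coherence isomorphism between the factorization product of the
pointings and the pointing is the identification of two empty tuples of objects. -/
lemma theta_star (t : C) :
    (B.theta (OrthTuple.star P t)).hom = eqToHom (B.op_empty rfl (OrthTuple.star P t) _) := by
  -- `theta` of any empty tuple is `theta` of the standard one: `star.comp g` is a tuple of length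
  -- `∑ i : Fin 0, _`, which is zero only propositionally.
  have h1 : ∀ {n : ℕ} (hn : n = 0) {c : Fin n → C} (F : OrthTuple P c t),
      (B.theta F).hom = eqToHom (B.op_empty hn F _) ≫
        eqToHom (B.op_empty rfl (OrthTuple.star P t) (fun i => B.pt _)).symm ≫
          (B.theta (OrthTuple.star P t)).hom := by
    intro n hn c F
    subst hn
    obtain rfl : c = fun i => i.elim0 := Subsingleton.elim _ _
    obtain rfl : F = OrthTuple.star P t := by ext i; exact i.elim0
    simp
  -- Composing the empty tuple with the empty family of tuples gives `θ ∘ θ = θ` up to such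
  -- identifications, and `θ` is invertible.
  let b : ∀ i : Fin 0, Fin i.elim0 → C := fun i => i.elim0
  let g : ∀ i : Fin 0, OrthTuple P (b i) i.elim0 := fun i => i.elim0
  have h2 := B.theta_comp (OrthTuple.star P t) g
  have h3 := B.compIso_empty (fun i => i.elim0) (OrthTuple.star P t) g
    (fun i j => B.pt (b i j))
  rw [h1 (by simp) ((OrthTuple.star P t).comp g)] at h2
  exact theta_star_aux _ _ (h3.trans (congrArg (· ≫ (B.theta (OrthTuple.star P t)).hom)
    (B.mapFam_empty rfl (OrthTuple.star P t) _))) (h2.trans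
      (congrArg (· ≫ (B.theta (OrthTuple.star P t)).hom)
    (B.mapFam_empty rfl (OrthTuple.star P t) _)))

end TwoAQFT

namespace AQFT
variable {K : Type w} [Field K] {C : Type u} [Category.{v} C] {P : Orthogonality C}
variable {A : AQFT K P} {B : TwoAQFT K P}

/-! ### Extension of a morphism `A ⟶ π B` to a 1-morphism `ι A ⟶ B` -/

section
variable (φ : A ⟶ B.trunc)

/-- The components `A(c) → End(b_c)` of a morphism `A ⟶ π B`. -/
noncomputable def truncComp (c : C) : A.alg c →ₐ[K] End (B.pt c) := comp φ c

/-- Naturality of `φ` at the `i`-th morphism of a tuple: the structure map of `π B` applies the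
factorization product of that single morphism. -/
lemma truncComp_act {I : Type} {c : I → C} {t : C} (f : OrthTuple P c t) (i : I) (a : A.alg (c i)) :
    truncComp φ t (A.act f i a) =
      B.truncMap (OrthTuple.single P (f.hom i)) (fun _ => truncComp φ (c i) a) :=
  DFunLike.congr_fun (comp_naturality φ f i) a

/-- The functor `(-) ⊗_{A(c)} b_c` from right `A(c)`-modules to `B(c)`. -/
noncomputable abbrev extFunctor (c : C) : LinFunctor (PrLin.mod K (A.alg c)) (B.cat c) :=
  tensorFunctor (truncComp φ c)

/-- The morphism `x ⊗ -` from `b_c` to `M ⊗_{A(c)} b_c`. -/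
noncomputable abbrev extGen {c : C} {M : PrLin.mod K (A.alg c)} (x : El M) :
    B.pt c ⟶ (extFunctor φ c).obj M :=
  adjGen (tensorAdj (truncComp φ c)) x

lemma extGen_add {c : C} {M : PrLin.mod K (A.alg c)} (x y : El M) :
    extGen φ (x + y) = extGen φ x + extGen φ y := adjGen_add _ _ _

lemma extGen_smul {c : C} {M : PrLin.mod K (A.alg c)} (r : K) (x : El M) :
    extGen φ (r • x) = r • extGen φ x := adjGen_smul _ _ _

lemma extGen_op_smul {c : C} {M : PrLin.mod K (A.alg c)} (a : A.alg c) (x : El M) :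
    extGen φ (MulOpposite.op a • x) = truncComp φ c a ≫ extGen φ x := adjGen_op_smul _ _ _

lemma extGen_map {c : C} {M N : PrLin.mod K (A.alg c)} (g : M ⟶ N) (x : El M) :
    extGen φ x ≫ (extFunctor φ c).map g = extGen φ (ev g x) := adjGen_map _ _ _

lemma extGen_update {n : ℕ} {c : Fin n → C}
    {X : ∀ i, PrLin.mod K (A.alg (c i))} (x : ∀ i, El (X i)) (i : Fin n) (y : El (X i)) :
    (fun j => extGen φ (Function.update x i y j)) =
      Function.update (fun j => extGen φ (x j)) i (extGen φ y) := by
  funext j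
  by_cases hj : j = i
  · subst hj
    simp
  · simp [Function.update_of_ne hj]

/-- The multilinear map which sends `(x i)` to the factorization product of the morphisms `x i ⊗ -`,
as a morphism out of `b_t`. -/
noncomputable def extMultilinear {n : ℕ} {c : Fin n → C} {t : C} (f : OrthTuple P c t)
    (X : ∀ i, PrLin.mod K (A.alg (c i))) :
    MultilinearMap K (fun i => El (X i)) (El ((homFunctor (truncComp φ t)).obj
      ((B.op f).obj (fun i => (extFunctor φ (c i)).obj (X i))))) where
  toFun x := (homEl (truncComp φ t)).symm
    ((B.theta f).inv ≫ (B.op f).mapFam (fun i => extGen φ (x i)))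
  map_update_add' := by
    intro inst x i y z
    obtain rfl : inst = instDecidableEqFin n := Subsingleton.elim _ _
    rw [← map_add]
    refine congrArg (homEl (truncComp φ t)).symm ?_
    rw [← Preadditive.comp_add]
    refine congrArg (_ ≫ ·) ?_
    simp only [extGen_update]
    rw [extGen_add, MultFunctor.mapFam_update_add]
  map_update_smul' := by
    intro inst x i r y
    obtain rfl : inst = instDecidableEqFin n := Subsingleton.elim _ _
    apply (homEl (truncComp φ t)).injective
    rw [homEl_smul, AddEquiv.apply_symm_apply, AddEquiv.apply_symm_apply, ← Linear.comp_smul]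
    refine congrArg (_ ≫ ·) ?_
    simp only [extGen_update]
    rw [extGen_smul, MultFunctor.mapFam_update_smul]

lemma homEl_extMultilinear {n : ℕ} {c : Fin n → C} {t : C} (f : OrthTuple P c t)
    (X : ∀ i, PrLin.mod K (A.alg (c i))) (x : ∀ i, El (X i)) :
    homEl (truncComp φ t) (extMultilinear φ f X x) =
      (B.theta f).inv ≫ (B.op f).mapFam (fun i => extGen φ (x i)) := rfl

/-- Acting with `A(c i)` on `x i` is the same as acting with its image in `A(t)` on the whole
factorization product. -/
lemma isBalanced_extMultilinear {n : ℕ} {c : Fin n → C} {t : C} (f : OrthTuple P c t)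
    (X : ∀ i, PrLin.mod K (A.alg (c i))) :
    IsBalanced (A.act f) (fun i => asMod (X i)) (N := asMod ((homFunctor (truncComp φ t)).obj
      ((B.op f).obj (fun i => (extFunctor φ (c i)).obj (X i))))) (extMultilinear φ f X) := by
  intro i a m m' h h'
  apply (homEl (truncComp φ t)).injective
  refine Eq.trans ?_ (homEl_op_smul (truncComp φ t) _ _).symm
  rw [homEl_extMultilinear, homEl_extMultilinear]
  -- The action of `a` as an endomorphism of the tuple of pointings, trivial away from slot `i`.
  let e : ∀ j, End (B.pt (c j)) := Function.update (fun j => 1) i (truncComp φ (c i) a)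
  have h1 : truncComp φ t (A.act f i a) = B.truncMap f e := by
    rw [B.truncMap_slot f i e (fun j hj => by simp [e, Function.update_of_ne hj])]
    simp only [e, Function.update_self]
    exact truncComp_act φ f i a
  have h2 : (fun j => extGen φ (m' j)) = fun j => e j ≫ extGen φ (m j) := by
    funext j
    by_cases hj : j = i
    · subst hj
      simp only [e, Function.update_self, h]
      exact extGen_op_smul _ _ _
    · simp only [e, Function.update_of_ne hj, h' j hj]
      exact (Category.id_comp _).symm
  rw [h1, h2, MultFunctor.mapFam_comp]
  simp [TwoAQFT.truncMap]

/-- The canonical morphism from the extension functor applied to the relative tensor product of the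
`X i` to the factorization product of their images, which sends the generator `x 1 ⊗ ⋯ ⊗ x n` to the
factorization product of the generators `x i`. -/
noncomputable def extOpHom {n : ℕ} {c : Fin n → C} {t : C} (f : OrthTuple P c t)
    (X : ∀ i, PrLin.mod K (A.alg (c i))) : (extFunctor φ t).obj ((A.op f).obj X) ⟶
      (B.op f).obj (fun i => (extFunctor φ (c i)).obj (X i)) :=
  ((tensorAdj (truncComp φ t)).homEquiv _ _).symm
    (Ind.lift (extMultilinear φ f X) (isBalanced_extMultilinear φ f X))

lemma extGen_extOpHom {n : ℕ} {c : Fin n → C} {t : C} (f : OrthTuple P c t)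
    {X : ∀ i, PrLin.mod K (A.alg (c i))} (x : ∀ i, El (X i)) :
    extGen φ (A.gen f X x) ≫ extOpHom φ f X =
      (B.theta f).inv ≫ (B.op f).mapFam (fun i => extGen φ (x i)) :=
  (adjGen_desc (tensorAdj (truncComp φ t)) _ _).trans
    (congrArg (homEl (truncComp φ t)) (Ind.lift_tau (extMultilinear φ f X)
      (isBalanced_extMultilinear φ f X) x))

/-- Morphisms out of the source of `extOpHom` are determined on pure tensors. -/
lemma extOp_ext {n : ℕ} {c : Fin n → C} {t : C} (f : OrthTuple P c t)
    {X : ∀ i, PrLin.mod K (A.alg (c i))} {Y : B.cat t}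
    {g g' : (extFunctor φ t).obj ((A.op f).obj X) ⟶ Y}
    (h : ∀ x, extGen φ (A.gen f X x) ≫ g = extGen φ (A.gen f X x) ≫ g') : g = g' := by
  refine adj_hom_ext_span (tensorAdj (truncComp φ t)) _ (A.span_gen f X) ?_
  rintro _ ⟨x, rfl⟩
  exact h x

lemma extOpHom_naturality {n : ℕ} {c : Fin n → C} {t : C} (f : OrthTuple P c t)
    {X Y : ∀ i, PrLin.mod K (A.alg (c i))} (h : ∀ i, X i ⟶ Y i) :
    (extFunctor φ t).map ((A.op f).mapFam h) ≫ extOpHom φ f Y =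
      extOpHom φ f X ≫ (B.op f).mapFam (fun i => (extFunctor φ (c i)).map (h i)) := by
  refine extOp_ext φ f fun x => ?_
  rw [← Category.assoc, extGen_map, ev_mapFam, extGen_extOpHom, ← Category.assoc, extGen_extOpHom,
    Category.assoc, ← MultFunctor.mapFam_comp]
  simp only [extGen_map]

instance isIso_extGen_ptGen (c : C) : IsIso (extGen φ (A.ptGen c)) :=
  isIso_adjGen _ (A.isFreeGenerator_ptGen c)

/-- At the free modules of rank one, `extOpHom` is the coherence isomorphism of the pointings of
`B`, up to the isomorphisms between these pointings and the values at the free modules. -/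
lemma isIso_extOpHom_pt {n : ℕ} {c : Fin n → C} {t : C} (f : OrthTuple P c t) :
    IsIso (extOpHom φ f (fun i => A.ptMod (c i))) := by
  have h1 : extGen φ (A.gen f _ (fun i => A.ptGen (c i))) =
      extGen φ (A.ptGen t) ≫ (extFunctor φ t).map (A.ptIso f).inv := by
    rw [extGen_map, ev_inv (A.ptIso f) (A.ev_ptIso f)]
  have h2 : IsIso (extGen φ (A.gen f _ (fun i => A.ptGen (c i)))) := by
    rw [h1]
    infer_instance
  have h3 := (B.op f).isIso_mapFam (fun i => extGen φ (A.ptGen (c i)))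
  have h4 : IsIso (extGen φ (A.gen f _ (fun i => A.ptGen (c i))) ≫ extOpHom φ f _) := by
    rw [extGen_extOpHom]
    infer_instance
  exact IsIso.of_isIso_comp_left (extGen φ (A.gen f _ (fun i => A.ptGen (c i)))) _

/-- Both sides are co-continuous in each `X i`, so the free modules suffice. -/
instance isIso_extOpHom {n : ℕ} {c : Fin n → C} {t : C} (f : OrthTuple P c t)
    (X : ∀ i, PrLin.mod K (A.alg (c i))) : IsIso (extOpHom φ f X) := by
  let α : (A.op f).toFunctor ⋙ (extFunctor φ t).toFunctor ⟶
      Functor.pi (fun i => (extFunctor φ (c i)).toFunctor) ⋙ (B.op f).toFunctor :=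
    { app := fun X => extOpHom φ f X
      naturality := fun X Y h => extOpHom_naturality φ f h }
  refine isIso_app_of_isFreeGenerator (fun i => A.isFreeGenerator_ptGen (c i)) (fun X i => ?_)
    (fun X i => ?_) α (isIso_extOpHom_pt φ f) X
  · have := (A.op f).cocontinuous X i
    have := (extFunctor φ t).cocontinuous
    exact inferInstanceAs (PreservesColimitsOfSize.{w, w}
      ((insertVar X i ⋙ (A.op f).toFunctor) ⋙ (extFunctor φ t).toFunctor))
  · change PreservesColimitsOfSize.{w, w}
      ((insertVar X i ⋙ Functor.pi (fun i => (extFunctor φ (c i)).toFunctor)) ⋙ (B.op f).toFunctor)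
    have h := insertVar_comp_pi (D' := fun i => B.cat (c i))
      (fun i => (extFunctor φ (c i)).toFunctor) X i
    have := (B.op f).cocontinuous (fun j => (extFunctor φ (c j)).obj (X j)) i
    have := (extFunctor φ (c i)).cocontinuous
    rw [h]
    exact inferInstanceAs (PreservesColimitsOfSize.{w, w}
      ((extFunctor φ (c i)).toFunctor ⋙
        (insertVar (fun j => (extFunctor φ (c j)).obj (X j)) i ⋙ (B.op f).toFunctor)))

/-- The coherence isomorphisms of the 1-morphism `ι A ⟶ B` with components `(-) ⊗_{A(c)} b_c`. -/
noncomputable def extOpIso {n : ℕ} {c : Fin n → C} {t : C} (f : OrthTuple P c t)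
    (X : ∀ i, PrLin.mod K (A.alg (c i))) :
    (B.op f).obj (fun i => (extFunctor φ (c i)).obj (X i)) ≅
      (extFunctor φ t).obj ((A.op f).obj X) :=
  (asIso (extOpHom φ f X)).symm

lemma mapFam_extGen {n : ℕ} {c : Fin n → C} {t : C} (f : OrthTuple P c t)
    {X : ∀ i, PrLin.mod K (A.alg (c i))} (x : ∀ i, El (X i)) :
    (B.op f).mapFam (fun i => extGen φ (x i)) ≫ (extOpIso φ f X).hom =
      (B.theta f).hom ≫ extGen φ (A.gen f X x) := by
  rw [← Iso.inv_comp_eq, ← Category.assoc, ← extGen_extOpHom]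
  simp [extOpIso]

lemma mapFam_extGen_ext {n : ℕ} {c : Fin n → C} {t : C} (f : OrthTuple P c t)
    {X : ∀ i, PrLin.mod K (A.alg (c i))} {Y : B.cat t}
    {g g' : (B.op f).obj (fun i => (extFunctor φ (c i)).obj (X i)) ⟶ Y}
    (h : ∀ x : ∀ i, El (X i), (B.op f).mapFam (fun i => extGen φ (x i)) ≫ g =
      (B.op f).mapFam (fun i => extGen φ (x i)) ≫ g') : g = g' := by
  rw [← cancel_epi (extOpHom φ f X)]
  refine extOp_ext φ f fun x => ?_
  rw [← Category.assoc, ← Category.assoc, extGen_extOpHom, Category.assoc, Category.assoc, h]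

lemma extOpIso_naturality {n : ℕ} {c : Fin n → C} {t : C} (f : OrthTuple P c t)
    {X Y : ∀ i, PrLin.mod K (A.alg (c i))} (h : ∀ i, X i ⟶ Y i) :
    (B.op f).mapFam (fun i => (extFunctor φ (c i)).map (h i)) ≫ (extOpIso φ f Y).hom =
      (extOpIso φ f X).hom ≫ (extFunctor φ t).map ((A.op f).mapFam h) := by
  rw [← Iso.inv_comp_eq, ← Category.assoc, ← Iso.eq_comp_inv]
  exact (extOpHom_naturality φ f h).symm

/-- Morphisms out of an iterated factorization product are determined on iterated factorization
products of generators. -/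
lemma mapFam_mapFam_extGen_ext {n : ℕ} {k : Fin n → ℕ} {a : Fin n → C} {b : ∀ i, Fin (k i) → C}
    {t : C} (f : OrthTuple P a t) (g : ∀ i, OrthTuple P (b i) (a i))
    {X : ∀ i j, PrLin.mod K (A.alg (b i j))} {Y : B.cat t}
    {h h' : (B.op f).obj (fun i => (B.op (g i)).obj
      (fun j => (extFunctor φ (b i j)).obj (X i j))) ⟶ Y}
    (H : ∀ x : ∀ i j, El (X i j),
      (B.op f).mapFam (fun i => (B.op (g i)).mapFam (fun j => extGen φ (x i j))) ≫ h =
      (B.op f).mapFam (fun i => (B.op (g i)).mapFam (fun j => extGen φ (x i j))) ≫ h') :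
    h = h' := by
  rw [← cancel_epi (B.compIso f g _).inv]
  refine mapFam_extGen_ext φ (f.comp g) (X := fun p => X (seq k p).1 (seq k p).2) fun x => ?_
  -- A tuple indexed by the concatenation comes from a family of tuples.
  obtain ⟨y, rfl⟩ : ∃ y : ∀ i j, El (X i j), (fun p => y (seq k p).1 (seq k p).2) = x :=
    ⟨fun i j => (seq k).piCongrLeft (fun s : (Σ i, Fin (k i)) => El (X s.1 s.2)) x ⟨i, j⟩, by
      funext p
      exact Equiv.piCongrLeft_apply_apply (fun s : (Σ i, Fin (k i)) => El (X s.1 s.2)) (seq k) x p⟩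
  have h1 := B.comp_naturality f g (fun i j => extGen φ (y i j))
  rw [← Iso.inv_comp_eq, ← Category.assoc, ← Iso.eq_comp_inv] at h1
  rw [← Category.assoc, ← Category.assoc, ← h1, Category.assoc, Category.assoc, H]

/-- The diagram chase behind the compatibility of `extOpIso` with composition and permutations:
both sides of the equation send a generator to the same generator `r`, up to the coherences `θ`. -/
lemma comp_chase {D : Type*} [Category D] {x₀ x₁ x₂ x₃ y₁ y₂ y₃ z : D} {p : x₀ ⟶ x₁}
    {c : x₁ ⟶ x₂} {e : x₂ ⟶ x₃} {θ₁ : x₀ ⟶ y₁} {q : y₁ ⟶ x₂} {θ₂ : y₁ ⟶ z} {r : z ⟶ x₃}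
    {T : x₀ ⟶ y₂} {θ₃ : y₂ ⟶ z} {m : x₁ ⟶ y₃} {s : y₂ ⟶ y₃} {w : D} {N : y₃ ⟶ w} {s' : z ⟶ w}
    {G : w ⟶ x₃} (h1 : p ≫ c = θ₁ ≫ q) (h2 : q ≫ e = θ₂ ≫ r) (ht : θ₁ ≫ θ₂ = T ≫ θ₃)
    (h5 : p ≫ m = T ≫ s) (h3 : s ≫ N = θ₃ ≫ s') (h4 : s' ≫ G = r) :
    p ≫ c ≫ e = p ≫ m ≫ N ≫ G := by
  rw [reassoc_of% h1, h2, reassoc_of% ht, reassoc_of% h5, reassoc_of% h3, h4]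

lemma extOpIso_comp {n : ℕ} {k : Fin n → ℕ} {a : Fin n → C} {b : ∀ i, Fin (k i) → C} {t : C}
    (f : OrthTuple P a t) (g : ∀ i, OrthTuple P (b i) (a i))
    (X : ∀ i j, PrLin.mod K (A.alg (b i j))) :
    (B.compIso f g (fun i j => (extFunctor φ (b i j)).obj (X i j))).hom ≫
      (extOpIso φ (f.comp g) (fun p => X (seq k p).1 (seq k p).2)).hom =
    (B.op f).mapFam (fun i => (extOpIso φ (g i) (X i)).hom) ≫
      (extOpIso φ f (fun i => (A.op (g i)).obj (X i))).hom ≫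
        (extFunctor φ t).map (A.inclData.compIso f g X).hom := by
  refine mapFam_mapFam_extGen_ext φ f g fun x => ?_
  have h1 := B.comp_naturality f g (fun i j => extGen φ (x i j))
  have h2 := mapFam_extGen φ (f.comp g) (X := fun p => X (seq k p).1 (seq k p).2)
    (fun p => x (seq k p).1 (seq k p).2)
  have h3 := mapFam_extGen φ f (X := fun i => (A.op (g i)).obj (X i))
    (fun i => A.gen (g i) (X i) (x i))
  have h4 := extGen_map φ (A.inclData.compIso f g X).hom
    (A.gen f (fun i => (A.op (g i)).obj (X i)) (fun i => A.gen (g i) (X i) (x i)))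
  have h5 : (B.op f).mapFam (fun i => (B.op (g i)).mapFam (fun j => extGen φ (x i j))) ≫
      (B.op f).mapFam (fun i => (extOpIso φ (g i) (X i)).hom) =
        (B.op f).mapFam (fun i => (B.theta (g i)).hom) ≫
          (B.op f).mapFam (fun i => extGen φ (A.gen (g i) (X i) (x i))) := by
    rw [← MultFunctor.mapFam_comp, ← MultFunctor.mapFam_comp]
    simp only [mapFam_extGen]
  exact comp_chase h1 h2 (B.theta_comp f g) h5 h3
    (h4.trans (congrArg (extGen φ) (A.ev_compIso f g X x)))

lemma extOpIso_one (t : C) (X : Fin 1 → PrLin.mod K (A.alg t)) :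
    (B.unitIso t (fun i => (extFunctor φ t).obj (X i))).hom ≫
      (extOpIso φ (OrthTuple.one P t) X).hom =
    (extFunctor φ t).map (A.inclData.unitIso t X).hom := by
  refine adj_hom_ext (tensorAdj (truncComp φ t)) fun x => ?_
  obtain ⟨m, rfl⟩ : ∃ m : ∀ i, El (X i), m 0 = x :=
    ⟨Function.update (fun i => (0 : asMod (X i))) 0 x, by simp⟩
  have h1 := B.unit_naturality t (fun i => extGen φ (m i))
  have h2 := mapFam_extGen φ (OrthTuple.one P t) m
  have h3 := extGen_map φ (A.inclData.unitIso t X).hom (m 0)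
  rw [ev_unitIso] at h3
  refine Eq.trans ?_ h3.symm
  rw [← Category.assoc]
  refine (congrArg (· ≫ (extOpIso φ (OrthTuple.one P t) X).hom) h1).trans ?_
  rw [Category.assoc, h2, ← Category.assoc, B.theta_one, Category.id_comp]
  rfl

/-- This is `comp_chase` with trivial coherences of the inner factorization products. -/
lemma extOpIso_perm {n m : ℕ} {c : Fin n → C} {t : C} (f : OrthTuple P c t) (σ : Fin m ≃ Fin n)
    (X : ∀ i, PrLin.mod K (A.alg (c i))) :
    (B.permIso f σ (fun i => (extFunctor φ (c i)).obj (X i))).hom ≫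
      (extOpIso φ (f.reindex σ) (fun j => X (σ j))).hom =
    (extOpIso φ f X).hom ≫ (extFunctor φ t).map (A.inclData.permIso f σ X).hom := by
  refine mapFam_extGen_ext φ f fun x => ?_
  have h1 := B.perm_naturality f σ (fun i => extGen φ (x i))
  have h2 := mapFam_extGen φ (f.reindex σ) (X := fun j => X (σ j)) (fun j => x (σ j))
  have h4 := extGen_map φ (A.inclData.permIso f σ X).hom (A.gen f X x)
  have h5 : (B.op f).mapFam (fun i => extGen φ (x i)) ≫ 𝟙 _ = 𝟙 _ ≫
      (B.op f).mapFam (fun i => extGen φ (x i)) := by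
    rw [Category.comp_id, Category.id_comp]
  have h6 := comp_chase h1 h2 ((B.theta_perm f σ).trans (Category.id_comp _).symm) h5
    (mapFam_extGen φ f x) (h4.trans (congrArg (extGen φ) (A.ev_permIso f σ X x)))
  exact h6.trans (congrArg (_ ≫ ·) (Category.id_comp _))

/-- The 1-morphism `ι A ⟶ B` which corresponds to a morphism `φ : A ⟶ π B`; its components are the
functors `(-) ⊗_{A(c)} b_c`. -/
noncomputable def extend : A.incl ⟶ B :=
  TwoAQFT.Hom.mk (A := A.incl) (B := B)
    (app := fun c => extFunctor φ c)
    (natIso := fun f X => extOpIso φ f X)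
    (naturality := fun f _ _ h => extOpIso_naturality φ f h)
    (natIso_comp := fun f g X => extOpIso_comp φ f g X)
    (natIso_one := fun t X => extOpIso_one φ t X)
    (natIso_perm := fun f σ X => extOpIso_perm φ f σ X)

lemma ptCompare_extend_aux {D : Type*} [Category D] {x y z p : D} {e : p = y} {e₁ : x = y}
    {e₂ : x = p} {N : y ⟶ z} {g : p ⟶ z} (h : eqToHom e₁ ≫ N = eqToHom e₂ ≫ g) :
    eqToHom e ≫ N = g := by
  subst e e₁
  simpa using h

/-- The comparison of pointings is the canonical isomorphism `b_c ≅ A(c) ⊗_{A(c)} b_c`. -/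
lemma ptCompare_extend (c : C) : (ptCompare (extend φ) c).hom = extGen φ (A.ptGen c) := by
  have h1 := mapFam_extGen φ (OrthTuple.star P c) (X := fun i => i.elim0) (fun i => i.elim0)
  rw [B.theta_star, B.mapFam_empty rfl] at h1
  exact ptCompare_extend_aux (e := (B.op_empty rfl (OrthTuple.star P c) _).symm) h1

lemma mate_extend (c : C) : mate (extend φ) c = truncComp φ c := by
  ext a
  rw [mate_apply, ← Category.assoc]
  refine (Iso.comp_inv_eq _).mpr ?_
  rw [ptCompare_extend]
  refine (extGen_map φ _ _).trans ?_
  rw [ev_elem, extGen_op_smul]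
  rfl

lemma unitHom_truncHom_extend : A.unitHom ≫ TwoAQFT.truncHom (extend φ) = φ := by
  apply ObjectProperty.hom_ext
  ext c a
  exact DFunLike.congr_fun (mate_extend φ c) a

end
end AQFT

/-! ### The unit is invertible -/

namespace AQFT
variable {K : Type w} [Field K] {C : Type u} [Category.{v} C] {P : Orthogonality C}
variable {A A' : AQFT K P} {B B' : TwoAQFT K P}

variable (A) in
/-- Endomorphisms of the free right module of rank one are left multiplications. -/
lemma unitApp_bijective (c : C) : Function.Bijective (A.unitApp c) := by
  constructor
  · intro a b h
    let q := (A.isFreeGenerator_ptGen c).hom (freeOne (K := K) (A.alg c))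
    have h1 : MulOpposite.op a • A.ptGen c = MulOpposite.op b • A.ptGen c := by
      rw [← ev_unitApp, ← ev_unitApp, h]
    have h2 := congrArg (ev q) h1
    rw [ev_op_smul, ev_op_smul, (A.isFreeGenerator_ptGen c).ev_hom] at h2
    exact MulOpposite.op_injective
      ((mul_one (MulOpposite.op a)).symm.trans (Eq.trans h2 (mul_one (MulOpposite.op b))))
  · intro g
    obtain ⟨a, ha⟩ := A.span_ptGen c (ev (R := A.alg c) (M := A.ptMod c) (N := A.ptMod c) g
      (A.ptGen c))
    exact ⟨a, A.pt_ext ((A.ev_unitApp c a).trans ha.symm)⟩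

instance isIso_unitHom : IsIso A.unitHom := by
  have h1 : ∀ c, IsIso (A.unitHom.hom.app c) := fun c =>
    (ConcreteCategory.isIso_iff_bijective _).mpr (A.unitApp_bijective c)
  have h2 : IsIso A.unitHom.hom := NatIso.isIso_of_isIso_app _
  exact ⟨ObjectProperty.homMk (CategoryTheory.inv A.unitHom.hom),
    ObjectProperty.hom_ext _ (IsIso.hom_inv_id A.unitHom.hom),
    ObjectProperty.hom_ext _ (IsIso.inv_hom_id A.unitHom.hom)⟩

lemma exists_unitHom_comp (g : A.incl.trunc ⟶ A'.incl.trunc) :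
    ∃ ζ : A ⟶ A', ζ ≫ A'.unitHom = A.unitHom ≫ g :=
  ⟨A.unitHom ≫ g ≫ CategoryTheory.inv A'.unitHom, by
    rw [Category.assoc, Category.assoc, IsIso.inv_hom_id, Category.comp_id]⟩

/-! ### Universal property of the unit -/

/-- 1-morphisms out of `ι A` are determined up to isomorphism by the morphism `π(ζ) ∘ η_A`. -/
lemma nonempty_iso {ζ κ : A.incl ⟶ B}
    (h : A.unitHom ≫ TwoAQFT.truncHom ζ = A.unitHom ≫ TwoAQFT.truncHom κ) : Nonempty (ζ ≅ κ) :=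
  exists_iso fun c => AlgHom.ext fun a =>
    congrArg (fun g : A ⟶ B.trunc => comp g c a) h

/-- Naturality of the counit, whose component at `B` is the extension of the identity of `π B`:
both sides correspond to `π(g)`. -/
lemma nonempty_counit_iso (g : B ⟶ B') :
    Nonempty (inclHom (TwoAQFT.truncHom g) ≫ extend (𝟙 B'.trunc) ≅ extend (𝟙 B.trunc) ≫ g) := by
  apply nonempty_iso
  rw [TwoAQFT.truncHom_comp, TwoAQFT.truncHom_comp, ← Category.assoc, ← unitHom_naturality,
    Category.assoc, unitHom_truncHom_extend, ← Category.assoc, unitHom_truncHom_extend,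
    Category.comp_id, Category.id_comp]

/-- The left triangle: both sides correspond to `η_A`. -/
lemma nonempty_left_iso (A : AQFT K P) :
    Nonempty (inclHom A.unitHom ≫ extend (𝟙 A.incl.trunc) ≅ 𝟙 A.incl) := by
  apply nonempty_iso
  rw [TwoAQFT.truncHom_comp, ← Category.assoc, ← unitHom_naturality, Category.assoc,
    unitHom_truncHom_extend, TwoAQFT.truncHom_id]

end AQFT

/-! ### Biadjunctions with unique 2-morphisms -/

section
open Bicategory

universe w₂ v₁ v₂ u₁ u₂

/-- A biadjunction out of a category `E`, regarded as a 2-category with only identity 2-morphisms,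
in the case where parallel 2-morphisms between 1-morphisms `L a ⟶ b` are equal.  All equations
between 2-morphisms are then automatic. -/
def Biadjunction.ofSubsingleton {E : Type u₁} [Category.{v₁} E] {D : Type u₂}
    [Bicategory.{w₂, v₂} D] {L : Pseudofunctor (LocallyDiscrete E) D}
    {R : Pseudofunctor D (LocallyDiscrete E)}
    (unit : Pseudofunctor.StrongTrans (Pseudofunctor.id (LocallyDiscrete E)) (L.comp R))
    (counit : ∀ b : D, L.obj (R.obj b) ⟶ b)
    (naturality : ∀ {b b' : D} (g : b ⟶ b'), L.map (R.map g) ≫ counit b' ≅ counit b ≫ g)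
    (left : ∀ a, L.map (unit.app a) ≫ counit (L.obj a) ≅ 𝟙 (L.obj a))
    (right : ∀ b : D, unit.app (R.obj b) ≫ R.map (counit b) ≅ 𝟙 (R.obj b))
    (h : ∀ (a : LocallyDiscrete E) (b : D) (ζ κ : L.obj a ⟶ b), Subsingleton (ζ ⟶ κ)) :
    Biadjunction L R where
  unit := unit
  counit :=
    { app := counit
      naturality := naturality
      naturality_naturality := fun _ => (h _ _ _ _).elim _ _
      naturality_id := fun _ => (h _ _ _ _).elim _ _
      naturality_comp := fun _ _ => (h _ _ _ _).elim _ _ }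
  left := left
  right := right
  left_naturality _ := (h _ _ _ _).elim _ _
  right_naturality _ := LocallyDiscrete.subsingleton2Hom _ _ |>.elim _ _
  swallowtail_unit _ := LocallyDiscrete.subsingleton2Hom _ _ |>.elim _ _
  swallowtail_counit _ := (h _ _ _ _).elim _ _

end

/-! ### The biadjunction `ι ⊣ π` -/

open AQFT
variable {K : Type w} [Field K] {C : Type u} [Category.{v} C] {P : Orthogonality C}

/-- The extension of `φ` is a preimage of `φ`, and 1-morphisms with the same image are isomorphic
by a unique 2-morphism. -/
instance isEquivalence_homComparison (A : LocallyDiscrete (AQFT K P)) (B : TwoAQFT K P) :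
    (homComparison (truncationUnit K P) A B).IsEquivalence where
  faithful := ⟨fun _ => hom₂_eq (A := A.as) _ _⟩
  full := ⟨fun {ζ κ} Γ => by
    obtain ⟨e⟩ := nonempty_iso (A := A.as) (ζ := ζ) (κ := κ) (Discrete.eq_of_hom Γ)
    exact ⟨e.hom, Subsingleton.elim (α := Discrete.mk _ ⟶ Discrete.mk _) _ _⟩⟩
  essSurj := ⟨fun φ => ⟨extend φ.as, ⟨eqToIso
    (Discrete.ext (unitHom_truncHom_extend φ.as))⟩⟩⟩

/-- Since `η` is natural and invertible, a 1-morphism `κ : ι A ⟶ ι A'` is isomorphic to the image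
of the conjugate of `π(κ)` by `η`, and morphisms with isomorphic images are equal. -/
lemma isEquivalence_mapFunctor_inclusion (A A' : LocallyDiscrete (AQFT K P)) :
    ((inclusion K P).mapFunctor A A').IsEquivalence where
  faithful := ⟨fun _ => Subsingleton.elim (α := Discrete.mk _ ⟶ Discrete.mk _) _ _⟩
  full := ⟨fun {ζ κ} Γ => by
    have h : ζ.as ≫ A'.as.unitHom = κ.as ≫ A'.as.unitHom := by
      rw [unitHom_naturality, unitHom_naturality]
      exact congrArg (A.as.unitHom ≫ ·) (TwoAQFT.truncHom_eq Γ)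
    exact ⟨eqToHom (Discrete.ext ((cancel_mono _).mp h)), hom₂_eq (A := A.as) _ _⟩⟩
  essSurj := ⟨fun κ => by
    obtain ⟨ζ, hζ⟩ := exists_unitHom_comp (A := A.as) (A' := A'.as) (TwoAQFT.truncHom κ)
    exact ⟨⟨ζ⟩, nonempty_iso (A := A.as) ((unitHom_naturality ζ).symm.trans hζ)⟩⟩

/-- The biadjunction `ι ⊣ π` with unit `η`.  The component of the counit at `B` is the extension of
the identity of `π B`, that is, the family of functors `(-) ⊗_{End(b_c)} b_c`. -/
noncomputable def inclusionAdjunction (K : Type w) [Field K] {C : Type u} [Category.{v} C]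
    (P : Orthogonality C) : Biadjunction (inclusion K P) (truncation K P) :=
  Biadjunction.ofSubsingleton (truncationUnit K P) (fun B => extend (𝟙 B.trunc))
    (fun g => (nonempty_counit_iso g).some) (fun A => (nonempty_left_iso A.as).some)
    (fun B => eqToIso (Discrete.ext (unitHom_truncHom_extend (𝟙 B.trunc))))
    (fun A _ _ _ => ⟨fun Γ Γ' => hom₂_eq (A := A.as) Γ Γ'⟩)

end QFT

theorem mainTheorem1 {K : Type w} [Field K] [CharZero K] {C : Type u} [Category.{v} C]
    (P : QFT.Orthogonality C) :
    (∀ (A : LocallyDiscrete (QFT.AQFT K P)) (B : QFT.TwoAQFT K P),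
      (QFT.homComparison (QFT.truncationUnit K P) A B).IsEquivalence) ∧
    (∃ adj : QFT.Biadjunction (QFT.inclusion K P) (QFT.truncation K P),
      adj.unit = QFT.truncationUnit K P) ∧
    (∀ A : QFT.AQFT K P, IsIso ((QFT.truncationUnit K P).app ⟨A⟩).as) ∧
    (∀ A A' : LocallyDiscrete (QFT.AQFT K P),
      ((QFT.inclusion K P).mapFunctor A A').IsEquivalence) :=
  ⟨fun A B => QFT.isEquivalence_homComparison A B, ⟨QFT.inclusionAdjunction K P, rfl⟩,
    fun A => QFT.AQFT.isIso_unitHom (A := A), QFT.isEquivalence_mapFunctor_inclusion⟩
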